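/- **Setting.** Let $\mu>0$, $\lambda+\mu>0$, $\rho>0$, $\omega\in\mathbb R\setminus\{0\}$, $p,q\ge 0$, $\alpha\in[0,1]$. Put $$C_{ijkl}=\lambda\delta_{ij}\delta_{kl}+\mu(\delta_{ik}\delta_{jl}+\delta_{il}\delta_{jk}),\qquad \tilde\omega^2=\frac{1+p(i\omega)^\alpha}{1+q(i\omega)^\alpha}\,\omega^2,$$ and, for a displacement field $v$, $\sigma_{ij}(v)=C_{ijkl}v_{k,l}$, $(Lv)_j=\sigma_{ij}(v)_{,i}+\rho\tilde\omega^2v_j$, and traction $T_j(v)=\sigma_{3j}(v)$; these act on matrix fields column by column. Repeated indices are summed, and $\sqrt{\cdot}$ is the principal complex square root. Let $\tilde\omega=i\sqrt{-\tilde\omega^2}$ (the root with $\operatorname{Im}\tilde\omega\ge0$), $k_1=\tilde\omega\sqrt{\rho/(\lambda+2\mu)}$, $k_2=\tilde\omega\sqrt{\rho/\mu}$. For $r=|x-\xi|$ let $\varphi_a=e^{ik_ar}/r$ $(a=1,2)$ and $$u^*_{ij}(x,\xi)=\frac1{4\pi\mu}\Big\{\frac1{k_2^2}\big[\varphi_2-\varphi_1\big]_{,ij}+\varphi_2\,\delta_{ij}\Big\}.$$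 For $\eta=(\eta_1,\eta_2)\in\mathbb R^2$ let $\beta_1=\sqrt{\eta_1^2+\eta_2^2-k_1^2}$, $\beta_2=\beta_3=\sqrt{\eta_1^2+\eta_2^2-k_2^2}$, $\nu^1=(-\eta_1,-\eta_2,i\beta_1)$, $\nu^2=(-\beta_2,0,i\eta_1)$, $\nu^3=(-\eta_2,\eta_1,0)$, and $e(\eta)=e^{i[\eta_1(x_1-\xi_1)+\eta_2(x_2-\xi_2)]}$. For $\xi_3<0$ put $E_m=e^{\beta_m\xi_3}/\beta_m$, and let $N$ be the matrix $$N=\begin{pmatrix}-2\mu\eta_1\beta_1E_1&-\mu(\beta_2^2+\eta_1^2)E_2&-\mu\eta_2\beta_3E_3\\-2\mu\eta_2\beta_1E_1&-\mu\eta_1\eta_2E_2&\mu\eta_1\beta_3E_3\\ i[(\lambda+2\mu)\beta_1^2-\lambda(\eta_1^2+\eta_2^2)]E_1&2i\mu\eta_1\beta_2E_2&0\end{pmatrix},\qquad \Delta=\det N.$$ With $d^a=(i\eta_1,i\eta_2,-\beta_a)$, $D^1_{ij}=d^1_id^1_j$, $D^2_{ij}=d^2_id^2_j+k_2^2\delta_{ij}$,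 let $$Q_{jk}=\frac{1}{8\pi^2\mu k_2^2}\Big[C_{3jmn}D^2_{mk}d^2_nE_2-C_{3jmn}D^1_{mk}d^1_nE_1\Big];$$ these are the Fourier coefficients of the traction of $u^*$ on $x_3=0$. Let $C^m_k=\Delta_{mk}/\Delta$, where $\Delta_{mk}$ is the determinant of $N$ with its $m$-th column replaced by $-Q_k=-(Q_{1k},Q_{2k},Q_{3k})^t$ (Cramer's rule for $NC_k=-Q_k$). **Hypothesis (H).** If $p\ne q$ and $\alpha\ne0$, then $\Delta(\eta_1,\eta_2)=0$ only for $\eta_1=0$. **Theorem.** Let (H) hold. Then: 1. For $a=1,2$ and $x_3\ne\xi_3$, $\displaystyle\varphi_a(x,\xi)=\frac1{2\pi}\int_{\mathbb R^2}\frac{e^{-\beta_a|x_3-\xi_3|}}{\beta_a}\,e(\eta)\,d\eta$, with an absolutely convergent integral. 2. For every $\xi\in\mathbb R^3$, $u^*(\cdot,\xi)$ is locally integrable and $L(u^*)_{jm}=-\delta_{jm}\delta(x-\xi)$ in the sense of distributions on $\mathbb R^3$. 3. There is a $3\times3$ matrix-valued function $w(x,\xi)$ such that for every $\xi$ with $\xi_3<0$: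 $w(\cdot,\xi)$ is $C^\infty$ in a neighbourhood of each point of $\{x_3\le0\}$ and $L(w)=0$ in $\{x_3<0\}$; and $g=u^*+w$ is locally integrable in $\{x_3<0\}$, satisfies $L(g)_{jm}=-\delta_{jm}\delta(x-\xi)$ there in the sense of distributions, and has zero traction, $T_j(g_{\cdot m})=0$, on $x_3=0$. 4. If moreover $p\ne q$ and $\alpha\ne0$, this $w$ is given for $x_3\le0$ by the absolutely convergent integrals $$w_{jk}(x,\xi)=\int_{\mathbb R^2}\Big(\sum_{m=1}^3C^m_k\,\nu^m_j\,\frac{e^{\beta_m(x_3+\xi_3)}}{\beta_m}\Big)e(\eta)\,d\eta,$$ and $g$ satisfies Sommerfeld's radiation condition along lines parallel to $x_3=0$: for $x_3\le0$, every unit vector $\theta$ with $\theta_3=0$, and $k\in\{k_1,k_2\}$, each component satisfies $t\,(\partial_\theta g-ikg)(x+t\theta,\xi)\to0$ as $t\to\infty$. -/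

import Mathlib

open MeasureTheory Filter Topology
open scoped ContDiff

noncomputable section

/-- Three-dimensional space. The coordinates `x₁, x₂, x₃` are `x 0, x 1, x 2`. -/
abbrev Space3 : Type := EuclideanSpace ℝ (Fin 3)

/-- The horizontal Fourier plane. The coordinates `η₁, η₂` are `η 0, η 1`. -/
abbrev Plane2 : Type := EuclideanSpace ℝ (Fin 2)

/-- The open half-space `x₃ < 0`. -/
def halfSpace : Set Space3 := {x | x 2 < 0}

/-- Partial derivative with respect to the `i`-th coordinate of `ℝ³`. -/
def pd (i : Fin 3) (f : Space3 → ℂ) (x : Space3) : ℂ :=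
  fderiv ℝ f x (EuclideanSpace.single i 1)

/-- Kronecker's delta. -/
def kron (i j : Fin 3) : ℂ := if i = j then 1 else 0

/-- The data of an isotropic fractional Zener medium: Lamé constants `lam`, `mu`, density `rho`,
frequency `omega`, and the viscoelastic coefficients `p`, `q`, `alpha`. -/
structure ZenerMedium where
  lam : ℝ
  mu : ℝ
  rho : ℝ
  omega : ℝ
  p : ℝ
  q : ℝ
  alpha : ℝ

namespace ZenerMedium

variable (M : ZenerMedium)

/-- Elasticity tensor `C_{ijkl} = λ δ_{ij} δ_{kl} + μ (δ_{ik} δ_{jl} + δ_{il} δ_{jk})`. -/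
def C (i j k l : Fin 3) : ℂ :=
  (M.lam : ℂ) * (kron i j * kron k l) + (M.mu : ℂ) * (kron i k * kron j l + kron i l * kron j k)

/-- Square of the damped frequency, `(1 + p (iω)^α) / (1 + q (iω)^α) * ω²`. -/
def dampedSq : ℂ :=
  (1 + (M.p : ℂ) * (Complex.I * (M.omega : ℂ)) ^ (M.alpha : ℂ)) /
    (1 + (M.q : ℂ) * (Complex.I * (M.omega : ℂ)) ^ (M.alpha : ℂ)) * (M.omega : ℂ) ^ 2

/-- The damped frequency: the square root of `dampedSq` with imaginary part `≥ 0`.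
`Complex.sqrt` is the principal square root, with real part `≥ 0` and `√(-a) = i √a` for `a > 0`. -/
def damped : ℂ := Complex.I * Complex.sqrt (-M.dampedSq)

/-- Pressure wave number. -/
def k₁ : ℂ := M.damped * (Real.sqrt (M.rho / (M.lam + 2 * M.mu)) : ℂ)

/-- Shear wave number. -/
def k₂ : ℂ := M.damped * (Real.sqrt (M.rho / M.mu) : ℂ)

/-- Stress `σ_{ij} = C_{ijkl} v_{k,l}` of a displacement field. -/
def stress (v : Fin 3 → Space3 → ℂ) (i j : Fin 3) (x : Space3) : ℂ :=
  ∑ k, ∑ l, M.C i j k l * pd l (v k) x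

/-- The operator `(L v)_j = σ_{ij,i} + ρ ω̃² v_j`. -/
def L (v : Fin 3 → Space3 → ℂ) (j : Fin 3) (x : Space3) : ℂ :=
  (∑ i, pd i (M.stress v i j) x) + (M.rho : ℂ) * M.dampedSq * v j x

/-- Traction `σ_{3j}` of a displacement field, for the normal `(0,0,1)`. -/
def traction (v : Fin 3 → Space3 → ℂ) (j : Fin 3) (x : Space3) : ℂ :=
  M.stress v 2 j x

/-- `G` solves `L(G)_{jm} = -δ_{jm} δ(x - ξ)` in the sense of distributions on the open set `Ω`:
it is locally integrable, and its pairing with `L ψ` is `-ψ_m(ξ)` for every vector-valued test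
function `ψ` on `Ω` (the operator `L` is formally symmetric). -/
def SolvesPointForce (Ω : Set Space3) (ξ : Space3) (G : Space3 → Fin 3 → Fin 3 → ℂ) : Prop :=
  (∀ j m, LocallyIntegrableOn (fun x => G x j m) Ω) ∧
  ∀ ψ : Fin 3 → Space3 → ℂ,
    (∀ j, ContDiff ℝ ∞ (ψ j) ∧ HasCompactSupport (ψ j) ∧ tsupport (ψ j) ⊆ Ω) →
    ∀ m, ∫ x, ∑ j, G x j m * M.L ψ j x = -ψ m ξ

/-- `φ = e^{i k r} / r` with `r = |x - ξ|`. -/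
def sphericalWave (k : ℂ) (ξ x : Space3) : ℂ :=
  Complex.exp (Complex.I * k * (‖x - ξ‖ : ℂ)) / (‖x - ξ‖ : ℂ)

/-- The fundamental solution
`u*_{ij} = (1 / (4πμ)) { [φ₂ / k₂² - φ₁ / k₂²]_{,ij} + φ₂ δ_{ij} }`. -/
def uStar (ξ x : Space3) (i j : Fin 3) : ℂ :=
  1 / (4 * (Real.pi : ℂ) * (M.mu : ℂ)) *
    (pd i (pd j fun y =>
        1 / M.k₂ ^ 2 * sphericalWave M.k₂ ξ y - 1 / M.k₂ ^ 2 * sphericalWave M.k₁ ξ y) x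
      + sphericalWave M.k₂ ξ x * kron i j)

/-- `β = √(η₁² + η₂² - k²)`. -/
def beta (k : ℂ) (η : Plane2) : ℂ := Complex.sqrt ((η 0 : ℂ) ^ 2 + (η 1 : ℂ) ^ 2 - k ^ 2)

/-- The horizontal Fourier kernel `e^{i [η₁ (x₁ - ξ₁) + η₂ (x₂ - ξ₂)]}`. -/
def planeWave (η : Plane2) (ξ x : Space3) : ℂ :=
  Complex.exp (Complex.I *
    ((η 0 : ℂ) * ((x 0 - ξ 0 : ℝ) : ℂ) + (η 1 : ℂ) * ((x 1 - ξ 1 : ℝ) : ℂ)))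

/-- `β₁, β₂, β₃`, with `β₃ = β₂`. -/
def betas (η : Plane2) : Fin 3 → ℂ := ![beta M.k₁ η, beta M.k₂ η, beta M.k₂ η]

/-- The vectors `ν¹ = (-η₁, -η₂, iβ₁)`, `ν² = (-β₂, 0, iη₁)`, `ν³ = (-η₂, η₁, 0)`;
the row index is the number of the vector. -/
def nu (η : Plane2) : Fin 3 → Fin 3 → ℂ :=
  ![![-(η 0 : ℂ), -(η 1 : ℂ), Complex.I * beta M.k₁ η],
    ![-beta M.k₂ η, 0, Complex.I * (η 0 : ℂ)],
    ![-(η 1 : ℂ), (η 0 : ℂ), 0]]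

/-- The factor `e^{β_m ξ₃} / β_m`. -/
def expFactor (ξ : Space3) (η : Plane2) (m : Fin 3) : ℂ :=
  Complex.exp (M.betas η m * (ξ 2 : ℂ)) / M.betas η m

/-- The matrix `N`: its `m`-th column is the traction on `x₃ = 0` of the mode
`ν^m e^{β_m (x₃ + ξ₃)} / β_m` (without the horizontal Fourier kernel). -/
def N (ξ : Space3) (η : Plane2) : Matrix (Fin 3) (Fin 3) ℂ :=
  let lam : ℂ := M.lam
  let mu : ℂ := M.mu
  let η₁ : ℂ := η 0
  let η₂ : ℂ := η 1
  let β₁ := M.betas η 0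
  let β₂ := M.betas η 1
  let β₃ := M.betas η 2
  let E := M.expFactor ξ η
  !![mu * (-2 * η₁ * β₁) * E 0, mu * (-β₂ ^ 2 - η₁ ^ 2) * E 1, mu * (-η₂ * β₃) * E 2;
     mu * (-2 * η₂ * β₁) * E 0, mu * (-η₁ * η₂) * E 1, mu * (η₁ * β₃) * E 2;
     (lam * (-Complex.I * η₁ ^ 2 - Complex.I * η₂ ^ 2)
        + Complex.I * (lam + 2 * mu) * β₁ ^ 2) * E 0,
     (lam * (-Complex.I * η₁ * β₂) + (lam + 2 * mu) * Complex.I * η₁ * β₂) * E 1,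
     0]

/-- The determinant `Δ = det N`. -/
def Delta (ξ : Space3) (η : Plane2) : ℂ := (M.N ξ η).det

/-- Fourier symbol of the gradient acting on `e^{-β (x₃ - ξ₃)}` times the horizontal kernel. -/
def gradSymbol (k : ℂ) (η : Plane2) : Fin 3 → ℂ :=
  ![Complex.I * (η 0 : ℂ), Complex.I * (η 1 : ℂ), -beta k η]

/-- The matrix `D¹` above the source (`x₃ > ξ₃`). -/
def D₁ (η : Plane2) (i j : Fin 3) : ℂ := gradSymbol M.k₁ η i * gradSymbol M.k₁ η j

/-- The matrix `D²` above the source (`x₃ > ξ₃`). -/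
def D₂ (η : Plane2) (i j : Fin 3) : ℂ :=
  gradSymbol M.k₂ η i * gradSymbol M.k₂ η j + M.k₂ ^ 2 * kron i j

/-- The Fourier coefficients `Q_{jk}` of the traction of `u*` on `x₃ = 0`, so that
`T^{u*}_{jk} = ∫ Q_{jk} e^{i [η₁ (x₁ - ξ₁) + η₂ (x₂ - ξ₂)]} dη` there. -/
def Q (ξ : Space3) (η : Plane2) (j k : Fin 3) : ℂ :=
  1 / (4 * (Real.pi : ℂ) * (M.mu : ℂ)) * (1 / (2 * (Real.pi : ℂ))) * (1 / M.k₂ ^ 2) *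
    ((∑ m, ∑ n, M.C 2 j m n * M.D₂ η m k * gradSymbol M.k₂ η n) * M.expFactor ξ η 1
      - (∑ m, ∑ n, M.C 2 j m n * M.D₁ η m k * gradSymbol M.k₁ η n) * M.expFactor ξ η 0)

/-- The solution of `N C_k = -Q_k` by Cramer's rule: `C^m_k = Δ_{mk} / Δ`, where `Δ_{mk}` is the
determinant of `N` with its `m`-th column replaced by `-Q_k = (-Q_{1k}, -Q_{2k}, -Q_{3k})ᵗ`. -/
def coeff (ξ : Space3) (η : Plane2) (m k : Fin 3) : ℂ :=
  ((M.N ξ η).updateCol m (fun j => -M.Q ξ η j k)).det / M.Delta ξ η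

/-- The integrand of the correction term,
`∑_m C^m_k ν^m_j (e^{β_m (x₃ + ξ₃)} / β_m) e^{i [η₁ (x₁ - ξ₁) + η₂ (x₂ - ξ₂)]}`. -/
def wIntegrand (ξ x : Space3) (j k : Fin 3) (η : Plane2) : ℂ :=
  (∑ m, M.coeff ξ η m k * M.nu η m j *
    (Complex.exp (M.betas η m * ((x 2 + ξ 2 : ℝ) : ℂ)) / M.betas η m)) * planeWave η ξ x

/-- The integrand of the plane-wave expansion of `e^{i k r} / r`. -/
def waveIntegrand (k : ℂ) (ξ x : Space3) (η : Plane2) : ℂ :=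
  Complex.exp (-beta k η * ((|x 2 - ξ 2| : ℝ) : ℂ)) / beta k η * planeWave η ξ x

/-- Hypothesis (H): if `p ≠ q` and `α ≠ 0`, then `Δ` vanishes only for `η₁ = 0`.
(The source enters `Δ` only through a factor that never vanishes.) -/
def HypothesisH : Prop :=
  M.p ≠ M.q → M.alpha ≠ 0 → ∀ ξ ∈ halfSpace, ∀ η : Plane2, M.Delta ξ η = 0 → η 0 = 0

/-- Sommerfeld's radiation condition, for the wave number `k`, along all lines in the closed
half-space `x₃ ≤ 0` that are parallel to `x₃ = 0`. -/
def RadiatesHorizontally (k : ℂ) (f : Space3 → ℂ) : Prop :=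
  ∀ x θ : Space3, x 2 ≤ 0 → θ 2 = 0 → ‖θ‖ = 1 →
    Tendsto (fun t : ℝ =>
      (t : ℂ) * (fderiv ℝ f (x + t • θ) θ - Complex.I * k * f (x + t • θ))) atTop (𝓝 0)

end ZenerMedium

end

/-! Horizontal plane waves reduce the half-space problem to algebra for each wave vector η.

Plane-wave expansion. For s = -k² > 0 the function e^{-βz}/β is a superposition of Gaussians in η,
whose Fourier transforms add up to e^{-√s r}/r. Both sides are holomorphic in s off the negative
axis, which gives all nonreal s, and real k is reached as a limit from above (`weyl_expansion`).

Whole space. The Hessian of e^{ikr}/r is of order r^{-3}, but its leading term does not depend on k,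
so the Hessian of φ₂ - φ₁ is O(1/r). Replacing r² by r² + e and letting e → 0 shows that this
pointwise Hessian is also the distributional one (`integral_pd_pd_diff`) and that (Δ + k²)φ = -4πδ
(`integral_sphericalWave_helmholtz`). With μk₂² = (λ+2μ)k₁² = ρω̃² these facts give
`IsRegular.solvesPointForce_uStar`.

Correction. Above the source u* is a superposition of upgoing modes e^{-βx₃} whose traction at x₃ =
0 has Fourier coefficients Q (`uStar_eq_upField`). To cancel Q one seeks modes e^{βx₃}: a pressure
amplitude A and a transverse shear amplitude with vertical component V. Once the horizontal shear
components are eliminated, A and V solve a 2×2 system with determinant -μ²R, where R = 4|η|²β₁β₂ -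
(|η|² + β₂²)² is the Rayleigh function. For large |η| it satisfies |R| ≥ 1, because λ + μ > 0 makes
k₁² and k₂² different (`exists_one_le_norm_rayleigh`).

In the elastic case R and the β's may vanish at bounded η. No decay of w is claimed there, so on the
bounded set of bad η the correction simply subtracts the modes of u* itself. They solve the
homogeneous equation everywhere, and a bounded set of wave vectors causes no convergence problem.
Thus `correction` uses the solved modes on a good open set S and the negated upgoing modes on its
complement. The tractions ∫Q, -∫_S Q and -∫_{Sᶜ} Q add up to zero.

In the viscoelastic case -k₁² and -k₂² are nonreal, so the β's stay away from zero. Since Δ is η₁R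
times factors without influence here, and R is radial, (H) excludes all zeros of R; so S is the
whole plane (`isGoodSet_univ`). Off the null line η₁ = 0 Cramer's rule yields the same amplitudes
(`coeff_eq_down`). For the radiation condition both g and its derivatives are o(1/t): the waves in
u* decay exponentially because Im k > 0, and the Fourier integrals of w gain a factor 1/t by one
integration by parts followed by the Riemann–Lebesgue lemma (`SymbolOn.tendsto_mul_integral`). -/

noncomputable section

/-! ### Partial derivatives on three-dimensional space -/

/-- The real-linear form on `ℝ³` with the complex coefficients `a`. -/
def gradL (a : Fin 3 → ℂ) : Space3 →L[ℝ] ℂ :=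
  ∑ i, (EuclideanSpace.proj i : Space3 →L[ℝ] ℝ).smulRight (a i)

lemma gradL_apply (a : Fin 3 → ℂ) (v : Space3) : gradL a v = ∑ i, (v i : ℂ) * a i := by
  simp [gradL]

lemma gradL_single (a : Fin 3 → ℂ) (i : Fin 3) : gradL a (EuclideanSpace.single i 1) = a i := by
  fin_cases i <;> simp [gradL_apply, Fin.sum_univ_three]

lemma norm_gradL_le (a : Fin 3 → ℂ) : ‖gradL a‖ ≤ ∑ i, ‖a i‖ := by
  refine (norm_sum_le _ _).trans (Finset.sum_le_sum fun i _ => ?_)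
  rw [ContinuousLinearMap.norm_smulRight_apply]
  refine mul_le_of_le_one_left (norm_nonneg _) ?_
  refine ContinuousLinearMap.opNorm_le_bound _ zero_le_one fun v => ?_
  simpa using PiLp.norm_apply_le v i

lemma clm_eq_gradL (T : Space3 →L[ℝ] ℂ) :
    T = gradL fun i => T (EuclideanSpace.single i 1) := by
  ext v
  have hv : v = ∑ i, v i • EuclideanSpace.single i (1 : ℝ) := by
    ext j
    fin_cases j <;> simp [Fin.sum_univ_three]
  conv_lhs => rw [hv]
  simp [gradL_apply]

lemma fderiv_eq_gradL (f : Space3 → ℂ) (x : Space3) : fderiv ℝ f x = gradL fun i => pd i f x :=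
  clm_eq_gradL _

lemma HasFDerivAt.pd_eq {f : Space3 → ℂ} {a : Fin 3 → ℂ} {x : Space3}
    (h : HasFDerivAt f (gradL a) x) (i : Fin 3) : pd i f x = a i := by
  rw [pd, h.fderiv, gradL_single]

lemma pd_add {f g : Space3 → ℂ} {x : Space3} (hf : DifferentiableAt ℝ f x)
    (hg : DifferentiableAt ℝ g x) (i : Fin 3) :
    pd i (fun y => f y + g y) x = pd i f x + pd i g x := by
  simp [pd, fderiv_fun_add hf hg]

lemma pd_sub {f g : Space3 → ℂ} {x : Space3} (hf : DifferentiableAt ℝ f x)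
    (hg : DifferentiableAt ℝ g x) (i : Fin 3) :
    pd i (fun y => f y - g y) x = pd i f x - pd i g x := by
  simp [pd, fderiv_fun_sub hf hg]

lemma pd_const_mul {f : Space3 → ℂ} {x : Space3} (hf : DifferentiableAt ℝ f x) (c : ℂ)
    (i : Fin 3) : pd i (fun y => c * f y) x = c * pd i f x := by
  simp [pd, fderiv_const_mul hf]

lemma pd_mul {f g : Space3 → ℂ} {x : Space3} (hf : DifferentiableAt ℝ f x)
    (hg : DifferentiableAt ℝ g x) (i : Fin 3) :
    pd i (fun y => f y * g y) x = f x * pd i g x + pd i f x * g x := by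
  simp [pd, fderiv_fun_mul hf hg, mul_comm]

lemma pd_sum {ι : Type*} (s : Finset ι) {f : ι → Space3 → ℂ} {x : Space3}
    (hf : ∀ k ∈ s, DifferentiableAt ℝ (f k) x) (i : Fin 3) :
    pd i (fun y => ∑ k ∈ s, f k y) x = ∑ k ∈ s, pd i (f k) x := by
  simp [pd, fderiv_fun_sum hf]

lemma Filter.EventuallyEq.pd_eventuallyEq {f g : Space3 → ℂ} {x : Space3} (h : f =ᶠ[𝓝 x] g)
    (i : Fin 3) : pd i f =ᶠ[𝓝 x] pd i g := by
  filter_upwards [h.fderiv (𝕜 := ℝ)] with y hy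
  simp [pd, hy]

lemma ContDiffAt.pd_infty {f : Space3 → ℂ} {x : Space3} (hf : ContDiffAt ℝ ∞ f x) (i : Fin 3) :
    ContDiffAt ℝ ∞ (pd i f) x :=
  (hf.fderiv_right (m := ∞) (by simp)).clm_apply contDiffAt_const

lemma ContDiff.pd_infty {f : Space3 → ℂ} (hf : ContDiff ℝ ∞ f) (i : Fin 3) :
    ContDiff ℝ ∞ (pd i f) :=
  contDiff_iff_contDiffAt.2 fun _ => hf.contDiffAt.pd_infty i

lemma ContDiffAt.differentiableAt_infty {f : Space3 → ℂ} {x : Space3} (hf : ContDiffAt ℝ ∞ f x) :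
    DifferentiableAt ℝ f x :=
  hf.differentiableAt (by simp)

lemma pd_comm {f : Space3 → ℂ} {x : Space3} (hf : ContDiffAt ℝ ∞ f x) (i j : Fin 3) :
    pd i (pd j f) x = pd j (pd i f) x := by
  have h1 : DifferentiableAt ℝ (fderiv ℝ f) x :=
    (hf.fderiv_right (m := ∞) (by simp)).differentiableAt (by simp)
  have key : ∀ i j, pd i (pd j f) x =
      fderiv ℝ (fderiv ℝ f) x (EuclideanSpace.single i 1) (EuclideanSpace.single j 1) := by
    intro i j
    have : HasFDerivAt (pd j f)
        ((fderiv ℝ (fderiv ℝ f) x).flip (EuclideanSpace.single j 1)) x := by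
      refine (h1.hasFDerivAt.clm_apply
        (hasFDerivAt_const (EuclideanSpace.single j (1 : ℝ)) x)).congr_fderiv ?_
      simp
    rw [pd, this.fderiv]
    rfl
  rw [key, key]
  exact (hf.isSymmSndFDerivAt (by
    rw [minSmoothness_of_isRCLikeNormedField]
    exact WithTop.coe_le_coe.2 (le_top : (2 : ℕ∞) ≤ ⊤))).eq _ _

lemma tsupport_pd_subset (f : Space3 → ℂ) (i : Fin 3) : tsupport (pd i f) ⊆ tsupport f :=
  tsupport_fderiv_apply_subset ℝ _

lemma HasCompactSupport.pd {f : Space3 → ℂ} (hf : HasCompactSupport f) (i : Fin 3) :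
    HasCompactSupport (pd i f) :=
  hf.fderiv_apply ℝ _

/-! ### The elastic operator in expanded form -/

namespace ZenerMedium

variable (M : ZenerMedium)

lemma stress_eq (v : Fin 3 → Space3 → ℂ) (i j : Fin 3) (x : Space3) :
    M.stress v i j x = M.lam * kron i j * (∑ k, pd k (v k) x) +
      M.mu * (pd j (v i) x + pd i (v j) x) := by
  fin_cases i <;> fin_cases j <;>
    simp [stress, C, kron, Fin.sum_univ_three] <;> ring

/-- Navier's form of the operator, on which all later computations rest. Smoothness enters through
the symmetry of second derivatives, which turns ∂_i∂_j v_i into ∂_j∂_i v_i. -/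
lemma L_eq {v : Fin 3 → Space3 → ℂ} {x : Space3} (hv : ∀ j, ContDiffAt ℝ ∞ (v j) x)
    (j : Fin 3) :
    M.L v j x = (M.lam + M.mu) * (∑ i, pd j (pd i (v i)) x) + M.mu * (∑ i, pd i (pd i (v j)) x)
      + M.rho * M.dampedSq * v j x := by
  have hd : ∀ i k, DifferentiableAt ℝ (pd i (v k)) x :=
    fun i k => ((hv k).pd_infty i).differentiableAt_infty
  have hst : ∀ i, pd i (M.stress v i j) x = M.lam * kron i j * (∑ k, pd i (pd k (v k)) x) +
      M.mu * (pd j (pd i (v i)) x + pd i (pd i (v j)) x) := by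
    intro i
    have e : M.stress v i j = fun x => M.lam * kron i j * (∑ k, pd k (v k) x) +
      M.mu * (pd j (v i) x + pd i (v j) x) := funext fun y => M.stress_eq v i j y
    rw [e, pd_add, pd_const_mul, pd_const_mul, pd_add (hd _ _) (hd _ _),
      pd_sum _ (fun k _ => hd k k), pd_comm (hv i) i j]
    · exact (hd _ _).add (hd _ _)
    · exact DifferentiableAt.fun_sum fun k _ => hd k k
    · exact (DifferentiableAt.fun_sum fun k _ => hd k k).const_mul _
    · exact ((hd _ _).add (hd _ _)).const_mul _
  simp_rw [L, hst]
  fin_cases j <;> simp [kron, Fin.sum_univ_three] <;> ring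

end ZenerMedium

/-! ### Smoothness of parameter integrals -/

/-- A family of functions `f j a`, depending on a parameter `a`, that is closed under partial
derivatives and dominated locally uniformly on `U`, with the data needed to differentiate its
integral. -/
structure DominatedFamily {Ω J : Type*} [MeasurableSpace Ω] (μ : Measure Ω) (U : Set Space3)
    (D : Fin 3 → J → J) (f : J → Ω → Space3 → ℂ) : Prop where
  deriv : ∀ j, ∀ᵐ a ∂μ, ∀ x ∈ U, HasFDerivAt (f j a) (gradL fun i => f (D i j) a x) x
  meas : ∀ j, ∀ x ∈ U, AEStronglyMeasurable (fun a => f j a x) μ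
  bound : ∀ j, ∀ x ∈ U, ∃ V ∈ 𝓝 x, ∃ g : Ω → ℝ, Integrable g μ ∧ ∀ᵐ a ∂μ, ∀ y ∈ V, ‖f j a y‖ ≤ g a

namespace DominatedFamily

variable {Ω J : Type*} [MeasurableSpace Ω] {μ : Measure Ω} {U : Set Space3}
  {D : Fin 3 → J → J} {f : J → Ω → Space3 → ℂ}

lemma integrable (h : DominatedFamily μ U D f) (j : J) {x : Space3} (hx : x ∈ U) :
    Integrable (fun a => f j a x) μ := by
  obtain ⟨V, hV, g, hg, hb⟩ := h.bound j x hx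
  refine hg.mono' (h.meas j x hx) ?_
  filter_upwards [hb] with a ha using ha x (mem_of_mem_nhds hV)

/-- Differentiation under the integral sign. The three partial derivatives are again members of the
family, so the sum of their majorants, on the intersection of their neighbourhoods, dominates the
whole gradient. -/
lemma hasFDerivAt (h : DominatedFamily μ U D f) (hU : IsOpen U) (j : J) {x : Space3}
    (hx : x ∈ U) :
    HasFDerivAt (fun y => ∫ a, f j a y ∂μ) (gradL fun i => ∫ a, f (D i j) a x ∂μ) x := by
  choose V hV g hg hb using fun i => h.bound (D i j) x hx
  have hs : (⋂ i, V i) ∩ U ∈ 𝓝 x :=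
    inter_mem ((Filter.iInter_mem).2 hV) (hU.mem_nhds hx)
  have hF'm : AEStronglyMeasurable (fun a => gradL fun i => f (D i j) a x) μ := by
    have hc : Continuous gradL := by
      unfold gradL
      refine continuous_finsetSum _ fun i _ => ?_
      exact ((ContinuousLinearMap.smulRightL ℝ Space3 ℂ
        (EuclideanSpace.proj i)).continuous).comp (continuous_apply i)
    refine hc.comp_aestronglyMeasurable ?_
    exact (aemeasurable_pi_lambda _ fun i => (h.meas (D i j) x hx).aemeasurable).aestronglyMeasurable
  have key := hasFDerivAt_integral_of_dominated_of_fderiv_le (𝕜 := ℝ) (μ := μ)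
    (F := fun y a => f j a y) (F' := fun y a => gradL fun i => f (D i j) a y)
    (bound := fun a => ∑ i, g i a) hs
    (by filter_upwards [hU.mem_nhds hx] with y hy using h.meas j y hy)
    (h.integrable j hx) hF'm
    (by
      filter_upwards [ae_all_iff.2 hb] with a ha y hy
      exact (norm_gradL_le _).trans
        (Finset.sum_le_sum fun i _ => ha i y (Set.mem_iInter.1 hy.1 i)))
    (integrable_finsetSum _ fun i _ => hg i)
    (by filter_upwards [h.deriv j] with a ha y hy using ha y hy.2)
  refine key.congr_fderiv ?_
  have hi : ∀ i, Integrable (fun a => f (D i j) a x) μ := fun i => h.integrable (D i j) hx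
  have hI : Integrable (fun a => gradL fun i => f (D i j) a x) μ := by
    refine (integrable_finsetSum Finset.univ fun i _ => (hi i).norm).mono' hF'm
      (ae_of_all _ fun a => norm_gradL_le _)
  rw [clm_eq_gradL (∫ a, gradL (fun i => f (D i j) a x) ∂μ)]
  congr 1
  ext i
  rw [ContinuousLinearMap.integral_apply hI]
  simp [gradL_single]

lemma pd_integral (h : DominatedFamily μ U D f) (hU : IsOpen U) (j : J) {x : Space3}
    (hx : x ∈ U) (i : Fin 3) :
    pd i (fun y => ∫ a, f j a y ∂μ) x = ∫ a, f (D i j) a x ∂μ :=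
  (h.hasFDerivAt hU j hx).pd_eq i

/-- The induction runs over all indices at once: the derivative of the integral with index `j` is
built from the integrals with indices `D i j`, to which the induction hypothesis applies. -/
lemma contDiffOn_nat (h : DominatedFamily μ U D f) (hU : IsOpen U) (n : ℕ) (j : J) :
    ContDiffOn ℝ n (fun y => ∫ a, f j a y ∂μ) U := by
  induction n generalizing j with
  | zero =>
    exact contDiffOn_zero.2 fun x hx =>
      (h.hasFDerivAt hU j hx).continuousAt.continuousWithinAt
  | succ n ih =>
    push_cast
    rw [contDiffOn_succ_iff_fderiv_of_isOpen hU]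
    refine ⟨fun x hx => (h.hasFDerivAt hU j hx).differentiableAt.differentiableWithinAt,
      by simp, ?_⟩
    have : ContDiffOn ℝ n (fun x => gradL fun i => ∫ a, f (D i j) a x ∂μ) U := by
      unfold gradL
      refine ContDiffOn.sum fun i _ => ?_
      exact (ContinuousLinearMap.smulRightL ℝ Space3 ℂ
        (EuclideanSpace.proj i)).contDiff.comp_contDiffOn (ih (D i j))
    exact this.congr fun x hx => (h.hasFDerivAt hU j hx).fderiv

lemma contDiffAt (h : DominatedFamily μ U D f) (hU : IsOpen U) (j : J) {x : Space3}
    (hx : x ∈ U) : ContDiffAt ℝ ∞ (fun y => ∫ a, f j a y ∂μ) x :=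
  (contDiffOn_infty.2 fun n => h.contDiffOn_nat hU n j).contDiffAt (hU.mem_nhds hx)

end DominatedFamily

/-! ### The complex square root -/

namespace Complex

lemma sqrt_sq_eq (z : ℂ) : sqrt z ^ 2 = z := by
  simp [sqrt]

lemma re_sqrt_nonneg (z : ℂ) : 0 ≤ (sqrt z).re := by
  rw [sqrt, cpow_inv_two_re]
  positivity

/-- Because Re √z = √((|z| + Re z)/2), the real part can vanish only when |z| = -Re z, that is, on
the branch cut. -/
lemma re_sqrt_pos {z : ℂ} (hz : z ∈ slitPlane) : 0 < (sqrt z).re := by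
  rw [sqrt, cpow_inv_two_re]
  refine Real.sqrt_pos.2 ?_
  have h := abs_re_le_norm z
  rcases hz with h1 | h1
  · positivity
  · have := abs_re_lt_norm.2 h1
    have := neg_abs_le z.re
    linarith

lemma norm_sqrt (z : ℂ) : ‖sqrt z‖ = √‖z‖ := by
  rw [← Real.sqrt_sq (norm_nonneg (sqrt z)), ← norm_pow, sqrt_sq_eq]

lemma sqrt_ne_zero {z : ℂ} (hz : z ≠ 0) : sqrt z ≠ 0 := by
  intro h
  apply hz
  rw [← sqrt_sq_eq z, h]
  simp

/-- Re z = (Re √z)² - (Im √z)². This is the source of the vertical decay rate of the modes. -/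
lemma re_le_re_sqrt_sq (z : ℂ) : z.re ≤ (sqrt z).re ^ 2 := by
  have h : (sqrt z ^ 2).re = z.re := by rw [sqrt_sq_eq]
  rw [pow_two, mul_re] at h
  nlinarith [sq_nonneg (sqrt z).im]

/-- A positive factor does not change the argument, so no branch is crossed. This carries the choice
of root from ω̃ to k₁ and k₂. -/
lemma sqrt_ofReal_mul {r : ℝ} (hr : 0 < r) {z : ℂ} (hz : z ≠ 0) :
    sqrt (r * z) = (√r : ℝ) * sqrt z := by
  have hr' : (r : ℂ) ≠ 0 := by exact_mod_cast hr.ne'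
  have h : √r = Real.exp (Real.log r / 2) := by rw [Real.exp_half, Real.exp_log hr]
  rw [sqrt_eq_exp (mul_ne_zero hr' hz), sqrt_eq_exp hz, log_ofReal_mul hr hz, add_div, exp_add, h]
  push_cast
  rfl

lemma hasDerivAt_sqrt_inv {z : ℂ} (hz : z ∈ slitPlane) : HasDerivAt sqrt (1 / (2 * sqrt z)) z := by
  convert hasDerivAt_sqrt hz using 1
  have h0 := slitPlane_ne_zero hz
  rw [show (-1 / 2 : ℂ) = -2⁻¹ by norm_num, cpow_neg, sqrt]
  field_simp

/-- The principal argument takes the value π on the negative axis, so the root is continuous there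
from the upper side. -/
lemma tendsto_sqrt_add_I {z : ℂ} (hz : z ≠ 0) (him : z.im = 0) {ε : ℕ → ℝ} (hε : ∀ n, 0 < ε n)
    (hlim : Tendsto ε atTop (𝓝 0)) :
    Tendsto (fun n => sqrt (z + I * ε n)) atTop (𝓝 (sqrt z)) := by
  have hl : Tendsto (fun n => z + I * (ε n : ℂ)) atTop (𝓝 z) := by
    have := (tendsto_const_nhds (x := z)).add
      ((tendsto_const_nhds (x := I)).mul ((continuous_ofReal.tendsto 0).comp hlim))
    simpa using this
  rcases le_or_gt 0 z.re with h | h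
  · exact (continuousAt_sqrt (Or.inl h)).tendsto.comp hl
  · have h1 := continuousWithinAt_log_of_re_neg_of_im_zero h him
    have h2 : Tendsto (fun n => log (z + I * ε n)) atTop (𝓝 (log z)) := by
      refine h1.tendsto.comp (tendsto_nhdsWithin_iff.2 ⟨hl, .of_forall fun n => ?_⟩)
      simp [him, (hε n).le]
    rw [sqrt_eq_exp hz]
    refine ((continuous_exp.tendsto _).comp (h2.div_const 2)).congr fun n => ?_
    rw [sqrt_eq_exp]
    · rfl
    · intro h0
      have := congrArg im h0
      simp [him, (hε n).ne'] at this

end Complex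

/-! ### Weights on the Fourier plane -/

/-- By x^N/N! ≤ e^x with N = n + 3 the exponential absorbs the polynomial and leaves (1 + |η|)^{-3},
which is integrable in two dimensions. -/
lemma integrable_one_add_norm_pow_mul_exp (n : ℕ) {c : ℝ} (hc : 0 < c) :
    Integrable (fun η : Plane2 => (1 + ‖η‖) ^ n * Real.exp (-(c * ‖η‖))) := by
  have hdim : ((Module.finrank ℝ Plane2 : ℕ) : ℝ) < 3 := by simp; norm_num
  refine ((integrable_one_add_norm (μ := volume) hdim).const_mul
    (Real.exp c * ((n + 3).factorial / c ^ (n + 3)))).mono' (by fun_prop) (ae_of_all _ fun η => ?_)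
  have hx : 0 < 1 + ‖η‖ := by positivity
  have h1 : (c * (1 + ‖η‖)) ^ (n + 3) / (n + 3).factorial ≤ Real.exp (c * (1 + ‖η‖)) :=
    Real.pow_div_factorial_le_exp _ (by positivity) _
  rw [Real.norm_of_nonneg (by positivity), Real.rpow_neg hx.le]
  rw [show (3 : ℝ) = (3 : ℕ) by norm_num, Real.rpow_natCast]
  rw [div_le_iff₀ (by positivity), mul_pow] at h1
  rw [← div_eq_mul_inv, le_div_iff₀ (by positivity), ← sub_nonneg]
  have h2 : Real.exp (-(c * ‖η‖)) = Real.exp c * Real.exp (-(c * (1 + ‖η‖))) := by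
    rw [← Real.exp_add]; ring_nf
  have h3 : Real.exp (c * (1 + ‖η‖)) * Real.exp (-(c * (1 + ‖η‖))) = 1 := by
    rw [← Real.exp_add]; simp
  have h4 : c ^ (n + 3) * (1 + ‖η‖) ^ (n + 3) * Real.exp (-(c * (1 + ‖η‖))) ≤ (n + 3).factorial := by
    calc _ ≤ Real.exp (c * (1 + ‖η‖)) * (n + 3).factorial * Real.exp (-(c * (1 + ‖η‖))) := by gcongr
      _ = _ := by linear_combination ((n + 3).factorial : ℝ) * h3
  rw [sub_nonneg, h2]
  calc _ = Real.exp c * ((1 + ‖η‖) ^ (n + 3) * Real.exp (-(c * (1 + ‖η‖)))) := by ring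
    _ ≤ _ := by
      gcongr
      rw [le_div_iff₀ (by positivity)]
      linarith

/-- For a real wave number the weight is singular on the circle |η| = κ. In polar coordinates |y² -
κ²| ≥ κ|y - κ|, so the singularity is at worst |y - κ|^{-1/2}, which is integrable on the line. -/
lemma integrable_exp_div_sqrt_abs_sub {κ c : ℝ} (hκ : 0 < κ) (hc : 0 < c) :
    Integrable (fun η : Plane2 => Real.exp (-(c * ‖η‖)) / √|‖η‖ ^ 2 - κ ^ 2|) := by
  have hmain : IntegrableOn (fun y : ℝ => y ^ (Module.finrank ℝ Plane2 - 1) •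
      (Real.exp (-(c * y)) / √|y ^ 2 - κ ^ 2|)) (Set.Ioi 0) := by
    have h0 : Integrable ((Set.Icc (-1) 1).indicator fun y : ℝ => (√|y|)⁻¹) := by
      refine IntegrableOn.integrable_indicator ?_ measurableSet_Icc
      refine (locallyIntegrable_of_norm_le_rpow (C := 1) (α := 1 / 2) (by simp) (by norm_num)
        (ae_of_all _ fun y => ?_) ?_).integrableOn_isCompact isCompact_Icc
      · rw [Real.norm_of_nonneg (by positivity), Real.sqrt_eq_rpow, Real.rpow_neg (norm_nonneg _)]
        simp
      · exact Measurable.aestronglyMeasurable (by fun_prop)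
    have h1 := (h0.comp_sub_right κ).const_mul (1 / c * (√κ)⁻¹)
    have h2 : IntegrableOn (fun y : ℝ => 2 / c * (√κ)⁻¹ * Real.exp (-(c / 2) * y)) (Set.Ioi 0) :=
      (exp_neg_integrableOn_Ioi 0 (half_pos hc)).const_mul _
    refine (h1.integrableOn.add h2).mono' (Measurable.aestronglyMeasurable (by fun_prop)) ?_
    refine (ae_restrict_iff' measurableSet_Ioi).2 (ae_of_all _ fun y (hy : 0 < y) => ?_)
    have e1 : y * Real.exp (-(c * y)) ≤ 1 / c := by
      have := Real.add_one_le_exp (c * y)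
      rw [Real.exp_neg, ← div_eq_mul_inv, div_le_div_iff₀ (Real.exp_pos _) hc]
      linarith
    have e2 : y * Real.exp (-(c * y)) ≤ 2 / c * Real.exp (-(c / 2) * y) := by
      have h3 := Real.add_one_le_exp (c / 2 * y)
      have h4 : Real.exp (-(c * y)) = Real.exp (-(c / 2) * y) * (Real.exp (c / 2 * y))⁻¹ := by
        rw [← Real.exp_neg, ← Real.exp_add]; ring_nf
      rw [h4, ← mul_assoc, ← div_eq_mul_inv, div_le_iff₀ (Real.exp_pos _)]
      have h5 : y ≤ 2 / c * Real.exp (c / 2 * y) := by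
        rw [div_mul_eq_mul_div, le_div_iff₀ hc]
        linarith
      nlinarith [Real.exp_pos (-(c / 2) * y)]
    have e3 : √κ * √|y - κ| ≤ √|y ^ 2 - κ ^ 2| := by
      rw [← Real.sqrt_mul hκ.le]
      refine Real.sqrt_le_sqrt ?_
      rw [show y ^ 2 - κ ^ 2 = (y + κ) * (y - κ) by ring, abs_mul, abs_of_pos (a := y + κ) (by linarith)]
      gcongr
      linarith
    have hn : ‖y ^ (Module.finrank ℝ Plane2 - 1) • (Real.exp (-(c * y)) / √|y ^ 2 - κ ^ 2|)‖ =
        y * Real.exp (-(c * y)) / √|y ^ 2 - κ ^ 2| := by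
      rw [Real.norm_of_nonneg (by positivity)]
      simp [mul_div_assoc]
    rw [hn]
    simp only [Pi.add_apply]
    -- Near the circle the inverse square root is the majorant; farther away √|y² - κ²| ≥ √κ and
    -- half of the exponential remains as an integrable tail.
    by_cases hyκ : |y - κ| ≤ 1
    · have hmem : y - κ ∈ Set.Icc (-1 : ℝ) 1 := abs_le.1 hyκ
      rw [Set.indicator_of_mem hmem]
      -- On the circle itself the quotient has denominator zero and hence the value 0.
      rcases eq_or_ne y κ with rfl | hne
      · simp only [sub_self, abs_zero, Real.sqrt_zero, div_zero]
        positivity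
      have hpos : 0 < √κ * √|y - κ| := by
        have := abs_pos.2 (sub_ne_zero.2 hne)
        positivity
      calc y * Real.exp (-(c * y)) / √|y ^ 2 - κ ^ 2| ≤ 1 / c / (√κ * √|y - κ|) := by gcongr
        _ = 1 / c * (√κ)⁻¹ * (√|y - κ|)⁻¹ := by rw [div_eq_mul_inv, mul_inv]; ring
        _ ≤ _ := le_add_of_nonneg_right (by positivity)
    · have hmem : y - κ ∉ Set.Icc (-1 : ℝ) 1 := fun h => hyκ (abs_le.2 h)
      rw [Set.indicator_of_notMem hmem, mul_zero, zero_add]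
      have h6 : √κ ≤ √|y ^ 2 - κ ^ 2| := by
        refine le_trans ?_ e3
        refine le_mul_of_one_le_right (by positivity) ?_
        rw [Real.one_le_sqrt]
        linarith
      have h7 : 0 < √κ := Real.sqrt_pos.2 hκ
      calc y * Real.exp (-(c * y)) / √|y ^ 2 - κ ^ 2|
          ≤ 2 / c * Real.exp (-(c / 2) * y) / √κ := by gcongr
        _ = _ := by rw [div_eq_mul_inv]; ring
  exact (integrable_fun_norm_addHaar volume
    (f := fun y => Real.exp (-(c * y)) / √|y ^ 2 - κ ^ 2|)).2 hmain

lemma exists_pow_mul_exp_le (n : ℕ) {c : ℝ} (hc : 0 < c) :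
    ∃ K, 0 < K ∧ ∀ x : ℝ, 0 ≤ x → (1 + x) ^ n * Real.exp (-(c * x)) ≤ K := by
  refine ⟨Real.exp c * (n.factorial / c ^ n), by positivity, fun x hx => ?_⟩
  have h1 : (c * (1 + x)) ^ n / n.factorial ≤ Real.exp (c * (1 + x)) :=
    Real.pow_div_factorial_le_exp _ (by positivity) _
  rw [div_le_iff₀ (by positivity), mul_pow] at h1
  have h2 : Real.exp (-(c * x)) = Real.exp c / Real.exp (c * (1 + x)) := by
    rw [← Real.exp_sub]; ring_nf
  rw [h2, mul_div_assoc', div_le_iff₀ (Real.exp_pos _), mul_assoc, mul_comm, div_mul_eq_mul_div]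
  refine mul_le_mul_of_nonneg_left ?_ (Real.exp_pos c).le
  rw [le_div_iff₀ (by positivity)]
  linarith

/-- The squared decay rates `s = -k²` that occur: off the branch cut of the square root, or on it
but nonzero. -/
def IsDecayRate (s : ℂ) : Prop := s ∈ Complex.slitPlane ∨ ∃ κ : ℝ, 0 < κ ∧ s = -(κ : ℂ) ^ 2

lemma IsDecayRate.ne_zero {s : ℂ} (hs : IsDecayRate s) : s ≠ 0 := by
  rcases hs with h | ⟨κ, hκ, rfl⟩
  · exact Complex.slitPlane_ne_zero h
  · simpa using hκ.ne'

/-- The points -a with a ≥ 0 form the complement of the slit plane, so ‖a + s‖ is bounded below by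
the distance from s to the cut. The bound is uniform in s near s₀, as needed for differentiating in
s. -/
lemma exists_le_norm_ofReal_add {s₀ : ℂ} (hs : s₀ ∈ Complex.slitPlane) :
    ∃ δ > 0, ∀ s ∈ Metric.ball s₀ δ, s ∈ Complex.slitPlane ∧
      ∀ a : ℝ, 0 ≤ a → δ ≤ ‖(a : ℂ) + s‖ := by
  obtain ⟨ε, hε, hb⟩ := Metric.isOpen_iff.1 Complex.isOpen_slitPlane s₀ hs
  refine ⟨ε / 2, half_pos hε, fun s h => ⟨hb (Metric.ball_subset_ball (by linarith) h), ?_⟩⟩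
  intro a ha
  by_contra! hlt
  have h1 : -(a : ℂ) ∈ Metric.ball s₀ ε := by
    rw [Metric.mem_ball, dist_eq_norm] at h ⊢
    have : -(a : ℂ) - s₀ = (s - s₀) - (a + s) := by ring
    rw [this]
    refine (norm_sub_le _ _).trans_lt (by linarith)
  have h2 := hb h1
  rw [Complex.mem_slitPlane_iff] at h2
  simp at h2
  linarith

lemma ofReal_add_mem_slitPlane {s : ℂ} (hs : s ∈ Complex.slitPlane) {a : ℝ} (ha : 0 ≤ a) :
    (a : ℂ) + s ∈ Complex.slitPlane := by
  rw [Complex.mem_slitPlane_iff] at hs ⊢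
  rcases hs with h | h
  · left; simp; linarith
  · right; simpa using h

lemma IsDecayRate.integrable_weight {s : ℂ} (hs : IsDecayRate s) (n : ℕ) {c : ℝ} (hc : 0 < c) :
    Integrable (fun η : Plane2 => (1 + ‖η‖) ^ n * Real.exp (-(c * ‖η‖)) /
      √‖((‖η‖ ^ 2 : ℝ) : ℂ) + s‖) := by
  rcases hs with h | ⟨κ, hκ, rfl⟩
  · obtain ⟨δ, hδ, hb⟩ := exists_le_norm_ofReal_add h
    refine ((integrable_one_add_norm_pow_mul_exp n hc).mul_const (√δ)⁻¹).mono'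
      (Measurable.aestronglyMeasurable (by fun_prop)) (ae_of_all _ fun η => ?_)
    rw [Real.norm_of_nonneg (by positivity), div_eq_mul_inv]
    have := (hb s (Metric.mem_ball_self hδ)).2 (‖η‖ ^ 2) (by positivity)
    have : 0 < √δ := Real.sqrt_pos.2 hδ
    gcongr
  -- On the cut, half of the exponential absorbs the polynomial and the other half controls the
  -- singular weight.
  · obtain ⟨K, -, hK⟩ := exists_pow_mul_exp_le n (half_pos hc)
    refine ((integrable_exp_div_sqrt_abs_sub hκ (half_pos hc)).const_mul K).mono'
      (Measurable.aestronglyMeasurable (by fun_prop)) (ae_of_all _ fun η => ?_)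
    rw [Real.norm_of_nonneg (by positivity)]
    have e1 : ‖((‖η‖ ^ 2 : ℝ) : ℂ) + -(κ : ℂ) ^ 2‖ = |‖η‖ ^ 2 - κ ^ 2| := by
      rw [← Real.norm_eq_abs, ← Complex.norm_real]
      push_cast
      rw [sub_eq_add_neg]
    have e2 : Real.exp (-(c * ‖η‖)) = Real.exp (-(c / 2 * ‖η‖)) * Real.exp (-(c / 2 * ‖η‖)) := by
      rw [← Real.exp_add]; ring_nf
    rw [e1, e2, ← mul_assoc, mul_div_assoc]
    gcongr
    exact hK _ (norm_nonneg _)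

/-! ### The plane-wave expansion of a spherical wave -/

/-- The vertical decay exponent `√(|η|² + s)`. -/
def decayExp (s : ℂ) (η : Plane2) : ℂ := Complex.sqrt (((‖η‖ ^ 2 : ℝ) : ℂ) + s)

lemma decayExp_sq (s : ℂ) (η : Plane2) : decayExp s η ^ 2 = ((‖η‖ ^ 2 : ℝ) : ℂ) + s :=
  Complex.sqrt_sq_eq _

lemma norm_decayExp (s : ℂ) (η : Plane2) : ‖decayExp s η‖ = √‖((‖η‖ ^ 2 : ℝ) : ℂ) + s‖ :=
  Complex.norm_sqrt _

lemma measurable_sqrt : Measurable Complex.sqrt := by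
  unfold Complex.sqrt
  fun_prop

lemma measurable_decayExp (s : ℂ) : Measurable (decayExp s) :=
  measurable_sqrt.comp (by fun_prop)

/-- Since (Re β)² ≥ |η|² - |s|, the exponent β differs from |η| by a bounded amount as far as decay
is concerned: e^{-βz} decays like e^{-z|η|} up to the constant e^{√|s|z}. -/
lemma norm_sub_le_re_decayExp (s : ℂ) (η : Plane2) : ‖η‖ - √‖s‖ ≤ (decayExp s η).re := by
  have h0 := Complex.re_sqrt_nonneg (((‖η‖ ^ 2 : ℝ) : ℂ) + s)
  have h1 := Complex.re_le_re_sqrt_sq (((‖η‖ ^ 2 : ℝ) : ℂ) + s)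
  have h2 := (abs_le.1 (Complex.abs_re_le_norm s)).1
  have h3 := Real.sq_sqrt (norm_nonneg s)
  have h4 := Real.sqrt_nonneg ‖s‖
  simp only [Complex.add_re, Complex.ofReal_re] at h1
  change ‖η‖ - √‖s‖ ≤ (Complex.sqrt (((‖η‖ ^ 2 : ℝ) : ℂ) + s)).re
  by_contra! hlt
  nlinarith [norm_nonneg η]

lemma re_decayExp_nonneg (s : ℂ) (η : Plane2) : 0 ≤ (decayExp s η).re := Complex.re_sqrt_nonneg _

lemma norm_decayExp_le (s : ℂ) (η : Plane2) : ‖decayExp s η‖ ≤ ‖η‖ + √‖s‖ := by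
  rw [norm_decayExp, Real.sqrt_le_left (by positivity)]
  have h3 := Real.sq_sqrt (norm_nonneg s)
  have : ‖((‖η‖ ^ 2 : ℝ) : ℂ) + s‖ ≤ ‖η‖ ^ 2 + ‖s‖ := by
    refine (norm_add_le _ _).trans ?_
    rw [Complex.norm_real, Real.norm_of_nonneg (by positivity)]
  nlinarith [mul_nonneg (norm_nonneg η) (Real.sqrt_nonneg ‖s‖)]

lemma norm_exp_neg_decayExp_le (s : ℂ) (η : Plane2) {z : ℝ} (hz : 0 ≤ z) :
    ‖Complex.exp (-decayExp s η * z)‖ ≤ Real.exp (√‖s‖ * z) * Real.exp (-(z * ‖η‖)) := by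
  rw [Complex.norm_exp, ← Real.exp_add]
  refine Real.exp_le_exp.2 ?_
  simp only [Complex.mul_re, Complex.neg_re, Complex.ofReal_re, Complex.ofReal_im, mul_zero,
    sub_zero]
  nlinarith [norm_sub_le_re_decayExp s η]

/-- The integrand of the plane-wave expansion, in terms of the horizontal distance `y`, the
height `z` and `s = -k²`. -/
def weylIntegrand (s : ℂ) (z : ℝ) (y η : Plane2) : ℂ :=
  Complex.exp (-decayExp s η * z) / decayExp s η * Complex.exp (Complex.I * (inner ℝ y η : ℝ))

lemma norm_exp_I_mul_real (a : ℝ) : ‖Complex.exp (Complex.I * a)‖ = 1 := by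
  rw [mul_comm, Complex.norm_exp_ofReal_mul_I]

lemma norm_weylIntegrand_le (s : ℂ) {z : ℝ} (hz : 0 ≤ z) (y η : Plane2) :
    ‖weylIntegrand s z y η‖ ≤
      Real.exp (√‖s‖ * z) * Real.exp (-(z * ‖η‖)) / √‖((‖η‖ ^ 2 : ℝ) : ℂ) + s‖ := by
  rw [weylIntegrand, norm_mul, norm_exp_I_mul_real, mul_one, norm_div, norm_decayExp]
  gcongr
  exact norm_exp_neg_decayExp_le s η hz

lemma measurable_weylIntegrand (s : ℂ) (z : ℝ) (y : Plane2) : Measurable (weylIntegrand s z y) := by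
  have := measurable_decayExp s
  unfold weylIntegrand
  fun_prop

lemma IsDecayRate.integrable_weylIntegrand {s : ℂ} (hs : IsDecayRate s) {z : ℝ} (hz : 0 < z)
    (y : Plane2) : Integrable (weylIntegrand s z y) := by
  refine ((hs.integrable_weight 0 hz).const_mul (Real.exp (√‖s‖ * z))).mono'
    (measurable_weylIntegrand s z y).aestronglyMeasurable (ae_of_all _ fun η => ?_)
  simpa [mul_div_assoc] using norm_weylIntegrand_le s hz.le y η

/-- The substitution w = sinh u, a bijection of the line, turns this into the Gaussian integral. -/
lemma integrable_cosh_mul_gaussian {c : ℝ} (hc : 0 < c) :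
    Integrable (fun u : ℝ => Real.cosh u * Real.exp (-c * Real.sinh u ^ 2)) ∧
    ∫ u : ℝ, Real.cosh u * Real.exp (-c * Real.sinh u ^ 2) = √(Real.pi / c) := by
  have hd : ∀ x ∈ (Set.univ : Set ℝ), HasDerivWithinAt Real.sinh (Real.cosh x) Set.univ x :=
    fun x _ => (Real.hasDerivAt_sinh x).hasDerivWithinAt
  have hinj : Set.InjOn Real.sinh Set.univ := Real.sinh_injective.injOn
  have him : Real.sinh '' Set.univ = Set.univ := by
    rw [Set.image_univ, Real.sinh_surjective.range_eq]
  constructor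
  · have := (integrableOn_image_iff_integrableOn_abs_deriv_smul MeasurableSet.univ hd hinj
      (fun w => Real.exp (-c * w ^ 2))).1 (by rw [him]; exact (integrable_exp_neg_mul_sq hc).integrableOn)
    simpa [abs_of_pos (Real.cosh_pos _)] using this
  · have := integral_image_eq_integral_abs_deriv_smul MeasurableSet.univ hd hinj
      (fun w => Real.exp (-c * w ^ 2))
    rw [him] at this
    simp only [Measure.restrict_univ, abs_of_pos (Real.cosh_pos _), smul_eq_mul] at this
    rw [← this, integral_gaussian]

/-- With t = e^u this is ∫₀^∞ e^{-a²t² - b²/t²} dt. A shift in u makes the exponent -2ab cosh 2u =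
-2ab - 4ab sinh² u. In e^u = cosh u + sinh u the odd part integrates to zero and the even part is
the preceding Gaussian. -/
lemma subordination {a b : ℝ} (ha : 0 < a) (hb : 0 < b) :
    Integrable (fun u : ℝ => Real.exp u *
      Real.exp (-(a ^ 2 * Real.exp (2 * u) + b ^ 2 * Real.exp (-(2 * u))))) ∧
    ∫ u : ℝ, Real.exp u * Real.exp (-(a ^ 2 * Real.exp (2 * u) + b ^ 2 * Real.exp (-(2 * u)))) =
      √Real.pi / (2 * a) * Real.exp (-(2 * a * b)) := by
  have hc : 0 < 4 * (a * b) := by positivity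
  obtain ⟨hi, hv⟩ := integrable_cosh_mul_gaussian hc
  have hodd : ∫ u : ℝ, Real.sinh u * Real.exp (-(4 * (a * b)) * Real.sinh u ^ 2) = 0 := by
    have := integral_neg_eq_self
      (fun u : ℝ => Real.sinh u * Real.exp (-(4 * (a * b)) * Real.sinh u ^ 2)) volume
    simp only [Real.sinh_neg, neg_mul, neg_sq, integral_neg] at this ⊢
    linarith
  have hi' : Integrable (fun u : ℝ => Real.sinh u * Real.exp (-(4 * (a * b)) * Real.sinh u ^ 2)) := by
    refine hi.mono' (by fun_prop) (ae_of_all _ fun u => ?_)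
    rw [norm_mul, Real.norm_of_nonneg (Real.exp_pos _).le, Real.norm_eq_abs]
    gcongr
    rw [Real.abs_sinh, ← Real.cosh_abs]
    exact (Real.sinh_lt_cosh _).le
  have hsum := hi.add hi'
  have hval : ∫ u : ℝ, Real.exp u * Real.exp (-(4 * (a * b)) * Real.sinh u ^ 2) =
      √(Real.pi / (4 * (a * b))) := by
    rw [← hv, ← add_zero (∫ u : ℝ, Real.cosh u * _), ← hodd, ← integral_add hi hi']
    refine integral_congr_ae (ae_of_all _ fun u => ?_)
    simp only [← Real.cosh_add_sinh u]
    ring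
  -- The shift that balances the two exponents: after it both a²e^{2u} and b²e^{-2u} carry the
  -- coefficient ab.
  set u₀ := Real.log (b / a) / 2 with hu₀
  have e1 : Real.exp (2 * u₀) = b / a := by
    rw [hu₀, mul_div_cancel₀ _ (two_ne_zero), Real.exp_log (by positivity)]
  have e2 : Real.exp u₀ = √(b / a) := by
    rw [hu₀, Real.exp_half, Real.exp_log (by positivity)]
  have hpt : ∀ u : ℝ, Real.exp (u + u₀) * Real.exp (-(a ^ 2 * Real.exp (2 * (u + u₀)) +
      b ^ 2 * Real.exp (-(2 * (u + u₀))))) =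
      √(b / a) * Real.exp (-(2 * a * b)) *
        (Real.exp u * Real.exp (-(4 * (a * b)) * Real.sinh u ^ 2)) := by
    intro u
    have h1 : a ^ 2 * Real.exp (2 * (u + u₀)) = a * b * Real.exp u ^ 2 := by
      rw [mul_add, Real.exp_add, e1, ← Real.exp_nat_mul]
      push_cast
      field_simp
    have h2 : b ^ 2 * Real.exp (-(2 * (u + u₀))) = a * b * Real.exp (-u) ^ 2 := by
      rw [mul_add, neg_add, Real.exp_add, Real.exp_neg (2 * u₀), e1, ← Real.exp_nat_mul]
      push_cast
      rw [show -(2 * u) = 2 * -u by ring]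
      field_simp
    have h3 : Real.exp u * Real.exp (-u) = 1 := by rw [← Real.exp_add]; simp
    have h4 : Real.exp (-(a * b * Real.exp u ^ 2 + a * b * Real.exp (-u) ^ 2)) =
        Real.exp (-(2 * a * b)) * Real.exp (-(4 * (a * b)) * Real.sinh u ^ 2) := by
      rw [← Real.exp_add, Real.sinh_eq]
      congr 1
      linear_combination -(2 * a * b) * h3
    rw [h1, h2, h4, Real.exp_add, e2]
    ring
  have hshift := integral_add_right_eq_self (μ := volume) (fun u : ℝ => Real.exp u *
      Real.exp (-(a ^ 2 * Real.exp (2 * u) + b ^ 2 * Real.exp (-(2 * u))))) u₀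
  constructor
  · have h4 : Integrable (fun u : ℝ => Real.exp u * Real.exp (-(4 * (a * b)) * Real.sinh u ^ 2)) := by
      refine hsum.congr (ae_of_all _ fun u => ?_)
      simp only [← Real.cosh_add_sinh u, Pi.add_apply]
      ring
    have h5 := h4.const_mul (√(b / a) * Real.exp (-(2 * a * b)))
    simp_rw [← hpt] at h5
    have h6 := h5.comp_sub_right u₀
    simpa using h6
  · rw [← hshift]
    simp_rw [hpt]
    rw [integral_const_mul, hval, mul_right_comm, ← Real.sqrt_mul (by positivity)]
    congr 1
    rw [show b / a * (Real.pi / (4 * (a * b))) = Real.pi / (2 * a) ^ 2 by field_simp; ring,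
      Real.sqrt_div Real.pi_pos.le, Real.sqrt_sq (by positivity)]

/-- Subordination with a = β and b = z/2 writes e^{-βz}/β as an integral of Gaussians in η. By
Fubini the Gaussians are Fourier transformed first, which adds |y|²/4 to (z/2)² and makes (r/2)². A
second use of subordination, with a = r/2 and b = √s, evaluates what is left. -/
lemma weyl_expansion_pos {s z : ℝ} (hs : 0 < s) (hz : 0 < z) (y : Plane2) :
    ∫ η, weylIntegrand s z y η =
      2 * Real.pi * (Complex.exp (-(√s : ℝ) * (√(‖y‖ ^ 2 + z ^ 2) : ℝ)) /
        (√(‖y‖ ^ 2 + z ^ 2) : ℝ)) := by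
  set r := √(‖y‖ ^ 2 + z ^ 2) with hr
  have hrpos : 0 < r := Real.sqrt_pos.2 (by positivity)
  have hr2 : r ^ 2 = ‖y‖ ^ 2 + z ^ 2 := Real.sq_sqrt (by positivity)
  have hβ : ∀ η : Plane2, 0 < √(‖η‖ ^ 2 + s) := fun η => Real.sqrt_pos.2 (by positivity)
  have hβ2 : ∀ η : Plane2, √(‖η‖ ^ 2 + s) ^ 2 = ‖η‖ ^ 2 + s := fun η =>
    Real.sq_sqrt (by positivity)
  have hdec : ∀ η : Plane2, decayExp (s : ℂ) η = (√(‖η‖ ^ 2 + s) : ℝ) := by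
    intro η
    rw [decayExp, ← Complex.ofReal_add, Complex.sqrt_of_nonneg]
    · rw [Complex.ofReal_re]
    · exact_mod_cast (by positivity : 0 ≤ ‖η‖ ^ 2 + s)
  let A : Plane2 → ℝ → ℝ := fun η u => Real.exp u *
      Real.exp (-((‖η‖ ^ 2 + s) * Real.exp (2 * u) + (z / 2) ^ 2 * Real.exp (-(2 * u))))
  let G : Plane2 → ℝ → ℂ := fun η u => (A η u : ℂ) * Complex.exp (Complex.I * (inner ℝ y η : ℝ))
  have hA : ∀ η, Integrable (A η) ∧ ∫ u, A η u =
      √Real.pi / 2 * (Real.exp (-(√(‖η‖ ^ 2 + s) * z)) / √(‖η‖ ^ 2 + s)) := by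
    intro η
    have h := subordination (hβ η) (half_pos hz)
    rw [hβ2] at h
    refine ⟨h.1, h.2.trans ?_⟩
    rw [show 2 * √(‖η‖ ^ 2 + s) * (z / 2) = √(‖η‖ ^ 2 + s) * z by ring]
    have := (hβ η).ne'
    field_simp
  have hAn : ∀ η u, 0 ≤ A η u := fun η u => by positivity
  have hGn : ∀ η u, ‖G η u‖ = A η u := by
    intro η u
    rw [norm_mul, norm_exp_I_mul_real, mul_one, Complex.norm_real, Real.norm_of_nonneg (hAn η u)]
  have hGm : AEStronglyMeasurable (Function.uncurry G) ((volume : Measure Plane2).prod volume) := by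
    refine Continuous.aestronglyMeasurable ?_
    simp only [G, A, Function.uncurry_def]
    fun_prop
  have hint : Integrable (Function.uncurry G) ((volume : Measure Plane2).prod volume) := by
    rw [integrable_prod_iff hGm]
    constructor
    · refine ae_of_all _ fun η => ?_
      exact (hA η).1.ofReal.mul_const (Complex.exp (Complex.I * (inner ℝ y η : ℝ)))
    · simp only [Function.uncurry_apply_pair, hGn, (hA _).2]
      -- The u-integral of |G| is a multiple of e^{-βz}/β, so Fubini's hypothesis reduces to
      -- integrability of the expansion at y = 0.
      have h1 := (IsDecayRate.integrable_weylIntegrand (s := (s : ℂ))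
        (Or.inl (by simp [hs])) hz 0).norm
      refine (h1.congr (ae_of_all _ fun η => ?_)).const_mul _
      simp only [weylIntegrand, hdec, norm_mul, norm_div, Complex.norm_real,
        Real.norm_of_nonneg (hβ η).le, Complex.norm_exp]
      simp [mul_comm]
  have hswap := integral_integral_swap hint
  have hL : ∀ η, ∫ u, G η u = (√Real.pi / 2 : ℝ) * weylIntegrand s z y η := by
    intro η
    simp only [G]
    rw [integral_mul_const, integral_complex_ofReal, (hA η).2, weylIntegrand, hdec]
    push_cast
    rw [neg_mul]
    ring
  have hR : ∀ u, ∫ η, G η u = (Real.pi : ℂ) * ((Real.exp (-u) *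
      Real.exp (-((√s) ^ 2 * Real.exp (2 * u) + (r / 2) ^ 2 * Real.exp (-(2 * u)))) : ℝ) : ℂ) := by
    intro u
    have hE : 0 < Real.exp (2 * u) := Real.exp_pos _
    have hg := GaussianFourier.integral_cexp_neg_mul_sq_norm_add (V := Plane2) (b := (Real.exp (2 * u) : ℂ))
      (by simpa [← Complex.ofReal_exp] using Real.exp_pos _) Complex.I y
    have h1 : ∀ η, G η u = ((Real.exp u * Real.exp (-(s * Real.exp (2 * u) +
        (z / 2) ^ 2 * Real.exp (-(2 * u)))) : ℝ) : ℂ) *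
        Complex.exp (-(Real.exp (2 * u) : ℂ) * (‖η‖ : ℂ) ^ 2 + Complex.I * (inner ℝ y η : ℝ)) := by
      intro η
      simp only [G, A]
      rw [Complex.exp_add, ← mul_assoc]
      congr 1
      rw [show Complex.exp (-(Real.exp (2 * u) : ℂ) * (‖η‖ : ℂ) ^ 2) =
        ((Real.exp (-(Real.exp (2 * u)) * ‖η‖ ^ 2) : ℝ) : ℂ) by push_cast; rfl,
        ← Complex.ofReal_mul, mul_assoc (Real.exp u), ← Real.exp_add (-(s * _ + _))]
      congr 3
      ring
    simp_rw [h1]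
    rw [integral_const_mul, hg]
    have h2 : ((Real.pi : ℂ) / (Real.exp (2 * u) : ℂ)) ^ ((Module.finrank ℝ Plane2 : ℂ) / 2) =
        (Real.pi : ℂ) * ((Real.exp (-(2 * u)) : ℝ) : ℂ) := by
      simp [Complex.exp_neg, div_eq_mul_inv]
    rw [h2, Complex.I_sq]
    have h3 : Complex.exp (-1 * (‖y‖ : ℂ) ^ 2 / (4 * (Real.exp (2 * u) : ℂ))) =
        ((Real.exp (-(‖y‖ ^ 2 / 4 * Real.exp (-(2 * u)))) : ℝ) : ℂ) := by
      rw [Real.exp_neg (2 * u)]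
      push_cast
      congr 1
      ring
    rw [h3, ← Complex.ofReal_mul, ← Complex.ofReal_mul, ← Complex.ofReal_mul, ← Complex.ofReal_mul]
    congr 1
    rw [show (r / 2) ^ 2 = ‖y‖ ^ 2 / 4 + (z / 2) ^ 2 by rw [div_pow, hr2]; ring,
      Real.sq_sqrt hs.le]
    rw [show ∀ a b c d e : ℝ, a * b * (c * d * e) = c * ((a * d) * (b * e)) by intros; ring,
      ← Real.exp_add, ← Real.exp_add]
    congr 2
    · ring_nf
    · ring_nf
  simp_rw [hL, hR] at hswap
  rw [integral_const_mul, integral_const_mul, integral_complex_ofReal] at hswap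
  have hsub := (subordination (half_pos hrpos) (Real.sqrt_pos.2 hs)).2
  have hneg : ∫ u : ℝ, Real.exp (-u) *
      Real.exp (-((√s) ^ 2 * Real.exp (2 * u) + (r / 2) ^ 2 * Real.exp (-(2 * u)))) =
      √Real.pi / (2 * (r / 2)) * Real.exp (-(2 * (r / 2) * √s)) := by
    -- The Gaussian transform has turned e^u into e^{-u}; the reflection u ↦ -u restores the form
    -- needed for subordination.
    rw [← hsub, ← integral_neg_eq_self]
    refine integral_congr_ae (ae_of_all _ fun u => ?_)
    simp only
    rw [neg_neg, show 2 * -u = -(2 * u) by ring, neg_neg, add_comm]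
  rw [hneg] at hswap
  have hπ : ((√Real.pi / 2 : ℝ) : ℂ) ≠ 0 := by
    exact_mod_cast (by positivity : √Real.pi / 2 ≠ 0)
  apply mul_left_cancel₀ hπ
  rw [hswap]
  have hrc : (r : ℂ) ≠ 0 := by exact_mod_cast hrpos.ne'
  push_cast
  rw [show -(2 * ((r : ℂ) / 2) * (√s : ℝ)) = -(√s : ℝ) * (r : ℂ) by ring]
  field_simp

lemma hasDerivAt_decayExp {s : ℂ} (hs : s ∈ Complex.slitPlane) (η : Plane2) :
    HasDerivAt (fun s => decayExp s η) (1 / (2 * decayExp s η)) s := by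
  have h := (Complex.hasDerivAt_sqrt_inv (ofReal_add_mem_slitPlane hs (sq_nonneg ‖η‖)))
  have h2 : HasDerivAt (fun s : ℂ => ((‖η‖ ^ 2 : ℝ) : ℂ) + s) 1 s := (hasDerivAt_id s).const_add _
  exact (h.comp s h2).congr_deriv (mul_one _)

lemma decayExp_ne_zero {s : ℂ} (hs : s ∈ Complex.slitPlane) (η : Plane2) : decayExp s η ≠ 0 :=
  Complex.sqrt_ne_zero (Complex.slitPlane_ne_zero (ofReal_add_mem_slitPlane hs (sq_nonneg ‖η‖)))

/-- The integrand is holomorphic in s with dβ/ds = 1/(2β). On a small ball around s₀ one has |β| ≥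
√δ for every η, so the s-derivative is dominated by a multiple of e^{-z|η|}. -/
lemma differentiableAt_weyl {s₀ : ℂ} (hs : s₀ ∈ Complex.slitPlane) {z : ℝ} (hz : 0 < z)
    (y : Plane2) : DifferentiableAt ℂ (fun s => ∫ η, weylIntegrand s z y η) s₀ := by
  obtain ⟨δ, hδ, hb⟩ := exists_le_norm_ofReal_add hs
  set F' : ℂ → Plane2 → ℂ := fun s η =>
    Complex.exp (-decayExp s η * z) * (-(z / (2 * decayExp s η ^ 2)) - 1 / (2 * decayExp s η ^ 3)) *
      Complex.exp (Complex.I * (inner ℝ y η : ℝ)) with hF'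
  set K := √(‖s₀‖ + δ) with hK
  refine (hasDerivAt_integral_of_dominated_loc_of_deriv_le (F := fun s η => weylIntegrand s z y η)
    (F' := F') (bound := fun η => Real.exp (K * z) * ((1 + ‖η‖) ^ 0 * Real.exp (-(z * ‖η‖))) *
      (z / (2 * √δ ^ 2) + 1 / (2 * √δ ^ 3))) (Metric.ball_mem_nhds s₀ hδ)
    (.of_forall fun s => (measurable_weylIntegrand s z y).aestronglyMeasurable)
    (IsDecayRate.integrable_weylIntegrand (Or.inl hs) hz y) ?_ ?_ ?_ ?_).2.differentiableAt
  · have := measurable_decayExp s₀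
    refine Measurable.aestronglyMeasurable ?_
    rw [hF']
    fun_prop
  · refine ae_of_all _ fun η s hsb => ?_
    have h1 := (hb s hsb).2 (‖η‖ ^ 2) (by positivity)
    have h2 : √δ ≤ ‖decayExp s η‖ := by
      rw [norm_decayExp]
      exact Real.sqrt_le_sqrt h1
    have h3 : 0 < √δ := Real.sqrt_pos.2 hδ
    have h4 : √‖s‖ ≤ K := by
      refine Real.sqrt_le_sqrt ?_
      have h5 := norm_add_le s₀ (s - s₀)
      rw [add_sub_cancel] at h5
      rw [Metric.mem_ball, dist_eq_norm] at hsb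
      linarith
    rw [hF', norm_mul, norm_exp_I_mul_real, mul_one, norm_mul, pow_zero, one_mul]
    gcongr
    · refine (norm_exp_neg_decayExp_le s η hz.le).trans ?_
      gcongr
    · refine (norm_sub_le _ _).trans ?_
      rw [norm_neg, norm_div, norm_div, norm_mul, norm_mul, norm_pow, norm_pow, Complex.norm_real,
        Real.norm_of_nonneg hz.le, norm_one, Complex.norm_two]
      gcongr
  · exact ((integrable_one_add_norm_pow_mul_exp 0 hz).const_mul _).mul_const _
  · refine ae_of_all _ fun η s hsb => ?_
    have hsl := (hb s hsb).1
    have h0 := decayExp_ne_zero hsl η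
    have hd := hasDerivAt_decayExp hsl η
    have he : HasDerivAt (fun s => Complex.exp (-decayExp s η * z))
        (Complex.exp (-decayExp s η * z) * (-(1 / (2 * decayExp s η)) * z)) s :=
      ((hd.neg).mul_const (z : ℂ)).cexp
    refine ((he.div hd h0).mul_const _).congr_deriv ?_
    rw [hF']
    simp only
    congr 1
    field_simp

/-- Identity theorem on the connected slit plane: both sides are analytic there and agree at the
points 1 + 1/(n+1), which accumulate at 1. -/
lemma weyl_expansion_slitPlane {s : ℂ} (hs : s ∈ Complex.slitPlane) {z : ℝ} (hz : 0 < z)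
    (y : Plane2) :
    ∫ η, weylIntegrand s z y η =
      2 * Real.pi * (Complex.exp (-Complex.sqrt s * (√(‖y‖ ^ 2 + z ^ 2) : ℝ)) /
        (√(‖y‖ ^ 2 + z ^ 2) : ℝ)) := by
  set r := √(‖y‖ ^ 2 + z ^ 2) with hr
  have hf : AnalyticOnNhd ℂ (fun s => ∫ η, weylIntegrand s z y η) Complex.slitPlane :=
    DifferentiableOn.analyticOnNhd
      (fun s hs => (differentiableAt_weyl hs hz y).differentiableWithinAt) Complex.isOpen_slitPlane
  have hg : AnalyticOnNhd ℂ (fun s => 2 * Real.pi * (Complex.exp (-Complex.sqrt s * r) / r))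
      Complex.slitPlane := by
    refine DifferentiableOn.analyticOnNhd (fun s hs => ?_) Complex.isOpen_slitPlane
    have := Complex.differentiableAt_sqrt hs
    exact DifferentiableAt.differentiableWithinAt
      ((((this.neg.mul_const _).cexp).div_const _).const_mul _)
  have hconn : IsPreconnected Complex.slitPlane :=
    (Complex.starConvex_one_slitPlane.isPathConnected (by simp)).isConnected.isPreconnected
  refine hf.eqOn_of_preconnected_of_frequently_eq hg hconn (z₀ := 1) (by simp) ?_ hs
  have hseq : Tendsto (fun n : ℕ => ((1 + 1 / ((n : ℝ) + 1) : ℝ) : ℂ)) atTop (𝓝[≠] 1) := by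
    refine tendsto_nhdsWithin_iff.2 ⟨?_, .of_forall fun n => ?_⟩
    · have h1 := (tendsto_const_nhds (x := (1 : ℝ))).add tendsto_one_div_add_atTop_nhds_zero_nat
      rw [add_zero] at h1
      exact (Complex.continuous_ofReal.tendsto 1).comp h1
    · simp only [Set.mem_compl_iff, Set.mem_singleton_iff]
      rw [← Complex.ofReal_one, Complex.ofReal_inj]
      have : (0 : ℝ) < 1 / ((n : ℝ) + 1) := by positivity
      linarith
  refine hseq.frequently (Frequently.of_forall fun n => ?_)
  have hpos : (0 : ℝ) < 1 + 1 / ((n : ℝ) + 1) := by positivity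
  rw [weyl_expansion_pos hpos hz y, Complex.sqrt_of_nonneg (by exact_mod_cast hpos.le),
    Complex.ofReal_re]

/-- **Weyl's expansion** of a spherical wave in plane waves. -/
lemma weyl_expansion {s : ℂ} (hs : IsDecayRate s) {z : ℝ} (hz : 0 < z) (y : Plane2) :
    ∫ η, weylIntegrand s z y η =
      2 * Real.pi * (Complex.exp (-Complex.sqrt s * (√(‖y‖ ^ 2 + z ^ 2) : ℝ)) /
        (√(‖y‖ ^ 2 + z ^ 2) : ℝ)) := by
  have hs' := hs
  rcases hs with h | ⟨κ, hκ, hsκ⟩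
  · exact weyl_expansion_slitPlane h hz y
  have him : s.im = 0 := by
    rw [hsκ, ← Complex.ofReal_pow, ← Complex.ofReal_neg, Complex.ofReal_im]
  -- A point of the cut is approached along s + iε with ε > 0, the side from which the principal
  -- root is continuous.
  set ε : ℕ → ℝ := fun n => 1 / ((n : ℝ) + 1) with hε
  have hεpos : ∀ n, 0 < ε n := fun n => by positivity
  have hεle : ∀ n, ε n ≤ 1 := fun n => by
    rw [hε]
    simp only
    rw [div_le_one (by positivity)]
    linarith [(Nat.cast_nonneg n : (0 : ℝ) ≤ n)]
  have hεlim : Tendsto ε atTop (𝓝 0) := tendsto_one_div_add_atTop_nhds_zero_nat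
  have hmem : ∀ n, s + Complex.I * ε n ∈ Complex.slitPlane := fun n => by
    right
    simp [him, (hεpos n).ne']
  set r := √(‖y‖ ^ 2 + z ^ 2) with hr
  have hR : Tendsto (fun n => 2 * Real.pi * (Complex.exp (-Complex.sqrt (s + Complex.I * ε n) * r) / r))
      atTop (𝓝 (2 * Real.pi * (Complex.exp (-Complex.sqrt s * r) / r))) := by
    have h := Complex.tendsto_sqrt_add_I hs'.ne_zero him hεpos hεlim
    exact ((((Complex.continuous_exp.tendsto _).comp (h.neg.mul_const (r : ℂ))).div_const _).const_mul _)
  -- The integrand is singular only on the circle |η| = κ, a null set.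
  have hnull : ∀ᵐ η : Plane2, ((‖η‖ ^ 2 : ℝ) : ℂ) + s ≠ 0 := by
    have h0 : volume (Metric.sphere (0 : Plane2) κ) = 0 := Measure.addHaar_sphere _ _ _
    filter_upwards [compl_mem_ae_iff.2 h0] with η hη h1
    apply hη
    rw [hsκ, ← sub_eq_add_neg, sub_eq_zero] at h1
    have h2 : ‖η‖ ^ 2 = κ ^ 2 := by exact_mod_cast h1
    rw [mem_sphere_zero_iff_norm]
    exact (sq_eq_sq₀ (norm_nonneg _) hκ.le).1 h2
  have hL : Tendsto (fun n => ∫ η, weylIntegrand (s + Complex.I * ε n) z y η) atTop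
      (𝓝 (∫ η, weylIntegrand s z y η)) := by
    refine tendsto_integral_of_dominated_convergence
      (fun η => Real.exp (√(‖s‖ + 1) * z) * ((1 + ‖η‖) ^ 0 * Real.exp (-(z * ‖η‖)) /
        √‖((‖η‖ ^ 2 : ℝ) : ℂ) + s‖))
      (fun n => (measurable_weylIntegrand _ z y).aestronglyMeasurable)
      ((hs'.integrable_weight 0 hz).const_mul _) (fun n => ?_) ?_
    · filter_upwards [hnull] with η hη
      refine (norm_weylIntegrand_le _ hz.le y η).trans ?_
      rw [pow_zero, one_mul, ← mul_div_assoc]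
      have h1 : ‖s + Complex.I * ε n‖ ≤ ‖s‖ + 1 := by
        refine (norm_add_le _ _).trans ?_
        simp only [norm_mul, Complex.norm_I, one_mul, Complex.norm_real]
        rw [Real.norm_of_nonneg (hεpos n).le]
        linarith [hεle n]
      -- For real s the shift iε is orthogonal to |η|² + s and only increases its modulus, so the
      -- singular weight at s itself dominates all approximants.
      have h2 : ‖((‖η‖ ^ 2 : ℝ) : ℂ) + s‖ ≤ ‖((‖η‖ ^ 2 : ℝ) : ℂ) + (s + Complex.I * ε n)‖ := by
        have h3 : ‖((‖η‖ ^ 2 : ℝ) : ℂ) + s‖ = |(((‖η‖ ^ 2 : ℝ) : ℂ) + (s + Complex.I * ε n)).re| := by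
          rw [hsκ, ← Complex.ofReal_pow, ← Complex.ofReal_neg, ← Complex.ofReal_add, Complex.norm_real,
            Real.norm_eq_abs]
          congr 1
          rw [← add_assoc, ← Complex.ofReal_add]
          simp [-Complex.ofReal_add, -Complex.ofReal_pow]
        rw [h3]
        exact Complex.abs_re_le_norm _
      have h4 : 0 < √‖((‖η‖ ^ 2 : ℝ) : ℂ) + s‖ := Real.sqrt_pos.2 (norm_pos_iff.2 hη)
      gcongr
    · filter_upwards [hnull] with η hη
      have h1 : Tendsto (fun n => decayExp (s + Complex.I * ε n) η) atTop (𝓝 (decayExp s η)) := by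
        simp only [decayExp, ← add_assoc]
        exact Complex.tendsto_sqrt_add_I hη (by rw [Complex.add_im, Complex.ofReal_im, him, add_zero])
          hεpos hεlim
      have h0 : decayExp s η ≠ 0 := Complex.sqrt_ne_zero hη
      exact ((((Complex.continuous_exp.tendsto _).comp (h1.neg.mul_const (z : ℂ))).div h1 h0).mul_const _)
  refine tendsto_nhds_unique hL (hR.congr fun n => ?_)
  rw [weyl_expansion_slitPlane (hmem n) hz y]

/-! ### Wave numbers of a Zener medium -/

namespace ZenerMedium

variable {M : ZenerMedium}

/-- The argument of iω is ±π/2, so its α-th power has argument ±απ/2. For 0 ≤ α ≤ 1 the power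
therefore stays in the closed right half-plane, and it is real only for α = 0. -/
lemma fractionalPower_eq (hω : M.omega ≠ 0) :
    ∃ a b : ℝ, 0 < a ∧ (b = Real.pi / 2 ∨ b = -(Real.pi / 2)) ∧
      (Complex.I * (M.omega : ℂ)) ^ (M.alpha : ℂ) =
        (a : ℂ) * Complex.exp ((M.alpha * b : ℝ) * Complex.I) := by
  have h0 : Complex.I * (M.omega : ℂ) ≠ 0 := by simp [hω]
  refine ⟨Real.exp (Real.log |M.omega| * M.alpha), Complex.arg (Complex.I * M.omega),
    Real.exp_pos _, ?_, ?_⟩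
  · rcases lt_or_gt_of_ne hω with h | h
    · right
      rw [show Complex.I * (M.omega : ℂ) = ((-M.omega : ℝ) : ℂ) * -Complex.I by push_cast; ring,
        Complex.arg_real_mul _ (by linarith), Complex.arg_neg_I]
    · left
      rw [mul_comm, Complex.arg_real_mul _ h, Complex.arg_I]
  · rw [Complex.cpow_def_of_ne_zero h0, Complex.ofReal_exp, ← Complex.exp_add]
    congr 1
    rw [Complex.log]
    simp
    ring

lemma re_fractionalPower_nonneg (hω : M.omega ≠ 0) (hα : M.alpha ∈ Set.Icc (0 : ℝ) 1) :
    0 ≤ ((Complex.I * (M.omega : ℂ)) ^ (M.alpha : ℂ)).re := by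
  obtain ⟨a, b, ha, hb, h⟩ := fractionalPower_eq hω
  rw [h, Complex.re_ofReal_mul, Complex.exp_ofReal_mul_I_re]
  refine mul_nonneg ha.le (Real.cos_nonneg_of_mem_Icc ?_)
  have := Real.pi_pos
  obtain ⟨h0, h1⟩ := hα
  rcases hb with rfl | rfl <;> constructor <;> nlinarith

lemma im_fractionalPower_ne_zero (hω : M.omega ≠ 0) (hα : M.alpha ∈ Set.Icc (0 : ℝ) 1)
    (h0 : M.alpha ≠ 0) : ((Complex.I * (M.omega : ℂ)) ^ (M.alpha : ℂ)).im ≠ 0 := by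
  obtain ⟨a, b, ha, hb, h⟩ := fractionalPower_eq hω
  rw [h, Complex.im_ofReal_mul, Complex.exp_ofReal_mul_I_im]
  have hpos : 0 < M.alpha := lt_of_le_of_ne hα.1 h0.symm
  have := Real.pi_pos
  have hsin : 0 < Real.sin (M.alpha * (Real.pi / 2)) :=
    Real.sin_pos_of_pos_of_lt_pi (by positivity) (by nlinarith [hα.2])
  refine mul_ne_zero ha.ne' ?_
  rcases hb with rfl | rfl
  · exact hsin.ne'
  · rw [mul_neg, Real.sin_neg]
    exact neg_ne_zero.2 hsin.ne'

lemma one_add_mul_ne_zero {z : ℂ} (hz : 0 ≤ z.re) {p : ℝ} (hp : 0 ≤ p) : 1 + (p : ℂ) * z ≠ 0 := by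
  intro h
  have := congrArg Complex.re h
  simp at this
  nlinarith

lemma dampedSq_ne_zero (hω : M.omega ≠ 0) (hp : 0 ≤ M.p) (hq : 0 ≤ M.q)
    (hα : M.alpha ∈ Set.Icc (0 : ℝ) 1) : M.dampedSq ≠ 0 := by
  have hz := re_fractionalPower_nonneg hω hα
  exact mul_ne_zero (div_ne_zero (one_add_mul_ne_zero hz hp) (one_add_mul_ne_zero hz hq))
    (by simpa using hω)

/-- With z = (iω)^α, Im((1 + pz)/(1 + qz)) = (p - q) Im z / |1 + qz|². -/
lemma im_dampedSq_ne_zero (hω : M.omega ≠ 0) (hq : 0 ≤ M.q)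
    (hα : M.alpha ∈ Set.Icc (0 : ℝ) 1) (hpq : M.p ≠ M.q) (h0 : M.alpha ≠ 0) :
    M.dampedSq.im ≠ 0 := by
  have hz := re_fractionalPower_nonneg hω hα
  have hi := im_fractionalPower_ne_zero hω hα h0
  have hne := one_add_mul_ne_zero hz hq
  rw [dampedSq]
  set z := (Complex.I * (M.omega : ℂ)) ^ (M.alpha : ℂ)
  rw [← Complex.ofReal_pow, Complex.im_mul_ofReal, Complex.div_im]
  have hns : Complex.normSq (1 + M.q * z) ≠ 0 := by simpa [Complex.normSq_eq_zero] using hne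
  refine mul_ne_zero ?_ (by simpa using hω)
  rw [← sub_div]
  refine div_ne_zero ?_ hns
  have : (1 + (M.p : ℂ) * z).im * (1 + (M.q : ℂ) * z).re -
      (1 + (M.p : ℂ) * z).re * (1 + (M.q : ℂ) * z).im = (M.p - M.q) * z.im := by
    simp
    ring
  rw [this]
  exact mul_ne_zero (sub_ne_zero.2 hpq) hi

lemma dampedSq_eq_ofReal (hω : M.omega ≠ 0) (hp : 0 ≤ M.p) (hq : 0 ≤ M.q)
    (hα : M.alpha ∈ Set.Icc (0 : ℝ) 1) (h : M.p = M.q ∨ M.alpha = 0) :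
    ∃ a : ℝ, 0 < a ∧ M.dampedSq = a := by
  rcases h with h | h
  · refine ⟨M.omega ^ 2, by positivity, ?_⟩
    rw [dampedSq, h, div_self (one_add_mul_ne_zero (re_fractionalPower_nonneg hω hα) hq)]
    simp
  · refine ⟨(1 + M.p) / (1 + M.q) * M.omega ^ 2, by positivity, ?_⟩
    rw [dampedSq, h]
    simp

lemma damped_sq : M.damped ^ 2 = M.dampedSq := by
  rw [damped, mul_pow, Complex.sqrt_sq_eq, Complex.I_sq]
  ring

/-- The dichotomy between absorbing and elastic media. It decides whether -k² lies off the branch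
cut or is a negative number on it. -/
lemma im_ne_zero_or_pos (hω : M.omega ≠ 0) (hp : 0 ≤ M.p) (hq : 0 ≤ M.q)
    (hα : M.alpha ∈ Set.Icc (0 : ℝ) 1) :
    M.dampedSq.im ≠ 0 ∨ ∃ a : ℝ, 0 < a ∧ M.dampedSq = a := by
  by_cases h : M.p = M.q ∨ M.alpha = 0
  · exact Or.inr (dampedSq_eq_ofReal hω hp hq hα h)
  · push Not at h
    exact Or.inl (im_dampedSq_ne_zero hω hq hα h.1 h.2)

lemma neg_sq_damped_mul {c : ℝ} (hc : 0 < c) :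
    -(M.damped * (√c : ℝ)) ^ 2 = (c : ℂ) * -M.dampedSq := by
  rw [mul_pow, damped_sq, ← Complex.ofReal_pow, Real.sq_sqrt hc.le]
  ring

lemma isDecayRate_damped (h : M.dampedSq.im ≠ 0 ∨ ∃ a : ℝ, 0 < a ∧ M.dampedSq = a) {c : ℝ}
    (hc : 0 < c) : IsDecayRate (-(M.damped * (√c : ℝ)) ^ 2) := by
  rw [neg_sq_damped_mul hc]
  rcases h with h | ⟨a, ha, h⟩
  · left
    right
    rw [Complex.im_ofReal_mul]
    simpa [hc.ne'] using h
  · right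
    refine ⟨√(c * a), Real.sqrt_pos.2 (by positivity), ?_⟩
    rw [h, ← Complex.ofReal_pow, Real.sq_sqrt (by positivity)]
    push_cast
    ring

/-- The root of ω̃² with nonnegative imaginary part is the one for which e^{ikr} = e^{-√(-k²) r}, so
Weyl's expansion produces the wave with the prescribed sign. -/
lemma I_mul_damped (h : M.dampedSq ≠ 0) {c : ℝ} (hc : 0 < c) :
    Complex.I * (M.damped * (√c : ℝ)) = -Complex.sqrt (-(M.damped * (√c : ℝ)) ^ 2) := by
  rw [neg_sq_damped_mul hc, Complex.sqrt_ofReal_mul hc (neg_ne_zero.2 h), damped]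
  linear_combination (Complex.sqrt (-M.dampedSq) * (√c : ℝ)) * Complex.I_sq

/-- The properties of the wave numbers that the construction of the Green function uses. -/
structure IsRegular (M : ZenerMedium) : Prop where
  mu_pos : 0 < M.mu
  lam_add_mu_pos : 0 < M.lam + M.mu
  mu_mul : (M.mu : ℂ) * M.k₂ ^ 2 = M.rho * M.dampedSq
  lam_mul : ((M.lam : ℂ) + 2 * M.mu) * M.k₁ ^ 2 = M.rho * M.dampedSq
  decay₁ : IsDecayRate (-M.k₁ ^ 2)
  decay₂ : IsDecayRate (-M.k₂ ^ 2)
  I_mul_k₁ : Complex.I * M.k₁ = -Complex.sqrt (-M.k₁ ^ 2)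
  I_mul_k₂ : Complex.I * M.k₂ = -Complex.sqrt (-M.k₂ ^ 2)

lemma isRegular (hmu : 0 < M.mu) (hlam : 0 < M.lam + M.mu) (hrho : 0 < M.rho)
    (hω : M.omega ≠ 0) (hp : 0 ≤ M.p) (hq : 0 ≤ M.q) (hα : M.alpha ∈ Set.Icc (0 : ℝ) 1) :
    M.IsRegular := by
  have h1 : 0 < M.rho / (M.lam + 2 * M.mu) := div_pos hrho (by linarith)
  have h2 : 0 < M.rho / M.mu := div_pos hrho hmu
  have h := im_ne_zero_or_pos hω hp hq hα
  have h0 := dampedSq_ne_zero hω hp hq hα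
  refine ⟨hmu, hlam, ?_, ?_, isDecayRate_damped h h1, isDecayRate_damped h h2,
    I_mul_damped h0 h1, I_mul_damped h0 h2⟩
  · have := neg_sq_damped_mul (M := M) h2
    have hm : (M.mu : ℂ) ≠ 0 := by exact_mod_cast hmu.ne'
    rw [k₂, ← neg_neg ((M.damped * _) ^ 2), this]
    push_cast
    field_simp
  · have := neg_sq_damped_mul (M := M) h1
    have hm : (M.lam : ℂ) + 2 * M.mu ≠ 0 := by
      exact_mod_cast (by linarith : M.lam + 2 * M.mu ≠ 0)
    rw [k₁, ← neg_neg ((M.damped * _) ^ 2), this]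
    push_cast
    field_simp

lemma neg_sq_mem_slitPlane (hlam : 0 < M.lam + M.mu) (hmu : 0 < M.mu) (hrho : 0 < M.rho)
    (h : M.dampedSq.im ≠ 0) :
    -M.k₁ ^ 2 ∈ Complex.slitPlane ∧ -M.k₂ ^ 2 ∈ Complex.slitPlane := by
  have h1 : 0 < M.rho / (M.lam + 2 * M.mu) := div_pos hrho (by linarith)
  have h2 : 0 < M.rho / M.mu := div_pos hrho hmu
  constructor
  · right
    rw [k₁, neg_sq_damped_mul h1, Complex.im_ofReal_mul]
    exact mul_ne_zero h1.ne' (by simpa using h)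
  · right
    rw [k₂, neg_sq_damped_mul h2, Complex.im_ofReal_mul]
    exact mul_ne_zero h2.ne' (by simpa using h)

/-! ### The plane-wave expansion in terms of the wave number -/

lemma norm_sq_plane (η : Plane2) : ‖η‖ ^ 2 = η 0 ^ 2 + η 1 ^ 2 := by
  rw [EuclideanSpace.real_norm_sq_eq, Fin.sum_univ_two]

lemma norm_sq_space (x : Space3) : ‖x‖ ^ 2 = x 0 ^ 2 + x 1 ^ 2 + x 2 ^ 2 := by
  rw [EuclideanSpace.real_norm_sq_eq, Fin.sum_univ_three]

lemma beta_eq_decayExp (k : ℂ) (η : Plane2) : beta k η = decayExp (-k ^ 2) η := by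
  rw [beta, decayExp, norm_sq_plane]
  push_cast
  ring_nf

/-- The horizontal component of `x - ξ`. -/
def horizontal (ξ x : Space3) : Plane2 := !₂[x 0 - ξ 0, x 1 - ξ 1]

lemma planeWave_eq (η : Plane2) (ξ x : Space3) :
    planeWave η ξ x = Complex.exp (Complex.I * (inner ℝ (horizontal ξ x) η : ℝ)) := by
  simp [planeWave, horizontal, PiLp.inner_apply, Fin.sum_univ_two]

lemma waveIntegrand_eq (k : ℂ) (ξ x : Space3) :
    waveIntegrand k ξ x = weylIntegrand (-k ^ 2) |x 2 - ξ 2| (horizontal ξ x) := by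
  ext η
  rw [waveIntegrand, weylIntegrand, beta_eq_decayExp, planeWave_eq]

lemma norm_sub_eq_sqrt (ξ x : Space3) :
    ‖x - ξ‖ = √(‖horizontal ξ x‖ ^ 2 + |x 2 - ξ 2| ^ 2) := by
  rw [norm_sq_plane, sq_abs, ← Real.sqrt_sq (norm_nonneg (x - ξ)), norm_sq_space]
  simp [horizontal]

lemma planeWave_expansion {k : ℂ} (hk : IsDecayRate (-k ^ 2))
    (hI : Complex.I * k = -Complex.sqrt (-k ^ 2)) {ξ x : Space3} (hx : x 2 ≠ ξ 2) :
    Integrable (waveIntegrand k ξ x) ∧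
      sphericalWave k ξ x = 1 / (2 * (Real.pi : ℂ)) * ∫ η, waveIntegrand k ξ x η := by
  have hz : 0 < |x 2 - ξ 2| := abs_pos.2 (sub_ne_zero.2 hx)
  rw [waveIntegrand_eq]
  refine ⟨hk.integrable_weylIntegrand hz _, ?_⟩
  rw [weyl_expansion hk hz, sphericalWave, hI, norm_sub_eq_sqrt]
  have : (Real.pi : ℂ) ≠ 0 := by exact_mod_cast Real.pi_ne_zero
  field_simp

lemma IsRegular.wave (h : M.IsRegular) {k : ℂ} (hk : k ∈ ({M.k₁, M.k₂} : Set ℂ)) :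
    IsDecayRate (-k ^ 2) ∧ Complex.I * k = -Complex.sqrt (-k ^ 2) := by
  rcases hk with rfl | rfl
  · exact ⟨h.decay₁, h.I_mul_k₁⟩
  · exact ⟨h.decay₂, h.I_mul_k₂⟩

end ZenerMedium

/-! ### Integration by parts against test functions -/

lemma integrable_mul_of_continuousOn_tsupport {f χ : Space3 → ℂ} (hχ : Continuous χ)
    (hc : HasCompactSupport χ) (hf : ContinuousOn f (tsupport χ)) :
    Integrable (fun x => f x * χ x) := by
  rw [← integrableOn_iff_integrable_of_support_subset (s := tsupport χ)]
  · exact (hf.mul hχ.continuousOn).integrableOn_compact hc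
  · intro x hx
    refine subset_tsupport χ fun h => hx ?_
    simp [h]

lemma integral_mul_pd_eq_neg {f χ : Space3 → ℂ} (hχ : ContDiff ℝ ∞ χ) (hc : HasCompactSupport χ)
    (hf : ∀ x ∈ tsupport χ, ContDiffAt ℝ ∞ f x) (i : Fin 3) :
    ∫ x, f x * pd i χ x = -∫ x, pd i f x * χ x := by
  have h1 : ContinuousOn f (tsupport χ) := fun x hx => (hf x hx).continuousAt.continuousWithinAt
  have h2 : ContinuousOn (pd i f) (tsupport χ) := fun x hx =>
    ((hf x hx).pd_infty i).continuousAt.continuousWithinAt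
  refine integral_mul_fderiv_eq_neg_fderiv_mul_of_integrable (μ := volume)
    (integrable_mul_of_continuousOn_tsupport hχ.continuous hc h2)
    (integrable_mul_of_continuousOn_tsupport (hχ.pd_infty i).continuous (hc.pd i)
      (h1.mono (tsupport_pd_subset χ i)))
    (integrable_mul_of_continuousOn_tsupport hχ.continuous hc h1)
    (fun x hx => (hf x hx).differentiableAt_infty)
    (fun x _ => hχ.contDiffAt.differentiableAt_infty)

lemma integral_mul_pd_pd {f χ : Space3 → ℂ} (hχ : ContDiff ℝ ∞ χ) (hc : HasCompactSupport χ)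
    (hf : ∀ x ∈ tsupport χ, ContDiffAt ℝ ∞ f x) (i j : Fin 3) :
    ∫ x, f x * pd i (pd j χ) x = ∫ x, pd i (pd j f) x * χ x := by
  rw [integral_mul_pd_eq_neg (hχ.pd_infty j) (hc.pd j)
    (fun x hx => hf x (tsupport_pd_subset χ j hx)),
    integral_mul_pd_eq_neg hχ hc (fun x hx => (hf x hx).pd_infty i), neg_neg]
  refine integral_congr_ae (ae_of_all _ fun x => ?_)
  by_cases hx : x ∈ tsupport χ
  · simp only [pd_comm (hf x hx) i j]
  · simp [image_eq_zero_of_notMem_tsupport hx]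

lemma locallyIntegrable_inv_norm_sub (ξ : Space3) :
    LocallyIntegrable (fun x : Space3 => ‖x - ξ‖⁻¹) := by
  have h0 : LocallyIntegrable (fun x : Space3 => ‖x‖⁻¹) := by
    refine locallyIntegrable_of_norm_le_rpow (C := 1) (α := 1) (by simp) (by simp)
      (ae_of_all _ fun y => ?_) (Measurable.aestronglyMeasurable (by fun_prop))
    rw [Real.rpow_neg_one]
    simp
  rw [locallyIntegrable_iff]
  intro K hK
  have hK' : IsCompact ((fun x => x - ξ) '' K) := hK.image (by fun_prop)
  have h1 := (h0.integrableOn_isCompact hK').integrable_indicator hK'.measurableSet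
  have h2 := h1.comp_sub_right ξ
  rw [← integrable_indicator_iff hK.measurableSet]
  refine h2.congr (ae_of_all _ fun x => ?_)
  by_cases hx : x ∈ K
  · simp [Set.indicator_of_mem hx, Set.indicator_of_mem (Set.mem_image_of_mem (fun x => x - ξ) hx)]
  · have : x - ξ ∉ (fun x => x - ξ) '' K := by
      rintro ⟨y, hy, h⟩
      exact hx (by simpa using (sub_left_injective h) ▸ hy)
    simp [Set.indicator_of_notMem hx, Set.indicator_of_notMem this]

lemma ae_ne_point (ξ : Space3) : ∀ᵐ x : Space3, x ≠ ξ := by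
  simp [ae_iff]

lemma locallyIntegrable_of_le_inv_norm {f : Space3 → ℂ} {ξ : Space3}
    (hf : ContinuousOn f {ξ}ᶜ)
    (hb : ∀ R : ℝ, ∃ C, ∀ x, x ≠ ξ → ‖x - ξ‖ ≤ R → ‖f x‖ ≤ C * ‖x - ξ‖⁻¹) :
    LocallyIntegrable f := by
  have hm : AEStronglyMeasurable f volume := by
    have := hf.aestronglyMeasurable (μ := volume) (measurableSet_singleton ξ).compl
    rwa [restrict_compl_singleton] at this
  rw [locallyIntegrable_iff]
  intro K hK
  obtain ⟨R, hR⟩ := (hK.image (f := fun x => ‖x - ξ‖) (by fun_prop)).bddAbove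
  obtain ⟨C, hC⟩ := hb R
  refine (((locallyIntegrable_inv_norm_sub ξ).integrableOn_isCompact hK).const_mul C).mono'
    hm.restrict ?_
  filter_upwards [ae_restrict_mem hK.measurableSet, ae_restrict_of_ae (ae_ne_point ξ)] with x hx hne
  exact hC x hne (hR ⟨x, hx, rfl⟩)

lemma MeasureTheory.LocallyIntegrable.integrable_mul_test {f χ : Space3 → ℂ} (hf : LocallyIntegrable f)
    (hχ : Continuous χ) (hc : HasCompactSupport χ) : Integrable (fun x => f x * χ x) := by
  simpa [mul_comm] using hf.integrable_smul_left_of_hasCompactSupport hχ hc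

/-- Dominated convergence with majorant C/|x - ξ|, the tool for removing a regularisation. A bound
on each ball suffices because χ has compact support. -/
lemma tendsto_integral_mul_of_le_inv_norm {g : ℕ → Space3 → ℂ} {f χ : Space3 → ℂ} {ξ : Space3}
    (hχ : Continuous χ) (hc : HasCompactSupport χ) (hg : ∀ n, Continuous (g n))
    (hb : ∀ R : ℝ, ∃ C, ∀ n x, x ≠ ξ → ‖x - ξ‖ ≤ R → ‖g n x‖ ≤ C * ‖x - ξ‖⁻¹)
    (hlim : ∀ x, x ≠ ξ → Tendsto (fun n => g n x) atTop (𝓝 (f x))) :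
    Tendsto (fun n => ∫ x, g n x * χ x) atTop (𝓝 (∫ x, f x * χ x)) := by
  obtain ⟨R, hR⟩ := (hc.isCompact.image (f := fun x => ‖x - ξ‖) (by fun_prop)).bddAbove
  obtain ⟨C, hC⟩ := hb R
  refine tendsto_integral_of_dominated_convergence (fun x => C * (‖x - ξ‖⁻¹ * ‖χ x‖))
    (fun n => ((hg n).mul hχ).aestronglyMeasurable) ?_ (fun n => ?_) ?_
  · refine Integrable.const_mul ?_ C
    have := (locallyIntegrable_inv_norm_sub ξ).integrable_smul_left_of_hasCompactSupport
      hχ.norm hc.norm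
    simpa [mul_comm] using this
  · filter_upwards [ae_ne_point ξ] with x hx
    rw [norm_mul]
    by_cases h : x ∈ tsupport χ
    · rw [← mul_assoc]
      gcongr
      exact hC n x hx (hR ⟨x, h, rfl⟩)
    · simp [image_eq_zero_of_notMem_tsupport h]
  · filter_upwards [ae_ne_point ξ] with x hx
    exact (hlim x hx).mul_const _

/-! ### Radial functions -/

/-- Waves are treated as functions of |y - ξ|² + e: the squared distance is smooth everywhere, e > 0
removes the singularity at ξ, and e = 0 gives back the wave itself. -/
lemma hasFDerivAt_radial {g : ℝ → ℂ} {g' : ℂ} {ξ x : Space3} {e : ℝ}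
    (h : HasDerivAt g g' (‖x - ξ‖ ^ 2 + e)) :
    HasFDerivAt (fun y => g (‖y - ξ‖ ^ 2 + e))
      (gradL fun i => 2 * ((x i - ξ i : ℝ) : ℂ) * g') x := by
  have h1 : HasFDerivAt (fun y : Space3 => ‖y - ξ‖ ^ 2 + e) _ x :=
    (((hasFDerivAt_id x).sub_const ξ).norm_sq).add_const e
  refine (h.hasFDerivAt.comp x h1).congr_fderiv ?_
  ext v
  simp [gradL_apply, Fin.sum_univ_three, PiLp.inner_apply]
  ring

lemma pd_radial {g : ℝ → ℂ} {g' : ℂ} {ξ x : Space3} {e : ℝ}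
    (h : HasDerivAt g g' (‖x - ξ‖ ^ 2 + e)) (i : Fin 3) :
    pd i (fun y => g (‖y - ξ‖ ^ 2 + e)) x = 2 * ((x i - ξ i : ℝ) : ℂ) * g' :=
  (hasFDerivAt_radial h).pd_eq i

lemma pd_coord (ξ x : Space3) (i j : Fin 3) :
    DifferentiableAt ℝ (fun y : Space3 => ((y j - ξ j : ℝ) : ℂ)) x ∧
      pd i (fun y : Space3 => ((y j - ξ j : ℝ) : ℂ)) x = kron i j := by
  have h : HasFDerivAt (fun y : Space3 => ((y j - ξ j : ℝ) : ℂ)) (gradL fun i => kron i j) x := by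
    have h1 : HasFDerivAt (fun y : Space3 => y j - ξ j) (EuclideanSpace.proj j : Space3 →L[ℝ] ℝ) x :=
      ((EuclideanSpace.proj j : Space3 →L[ℝ] ℝ).hasFDerivAt).sub_const _
    refine (Complex.ofRealCLM.hasFDerivAt.comp x h1).congr_fderiv ?_
    ext v
    fin_cases j <;> simp [gradL_apply, kron]
  exact ⟨h.differentiableAt, h.pd_eq i⟩

lemma pd_pd_radial {g g₁ g₂ : ℝ → ℂ} (h₁ : ∀ q, 0 < q → HasDerivAt g (g₁ q) q)
    (h₂ : ∀ q, 0 < q → HasDerivAt g₁ (g₂ q) q) {ξ x : Space3} {e : ℝ} (he : 0 ≤ e)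
    (hx : x ≠ ξ ∨ 0 < e) (i j : Fin 3) :
    pd i (pd j fun y => g (‖y - ξ‖ ^ 2 + e)) x =
      4 * ((x i - ξ i : ℝ) : ℂ) * ((x j - ξ j : ℝ) : ℂ) * g₂ (‖x - ξ‖ ^ 2 + e) +
        2 * kron i j * g₁ (‖x - ξ‖ ^ 2 + e) := by
  have hq : 0 < ‖x - ξ‖ ^ 2 + e := by
    rcases hx with hx | hx
    · have := norm_pos_iff.2 (sub_ne_zero.2 hx)
      positivity
    · positivity
  have hev : (pd j fun y => g (‖y - ξ‖ ^ 2 + e)) =ᶠ[𝓝 x]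
      fun y => 2 * (((y j - ξ j : ℝ) : ℂ) * g₁ (‖y - ξ‖ ^ 2 + e)) := by
    have hc : ContinuousAt (fun y : Space3 => ‖y - ξ‖ ^ 2 + e) x := by fun_prop
    filter_upwards [hc.eventually (lt_mem_nhds hq)] with y hy
    rw [pd_radial (h₁ _ hy), mul_assoc]
  rw [(hev.pd_eventuallyEq i).eq_of_nhds]
  have hr := hasFDerivAt_radial (h₂ _ hq)
  obtain ⟨hd, hv⟩ := pd_coord ξ x i j
  rw [pd_const_mul (f := fun y => ((y j - ξ j : ℝ) : ℂ) * g₁ (‖y - ξ‖ ^ 2 + e))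
    (hd.mul hr.differentiableAt), pd_mul hd hr.differentiableAt, hv, hr.pd_eq]
  ring

/-! ### The scalar wave as a function of the squared distance -/

/-- `e^{i k √q} / √q`. -/
def waveProfile (k : ℂ) (q : ℝ) : ℂ := Complex.exp (Complex.I * k * (√q : ℝ)) / (√q : ℝ)

/-- The derivative of `waveProfile`. -/
def waveProfile₁ (k : ℂ) (q : ℝ) : ℂ :=
  Complex.exp (Complex.I * k * (√q : ℝ)) * (Complex.I * k * (√q : ℝ) - 1) / (2 * (√q : ℝ) ^ 3)

/-- The second derivative of `waveProfile`. -/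
def waveProfile₂ (k : ℂ) (q : ℝ) : ℂ :=
  Complex.exp (Complex.I * k * (√q : ℝ)) *
    ((Complex.I * k * (√q : ℝ)) ^ 2 - 3 * (Complex.I * k * (√q : ℝ)) + 3) / (4 * (√q : ℝ) ^ 5)

lemma hasDerivAt_ofReal_sqrt {q : ℝ} (hq : 0 < q) :
    HasDerivAt (fun q : ℝ => ((√q : ℝ) : ℂ)) (1 / (2 * (√q : ℝ))) q := by
  have := (Real.hasDerivAt_sqrt hq.ne').ofReal_comp
  push_cast at this
  exact this

lemma hasDerivAt_waveProfile (k : ℂ) {q : ℝ} (hq : 0 < q) :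
    HasDerivAt (waveProfile k) (waveProfile₁ k q) q := by
  have hs := hasDerivAt_ofReal_sqrt hq
  have h0 : ((√q : ℝ) : ℂ) ≠ 0 := by exact_mod_cast (Real.sqrt_pos.2 hq).ne'
  refine (((hs.const_mul (Complex.I * k)).cexp).div hs h0).congr_deriv ?_
  rw [waveProfile₁]
  field_simp

lemma hasDerivAt_waveProfile₁ (k : ℂ) {q : ℝ} (hq : 0 < q) :
    HasDerivAt (waveProfile₁ k) (waveProfile₂ k q) q := by
  have hs := hasDerivAt_ofReal_sqrt hq
  have h0 : ((√q : ℝ) : ℂ) ≠ 0 := by exact_mod_cast (Real.sqrt_pos.2 hq).ne'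
  have h3 : (2 : ℂ) * (√q : ℝ) ^ 3 ≠ 0 := mul_ne_zero two_ne_zero (pow_ne_zero _ h0)
  refine (((((hs.const_mul (Complex.I * k)).cexp).mul
    ((hs.const_mul (Complex.I * k)).sub_const 1)).div ((hs.pow 3).const_mul 2) h3)).congr_deriv ?_
  rw [waveProfile₂]
  simp only [Pi.mul_apply, Pi.pow_apply, Nat.cast_ofNat]
  field_simp
  ring

lemma contDiffAt_waveProfile (k : ℂ) {q : ℝ} (hq : 0 < q) : ContDiffAt ℝ ∞ (waveProfile k) q := by
  have hs : ContDiffAt ℝ ∞ (fun q : ℝ => ((√q : ℝ) : ℂ)) q :=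
    Complex.ofRealCLM.contDiff.contDiffAt.comp q (Real.contDiffAt_sqrt hq.ne')
  have h0 : ((√q : ℝ) : ℂ) ≠ 0 := by exact_mod_cast (Real.sqrt_pos.2 hq).ne'
  exact ((contDiffAt_const.mul hs).cexp).mul (hs.inv h0)

lemma contDiffAt_radial_wave (k : ℂ) {ξ x : Space3} {e : ℝ} (he : 0 ≤ e) (hx : x ≠ ξ ∨ 0 < e) :
    ContDiffAt ℝ ∞ (fun y : Space3 => waveProfile k (‖y - ξ‖ ^ 2 + e)) x := by
  have hq : 0 < ‖x - ξ‖ ^ 2 + e := by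
    rcases hx with hx | hx
    · have := norm_pos_iff.2 (sub_ne_zero.2 hx)
      positivity
    · positivity
  have h2 : ContDiffAt ℝ ∞ (fun y : Space3 => ‖y - ξ‖ ^ 2 + e) x :=
    ((contDiffAt_id.sub contDiffAt_const).norm_sq ℝ).add contDiffAt_const
  exact (contDiffAt_waveProfile k hq).comp x h2

lemma sphericalWave_eq (k : ℂ) (ξ : Space3) :
    ZenerMedium.sphericalWave k ξ = fun x => waveProfile k (‖x - ξ‖ ^ 2 + 0) := by
  ext x
  rw [ZenerMedium.sphericalWave, waveProfile, add_zero, Real.sqrt_sq (norm_nonneg _)]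

lemma contDiffAt_sphericalWave (k : ℂ) {ξ x : Space3} (hx : x ≠ ξ) :
    ContDiffAt ℝ ∞ (ZenerMedium.sphericalWave k ξ) x := by
  rw [sphericalWave_eq]
  exact contDiffAt_radial_wave k le_rfl (Or.inl hx)

/-- For g(r² + e) the Laplacian is 4r²g'' + 6g'. The profile satisfies 4qg'' + 6g' + k²g = 0, the
Helmholtz equation for e^{ikr}/r; with q = r² + e only -4e g'' is left over. -/
lemma helmholtz_radial (k : ℂ) (ξ x : Space3) {e : ℝ} (he : 0 < e) :
    (∑ i, pd i (pd i fun y => waveProfile k (‖y - ξ‖ ^ 2 + e)) x) +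
      k ^ 2 * waveProfile k (‖x - ξ‖ ^ 2 + e) = -(4 * e * waveProfile₂ k (‖x - ξ‖ ^ 2 + e)) := by
  have hq : 0 < ‖x - ξ‖ ^ 2 + e := by positivity
  have h0 : ((√(‖x - ξ‖ ^ 2 + e) : ℝ) : ℂ) ≠ 0 := by exact_mod_cast (Real.sqrt_pos.2 hq).ne'
  have hsq : ((√(‖x - ξ‖ ^ 2 + e) : ℝ) : ℂ) ^ 2 =
      ((x 0 - ξ 0 : ℝ) : ℂ) ^ 2 + ((x 1 - ξ 1 : ℝ) : ℂ) ^ 2 + ((x 2 - ξ 2 : ℝ) : ℂ) ^ 2 + e := by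
    rw [← Complex.ofReal_pow, Real.sq_sqrt hq.le, ZenerMedium.norm_sq_space]
    push_cast
    simp
  simp_rw [pd_pd_radial (fun q => hasDerivAt_waveProfile k) (fun q => hasDerivAt_waveProfile₁ k)
    he.le (Or.inr he)]
  rw [Fin.sum_univ_three]
  have hk : ∀ i, kron i i = 1 := fun i => by simp [kron]
  rw [hk, hk, hk]
  have h5 : 4 * waveProfile₂ k (‖x - ξ‖ ^ 2 + e) * ((√(‖x - ξ‖ ^ 2 + e) : ℝ) : ℂ) ^ 2 +
      6 * waveProfile₁ k (‖x - ξ‖ ^ 2 + e) + k ^ 2 * waveProfile k (‖x - ξ‖ ^ 2 + e) = 0 := by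
    rw [waveProfile, waveProfile₁, waveProfile₂]
    field_simp
    ring_nf
    simp only [Complex.I_sq]
    ring
  rw [hsq] at h5
  linear_combination h5

lemma continuousAt_waveProfile₂ (k : ℂ) {q : ℝ} (hq : 0 < q) :
    ContinuousAt (waveProfile₂ k) q := by
  have h0 : ((√q : ℝ) : ℂ) ≠ 0 := by exact_mod_cast (Real.sqrt_pos.2 hq).ne'
  have hs : ContinuousAt (fun q : ℝ => ((√q : ℝ) : ℂ)) q := by fun_prop
  unfold waveProfile₂
  have h5 : (4 : ℂ) * (√q : ℝ) ^ 5 ≠ 0 := mul_ne_zero (by norm_num) (pow_ne_zero _ h0)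
  refine ContinuousAt.div ?_ ?_ h5 <;> fun_prop

lemma norm_I_mul_mul_le (k : ℂ) {s R : ℝ} (hs : 0 ≤ s) (hR : s ≤ R) :
    ‖Complex.I * k * s‖ = ‖k‖ * s ∧ ‖Complex.I * k * s‖ ≤ ‖k‖ * R := by
  have : ‖Complex.I * k * s‖ = ‖k‖ * s := by
    rw [norm_mul, norm_mul, Complex.norm_I, one_mul, Complex.norm_real, Real.norm_of_nonneg hs]
  exact ⟨this, this ▸ by gcongr⟩

lemma norm_exp_le_exp_norm (z : ℂ) : ‖Complex.exp z‖ ≤ Real.exp ‖z‖ := by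
  rw [Complex.norm_exp]
  exact Real.exp_le_exp.2 (Complex.re_le_norm z)

lemma norm_waveProfile_le (k : ℂ) {q R : ℝ} (hR : √q ≤ R) :
    ‖waveProfile k q‖ ≤ Real.exp (‖k‖ * R) * (√q)⁻¹ := by
  rw [waveProfile, norm_div, div_eq_mul_inv, Complex.norm_real,
    Real.norm_of_nonneg (Real.sqrt_nonneg _)]
  gcongr
  refine (norm_exp_le_exp_norm _).trans (Real.exp_le_exp.2 ?_)
  exact (norm_I_mul_mul_le k (Real.sqrt_nonneg _) hR).2

lemma norm_exp_sub_le (z : ℂ) : ‖Complex.exp z - (1 + z)‖ ≤ ‖z‖ ^ 2 * Real.exp ‖z‖ := by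
  have := Complex.norm_exp_sub_sum_le_norm_mul_exp z 2
  simpa [Finset.sum_range_succ] using this

/-- The constant and linear terms of the expansion at z = 0 cancel. With z = ik√q the remaining
factor z² lowers the order of the singularity of `waveProfile₁` by two. -/
lemma norm_profile_numerator₁_le {z : ℂ} {A : ℝ} (hA : ‖z‖ ≤ A) :
    ‖Complex.exp z * (z - 1) + 1‖ ≤ ‖z‖ ^ 2 * ((A + 1) * Real.exp A + 1) := by
  have h := norm_exp_sub_le z
  have e : Complex.exp z * (z - 1) + 1 = (Complex.exp z - (1 + z)) * (z - 1) + z ^ 2 := by ring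
  have hz : ‖z - 1‖ ≤ A + 1 := (norm_sub_le _ _).trans (by simpa using hA)
  have hA0 : 0 ≤ A := (norm_nonneg z).trans hA
  rw [e]
  calc _ ≤ ‖Complex.exp z - (1 + z)‖ * ‖z - 1‖ + ‖z‖ ^ 2 := by
        refine (norm_add_le _ _).trans ?_
        rw [norm_mul, norm_pow]
    _ ≤ (‖z‖ ^ 2 * Real.exp A) * (A + 1) + ‖z‖ ^ 2 := by
        gcongr
        exact h.trans (by gcongr)
    _ = _ := by ring

lemma norm_profile_numerator₂_le {z : ℂ} {A : ℝ} (hA : ‖z‖ ≤ A) :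
    ‖Complex.exp z * (z ^ 2 - 3 * z + 3) - 3‖ ≤
      ‖z‖ ^ 2 * ((A ^ 2 + 3 * A + 3) * Real.exp A + (A + 2)) := by
  have h := norm_exp_sub_le z
  have e : Complex.exp z * (z ^ 2 - 3 * z + 3) - 3 =
    (Complex.exp z - (1 + z)) * (z ^ 2 - 3 * z + 3) + z ^ 2 * (z - 2) := by ring
  have hA0 : 0 ≤ A := (norm_nonneg z).trans hA
  have hz : ‖z ^ 2 - 3 * z + 3‖ ≤ A ^ 2 + 3 * A + 3 := by
    refine (norm_add_le _ _).trans (add_le_add ((norm_sub_le _ _).trans ?_) (by simp))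
    rw [norm_pow, norm_mul]
    simp only [Complex.norm_ofNat]
    gcongr
  have hz2 : ‖z - 2‖ ≤ A + 2 := (norm_sub_le _ _).trans (by simpa using hA)
  rw [e]
  calc _ ≤ ‖Complex.exp z - (1 + z)‖ * ‖z ^ 2 - 3 * z + 3‖ + ‖z‖ ^ 2 * ‖z - 2‖ := by
        refine (norm_add_le _ _).trans ?_
        rw [norm_mul, norm_mul, norm_pow]
    _ ≤ (‖z‖ ^ 2 * Real.exp A) * (A ^ 2 + 3 * A + 3) + ‖z‖ ^ 2 * (A + 2) := by
        gcongr
        exact h.trans (by gcongr)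
    _ = _ := by ring

/-- The strongest singularity -1/(2q^{3/2}) of the first derivative does not involve k; what remains
is O(q^{-1/2}) on bounded sets. The second derivative behaves in the same way, with leading term
3/(4q^{5/2}). -/
lemma exists_norm_waveProfile₁_add_le (k : ℂ) (R : ℝ) : ∃ C, 0 ≤ C ∧ ∀ q, 0 < q → √q ≤ R →
    ‖waveProfile₁ k q + 1 / (2 * (√q : ℝ) ^ 3)‖ ≤ C * (√q)⁻¹ := by
  refine ⟨‖k‖ ^ 2 * ((‖k‖ * |R| + 1) * Real.exp (‖k‖ * |R|) + 1), by positivity, ?_⟩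
  intro q hq hqR
  have hs : 0 < √q := Real.sqrt_pos.2 hq
  obtain ⟨h1, h2⟩ := norm_I_mul_mul_le k hs.le (hqR.trans (le_abs_self R))
  have h3 := norm_profile_numerator₁_le h2
  have e : waveProfile₁ k q + 1 / (2 * (√q : ℝ) ^ 3) =
      (Complex.exp (Complex.I * k * (√q : ℝ)) * (Complex.I * k * (√q : ℝ) - 1) + 1) /
        ((2 * √q ^ 3 : ℝ) : ℂ) := by
    rw [waveProfile₁]
    push_cast
    ring
  rw [e, norm_div, Complex.norm_real, Real.norm_of_nonneg (by positivity),
    div_le_iff₀ (by positivity)]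
  rw [h1, mul_pow ‖k‖] at h3
  refine h3.trans ?_
  set B := (‖k‖ * |R| + 1) * Real.exp (‖k‖ * |R|) + 1
  have hB : 0 ≤ B := by positivity
  have : ‖k‖ ^ 2 * B * (√q)⁻¹ * (2 * √q ^ 3) = 2 * (‖k‖ ^ 2 * √q ^ 2 * B) := by
    field_simp
  rw [this]
  have : 0 ≤ ‖k‖ ^ 2 * √q ^ 2 * B := by positivity
  linarith

lemma exists_norm_waveProfile₂_sub_le (k : ℂ) (R : ℝ) : ∃ C, 0 ≤ C ∧ ∀ q, 0 < q → √q ≤ R →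
    ‖waveProfile₂ k q - 3 / (4 * (√q : ℝ) ^ 5)‖ * √q ^ 2 ≤ C * (√q)⁻¹ := by
  refine ⟨‖k‖ ^ 2 * (((‖k‖ * |R|) ^ 2 + 3 * (‖k‖ * |R|) + 3) * Real.exp (‖k‖ * |R|) +
    (‖k‖ * |R| + 2)), by positivity, ?_⟩
  intro q hq hqR
  have hs : 0 < √q := Real.sqrt_pos.2 hq
  obtain ⟨h1, h2⟩ := norm_I_mul_mul_le k hs.le (hqR.trans (le_abs_self R))
  have h3 := norm_profile_numerator₂_le h2
  have e : waveProfile₂ k q - 3 / (4 * (√q : ℝ) ^ 5) =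
      (Complex.exp (Complex.I * k * (√q : ℝ)) * ((Complex.I * k * (√q : ℝ)) ^ 2 -
        3 * (Complex.I * k * (√q : ℝ)) + 3) - 3) / ((4 * √q ^ 5 : ℝ) : ℂ) := by
    rw [waveProfile₂]
    push_cast
    ring
  rw [e, norm_div, Complex.norm_real, Real.norm_of_nonneg (by positivity), div_mul_eq_mul_div,
    div_le_iff₀ (by positivity)]
  rw [h1, mul_pow ‖k‖] at h3
  set B := ((‖k‖ * |R|) ^ 2 + 3 * (‖k‖ * |R|) + 3) * Real.exp (‖k‖ * |R|) + (‖k‖ * |R| + 2)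
  have hB : 0 ≤ B := by positivity
  have : ‖k‖ ^ 2 * B * (√q)⁻¹ * (4 * √q ^ 5) = 4 * (‖k‖ ^ 2 * √q ^ 2 * B * √q ^ 2) := by
    field_simp
  rw [this]
  have h4 : 0 ≤ ‖k‖ ^ 2 * √q ^ 2 * B * √q ^ 2 := by positivity
  have h5 := mul_le_mul_of_nonneg_right h3 (sq_nonneg √q)
  linarith

lemma norm_coord_mul_le (y : Space3) (i j : Fin 3) : ‖((y i : ℝ) : ℂ) * ((y j : ℝ) : ℂ)‖ ≤ ‖y‖ ^ 2 := by
  rw [norm_mul, Complex.norm_real, Complex.norm_real, pow_two]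
  exact mul_le_mul (PiLp.norm_apply_le y i) (PiLp.norm_apply_le y j) (norm_nonneg _) (norm_nonneg _)

lemma norm_kron_le (i j : Fin 3) : ‖kron i j‖ ≤ 1 := by
  unfold kron
  split_ifs <;> simp

/-- The difference of two scalar waves, as a function of the squared distance. -/
def diffProfile (k k' : ℂ) (q : ℝ) : ℂ := waveProfile k q - waveProfile k' q

/-- The leading singularities are independent of the wave number and cancel in the difference, so
the Hessian is O(1/r) instead of O(1/r³). Uniformity in e ∈ [0,1] allows the passage e → 0; the case
e = 0 gives local integrability of u*. -/
lemma exists_norm_pd_pd_diffProfile_le (k k' : ℂ) (ξ : Space3) (i j : Fin 3) (R : ℝ) :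
    ∃ C, ∀ x, ∀ e ∈ Set.Icc (0 : ℝ) 1, x ≠ ξ → ‖x - ξ‖ ≤ R →
      ‖pd i (pd j fun y => diffProfile k k' (‖y - ξ‖ ^ 2 + e)) x‖ ≤ C * ‖x - ξ‖⁻¹ := by
  set R' := √(R ^ 2 + 1)
  obtain ⟨C₁, h1, hC₁⟩ := exists_norm_waveProfile₁_add_le k R'
  obtain ⟨C₁', h1', hC₁'⟩ := exists_norm_waveProfile₁_add_le k' R'
  obtain ⟨C₂, h2, hC₂⟩ := exists_norm_waveProfile₂_sub_le k R'
  obtain ⟨C₂', h2', hC₂'⟩ := exists_norm_waveProfile₂_sub_le k' R'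
  refine ⟨4 * (C₂ + C₂') + 2 * (C₁ + C₁'), fun x e he hx hxR => ?_⟩
  have hpos : 0 < ‖x - ξ‖ := norm_pos_iff.2 (sub_ne_zero.2 hx)
  set q := ‖x - ξ‖ ^ 2 + e with hqdef
  have hq : 0 < q := add_pos_of_pos_of_nonneg (by positivity) he.1
  have hqR : √q ≤ R' := Real.sqrt_le_sqrt (add_le_add (by gcongr) he.2)
  have hle : ‖x - ξ‖ ≤ √q := Real.le_sqrt_of_sq_le (by linarith [he.1])
  have hs : 0 < √q := hpos.trans_le hle
  rw [pd_pd_radial (g := diffProfile k k')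
    (g₁ := fun q => waveProfile₁ k q - waveProfile₁ k' q)
    (g₂ := fun q => waveProfile₂ k q - waveProfile₂ k' q)
    (fun q h => (hasDerivAt_waveProfile k h).sub (hasDerivAt_waveProfile k' h))
    (fun q h => (hasDerivAt_waveProfile₁ k h).sub (hasDerivAt_waveProfile₁ k' h)) he.1 (Or.inl hx)]
  rw [← hqdef]
  have b1 : ‖waveProfile₁ k q - waveProfile₁ k' q‖ ≤ (C₁ + C₁') * (√q)⁻¹ := by
    rw [show waveProfile₁ k q - waveProfile₁ k' q = (waveProfile₁ k q + 1 / (2 * (√q : ℝ) ^ 3)) -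
      (waveProfile₁ k' q + 1 / (2 * (√q : ℝ) ^ 3)) by ring, add_mul]
    exact (norm_sub_le _ _).trans (add_le_add (hC₁ q hq hqR) (hC₁' q hq hqR))
  have b2 : ‖waveProfile₂ k q - waveProfile₂ k' q‖ * √q ^ 2 ≤ (C₂ + C₂') * (√q)⁻¹ := by
    rw [show waveProfile₂ k q - waveProfile₂ k' q = (waveProfile₂ k q - 3 / (4 * (√q : ℝ) ^ 5)) -
      (waveProfile₂ k' q - 3 / (4 * (√q : ℝ) ^ 5)) by ring, add_mul]
    refine (mul_le_mul_of_nonneg_right (norm_sub_le _ _) (sq_nonneg _)).trans ?_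
    rw [add_mul]
    exact add_le_add (hC₂ q hq hqR) (hC₂' q hq hqR)
  have b3 : ‖((x i - ξ i : ℝ) : ℂ) * ((x j - ξ j : ℝ) : ℂ)‖ ≤ √q ^ 2 := by
    refine (norm_coord_mul_le (x - ξ) i j).trans ?_
    gcongr
  have b4 : (√q)⁻¹ ≤ ‖x - ξ‖⁻¹ := by gcongr
  calc _ ≤ 4 * (‖waveProfile₂ k q - waveProfile₂ k' q‖ *
          ‖((x i - ξ i : ℝ) : ℂ) * ((x j - ξ j : ℝ) : ℂ)‖) +
          2 * (‖kron i j‖ * ‖waveProfile₁ k q - waveProfile₁ k' q‖) := by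
        refine (norm_add_le _ _).trans (le_of_eq ?_)
        simp only [norm_mul, Complex.norm_ofNat]
        ring
    _ ≤ 4 * (‖waveProfile₂ k q - waveProfile₂ k' q‖ * √q ^ 2) +
          2 * (1 * ‖waveProfile₁ k q - waveProfile₁ k' q‖) := by
        gcongr
        exact norm_kron_le i j
    _ ≤ 4 * ((C₂ + C₂') * (√q)⁻¹) + 2 * (1 * ((C₁ + C₁') * (√q)⁻¹)) := by gcongr
    _ = (4 * (C₂ + C₂') + 2 * (C₁ + C₁')) * (√q)⁻¹ := by ring
    _ ≤ _ := by gcongr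

/-- A null sequence in `(0, 1]`. -/
def nullSeq (n : ℕ) : ℝ := 1 / ((n : ℝ) + 1)

lemma nullSeq_pos (n : ℕ) : 0 < nullSeq n := by unfold nullSeq; positivity

lemma nullSeq_le_one (n : ℕ) : nullSeq n ≤ 1 := by
  rw [nullSeq, div_le_one (by positivity)]
  linarith [(Nat.cast_nonneg n : (0 : ℝ) ≤ n)]

lemma tendsto_nullSeq : Tendsto nullSeq atTop (𝓝 0) := tendsto_one_div_add_atTop_nhds_zero_nat

lemma tendsto_radial {g : ℝ → ℂ} (hg : ∀ q, 0 < q → ContinuousAt g q) {ξ x : Space3} (hx : x ≠ ξ)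
    {e : ℕ → ℝ} (he : Tendsto e atTop (𝓝 0)) :
    Tendsto (fun n => g (‖x - ξ‖ ^ 2 + e n)) atTop (𝓝 (g (‖x - ξ‖ ^ 2 + 0))) := by
  have hpos : 0 < ‖x - ξ‖ := norm_pos_iff.2 (sub_ne_zero.2 hx)
  exact (hg _ (by positivity)).tendsto.comp (tendsto_const_nhds.add he)

lemma exists_norm_radial_wave_le (k : ℂ) (ξ : Space3) (R : ℝ) :
    ∃ C, ∀ x, ∀ e ∈ Set.Icc (0 : ℝ) 1, x ≠ ξ → ‖x - ξ‖ ≤ R →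
      ‖waveProfile k (‖x - ξ‖ ^ 2 + e)‖ ≤ C * ‖x - ξ‖⁻¹ := by
  refine ⟨Real.exp (‖k‖ * √(R ^ 2 + 1)), fun x e he hx hxR => ?_⟩
  have hpos : 0 < ‖x - ξ‖ := norm_pos_iff.2 (sub_ne_zero.2 hx)
  refine (norm_waveProfile_le k (R := √(R ^ 2 + 1)) ?_).trans ?_
  · exact Real.sqrt_le_sqrt (add_le_add (by gcongr) he.2)
  · gcongr
    exact Real.le_sqrt_of_sq_le (by linarith [he.1])

lemma contDiff_radial_wave (k : ℂ) (ξ : Space3) {e : ℝ} (he : 0 < e) :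
    ContDiff ℝ ∞ (fun y : Space3 => waveProfile k (‖y - ξ‖ ^ 2 + e)) :=
  contDiff_iff_contDiffAt.2 fun _ => contDiffAt_radial_wave k he.le (Or.inr he)

lemma tendsto_integral_radial_wave (k : ℂ) (ξ : Space3) {e : ℕ → ℝ} (hpos : ∀ n, 0 < e n)
    (hle : ∀ n, e n ≤ 1) (hlim : Tendsto e atTop (𝓝 0)) {χ : Space3 → ℂ} (hχ : Continuous χ)
    (hc : HasCompactSupport χ) :
    Tendsto (fun n => ∫ x, waveProfile k (‖x - ξ‖ ^ 2 + e n) * χ x) atTop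
      (𝓝 (∫ x, ZenerMedium.sphericalWave k ξ x * χ x)) := by
  rw [sphericalWave_eq]
  refine tendsto_integral_mul_of_le_inv_norm (ξ := ξ) hχ hc
    (fun n => (contDiff_radial_wave k ξ (hpos n)).continuous) (fun R => ?_)
    (fun x hx => tendsto_radial (fun q hq => (hasDerivAt_waveProfile k hq).continuousAt) hx hlim)
  obtain ⟨C, hC⟩ := exists_norm_radial_wave_le k ξ R
  exact ⟨C, fun n x hx hxR => hC x _ ⟨(hpos n).le, hle n⟩ hx hxR⟩

/-- The pointwise Hessian of φ - φ' has no additional point mass at ξ: for the regularised profiles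
this is integration by parts, and both sides converge because their singularities are O(1/r). -/
lemma integral_pd_pd_diff (k k' : ℂ) (ξ : Space3) {χ : Space3 → ℂ} (hχ : ContDiff ℝ ∞ χ)
    (hc : HasCompactSupport χ) (i j : Fin 3) :
    ∫ x, pd i (pd j fun y => ZenerMedium.sphericalWave k ξ y - ZenerMedium.sphericalWave k' ξ y) x
      * χ x =
    ∫ x, (ZenerMedium.sphericalWave k ξ x - ZenerMedium.sphericalWave k' ξ x) * pd i (pd j χ) x := by
  have hd : ∀ n, ContDiff ℝ ∞ (fun y => diffProfile k k' (‖y - ξ‖ ^ 2 + nullSeq n)) := fun n =>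
    (contDiff_radial_wave k ξ (nullSeq_pos n)).sub (contDiff_radial_wave k' ξ (nullSeq_pos n))
  have hfun : (fun y => ZenerMedium.sphericalWave k ξ y - ZenerMedium.sphericalWave k' ξ y) =
      fun y => diffProfile k k' (‖y - ξ‖ ^ 2 + 0) := by
    rw [sphericalWave_eq, sphericalWave_eq]
    rfl
  have h1 : Tendsto (fun n => ∫ x, pd i (pd j fun y => diffProfile k k' (‖y - ξ‖ ^ 2 + nullSeq n)) x
      * χ x) atTop (𝓝 (∫ x, pd i (pd j fun y => diffProfile k k' (‖y - ξ‖ ^ 2 + 0)) x * χ x)) := by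
    refine tendsto_integral_mul_of_le_inv_norm (ξ := ξ) hχ.continuous hc
      (fun n => (((hd n).pd_infty j).pd_infty i).continuous) (fun R => ?_) (fun x hx => ?_)
    · obtain ⟨C, hC⟩ := exists_norm_pd_pd_diffProfile_le k k' ξ i j R
      exact ⟨C, fun n x hx hxR => hC x _ ⟨(nullSeq_pos n).le, nullSeq_le_one n⟩ hx hxR⟩
    · have hp : ∀ e, 0 ≤ e → pd i (pd j fun y => diffProfile k k' (‖y - ξ‖ ^ 2 + e)) x = _ :=
        fun e he => pd_pd_radial (g := diffProfile k k')
          (g₁ := fun q => waveProfile₁ k q - waveProfile₁ k' q)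
          (g₂ := fun q => waveProfile₂ k q - waveProfile₂ k' q)
          (fun q h => (hasDerivAt_waveProfile k h).sub (hasDerivAt_waveProfile k' h))
          (fun q h => (hasDerivAt_waveProfile₁ k h).sub (hasDerivAt_waveProfile₁ k' h)) he
          (Or.inl hx) i j
      rw [hp 0 le_rfl]
      simp_rw [hp _ (nullSeq_pos _).le]
      refine ((tendsto_radial (g := fun q => waveProfile₂ k q - waveProfile₂ k' q) (fun q hq => ?_)
        hx tendsto_nullSeq).const_mul _).add
        ((tendsto_radial (g := fun q => waveProfile₁ k q - waveProfile₁ k' q) (fun q hq => ?_)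
        hx tendsto_nullSeq).const_mul _)
      · exact (continuousAt_waveProfile₂ k hq).sub (continuousAt_waveProfile₂ k' hq)
      · exact (hasDerivAt_waveProfile₁ k hq).continuousAt.sub
          (hasDerivAt_waveProfile₁ k' hq).continuousAt
  have h2 : Tendsto (fun n => ∫ x, diffProfile k k' (‖x - ξ‖ ^ 2 + nullSeq n) * pd i (pd j χ) x)
      atTop (𝓝 (∫ x, diffProfile k k' (‖x - ξ‖ ^ 2 + 0) * pd i (pd j χ) x)) := by
    refine tendsto_integral_mul_of_le_inv_norm (ξ := ξ) ((hχ.pd_infty j).pd_infty i).continuous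
      ((hc.pd j).pd i) (fun n => (hd n).continuous) (fun R => ?_) (fun x hx => ?_)
    · obtain ⟨C, hC⟩ := exists_norm_radial_wave_le k ξ R
      obtain ⟨C', hC'⟩ := exists_norm_radial_wave_le k' ξ R
      refine ⟨C + C', fun n x hx hxR => ?_⟩
      have he : nullSeq n ∈ Set.Icc (0 : ℝ) 1 := ⟨(nullSeq_pos n).le, nullSeq_le_one n⟩
      rw [add_mul]
      exact (norm_sub_le _ _).trans (add_le_add (hC x _ he hx hxR) (hC' x _ he hx hxR))
    · exact tendsto_radial (fun q hq => (hasDerivAt_waveProfile k hq).continuousAt.sub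
        (hasDerivAt_waveProfile k' hq).continuousAt) hx tendsto_nullSeq
  have hfun' : ∀ x, ZenerMedium.sphericalWave k ξ x - ZenerMedium.sphericalWave k' ξ x =
      diffProfile k k' (‖x - ξ‖ ^ 2 + 0) := fun x => congrFun hfun x
  rw [hfun]
  simp_rw [hfun']
  refine tendsto_nhds_unique h1 (h2.congr fun n => ?_)
  exact integral_mul_pd_pd hχ hc (fun x _ => (hd n).contDiffAt) i j

/-! ### The fundamental solution of the Helmholtz equation -/

lemma integral_Ioi_sq_div : ∫ y in Set.Ioi (0 : ℝ), y ^ 2 * (√(y ^ 2 + 1) ^ 5)⁻¹ = 1 / 3 := by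
  have hpos : ∀ y : ℝ, 0 < √(y ^ 2 + 1) := fun y => Real.sqrt_pos.2 (by positivity)
  have hsq : ∀ y : ℝ, √(y ^ 2 + 1) ^ 2 = y ^ 2 + 1 := fun y => Real.sq_sqrt (by positivity)
  -- The primitive (y/√(y²+1))³/3 increases from 0 to 1/3.
  have hd : ∀ y : ℝ, HasDerivAt (fun y : ℝ => (y / √(y ^ 2 + 1)) ^ 3 / 3)
      (y ^ 2 * (√(y ^ 2 + 1) ^ 5)⁻¹) y := by
    intro y
    have h1 : HasDerivAt (fun y : ℝ => y ^ 2 + 1) (2 * y) y := by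
      simpa using (hasDerivAt_pow 2 y).add_const (1 : ℝ)
    have h2 := h1.sqrt (by positivity)
    have h3 := ((((hasDerivAt_id y).div h2 (hpos y).ne').pow 3).div_const 3)
    refine h3.congr_deriv ?_
    have h0 := (hpos y).ne'
    have h4 : √(y ^ 2 + 1) ^ 2 - y ^ 2 = 1 := by rw [hsq]; ring
    calc _ = y ^ 2 * (√(y ^ 2 + 1) ^ 2 - y ^ 2) * (√(y ^ 2 + 1) ^ 5)⁻¹ := by
          simp only [id, Pi.div_apply, Nat.cast_ofNat, show 3 - 1 = 2 from rfl]
          field_simp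
      _ = _ := by rw [h4, mul_one]
  have hlim : Tendsto (fun y : ℝ => (y / √(y ^ 2 + 1)) ^ 3 / 3) atTop (𝓝 (1 / 3)) := by
    have h1 : Tendsto (fun y : ℝ => y / √(y ^ 2 + 1)) atTop (𝓝 1) := by
      have h2 : Tendsto (fun y : ℝ => (√(1 + (y ^ 2)⁻¹))⁻¹) atTop (𝓝 1) := by
        have h3 : Tendsto (fun y : ℝ => 1 + (y ^ 2)⁻¹) atTop (𝓝 (1 + 0)) :=
          tendsto_const_nhds.add ((tendsto_pow_atTop two_ne_zero).inv_tendsto_atTop)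
        have h4 := (h3.sqrt).inv₀ (by simp)
        simpa using h4
      refine h2.congr' ?_
      filter_upwards [eventually_gt_atTop 0] with y hy
      rw [show y ^ 2 + 1 = y ^ 2 * (1 + (y ^ 2)⁻¹) by field_simp, Real.sqrt_mul (by positivity),
        Real.sqrt_sq hy.le]
      field_simp
    simpa using (h1.pow 3).div_const 3
  have h := integral_Ioi_of_hasDerivAt_of_nonneg' (a := 0) (fun y _ => hd y)
    (fun y (_ : 0 < y) => by positivity) hlim
  rw [h]
  simp

lemma integral_inv_sqrt_pow_five :
    ∫ y : Space3, (√(‖y‖ ^ 2 + 1) ^ 5)⁻¹ = 4 * Real.pi / 3 := by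
  have h := integral_fun_norm_addHaar (volume : Measure Space3)
    (fun r : ℝ => (√(r ^ 2 + 1) ^ 5)⁻¹)
  simp only [finrank_euclideanSpace, Fintype.card_fin, smul_eq_mul, Nat.add_one_sub_one,
    integral_Ioi_sq_div, nsmul_eq_mul] at h
  rw [h, Measure.real, EuclideanSpace.volume_ball_fin_three]
  simp only [ENNReal.ofReal_one, one_pow, one_mul, Nat.cast_ofNat]
  rw [ENNReal.toReal_ofReal (by positivity)]
  ring

lemma integrable_inv_sqrt_pow_four : Integrable (fun y : Space3 => (√(‖y‖ ^ 2 + 1) ^ 4)⁻¹) := by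
  have h := integrable_rpow_neg_one_add_norm_sq (E := Space3) (μ := volume) (r := 4)
    (by simp; norm_num)
  refine h.congr (ae_of_all _ fun y => ?_)
  simp only
  rw [show (-4 / 2 : ℝ) = -((2 : ℕ) : ℝ) by norm_num, Real.rpow_neg (by positivity),
    Real.rpow_natCast, show √(‖y‖ ^ 2 + 1) ^ 4 = (√(‖y‖ ^ 2 + 1) ^ 2) ^ 2 by ring,
    Real.sq_sqrt (by positivity), add_comm]

/-- The residue -4e g'' with e = ε² is an approximate identity at scale ε. Under x = ξ + εy it
becomes -e^z(z² - 3z + 3)(|y|²+1)^{-5/2} with z = ikε√(|y|²+1) → 0, and the limit has mass -3 · 4π/3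
= -4π. -/
lemma tendsto_integral_scaled (k : ℂ) (ξ : Space3) {χ : Space3 → ℂ} (hχ : Continuous χ)
    (hc : HasCompactSupport χ) :
    Tendsto (fun n => ∫ x, -(4 * ((nullSeq n ^ 2 : ℝ) : ℂ) *
      waveProfile₂ k (‖x - ξ‖ ^ 2 + nullSeq n ^ 2)) * χ x) atTop (𝓝 (-(4 * Real.pi) * χ ξ)) := by
  let s : Space3 → ℝ := fun y => √(‖y‖ ^ 2 + 1)
  have hs1 : ∀ y, 1 ≤ s y := fun y => Real.one_le_sqrt.2 (by linarith [sq_nonneg ‖y‖])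
  have hs0 : ∀ y, 0 < s y := fun y => one_pos.trans_le (hs1 y)
  let G : ℕ → Space3 → ℂ := fun n y => -(Complex.exp (Complex.I * k * ((nullSeq n * s y : ℝ) : ℂ)) *
    ((Complex.I * k * ((nullSeq n * s y : ℝ) : ℂ)) ^ 2 -
      3 * (Complex.I * k * ((nullSeq n * s y : ℝ) : ℂ)) + 3) * ((s y ^ 5)⁻¹ : ℝ)) *
      χ (ξ + nullSeq n • y)
  have hG : ∀ n, ∫ x, -(4 * ((nullSeq n ^ 2 : ℝ) : ℂ) *
      waveProfile₂ k (‖x - ξ‖ ^ 2 + nullSeq n ^ 2)) * χ x = ∫ y, G n y := by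
    intro n
    have hε := nullSeq_pos n
    set ε := nullSeq n with hεdef
    set F : Space3 → ℂ := fun x => -(4 * ((ε ^ 2 : ℝ) : ℂ) *
      waveProfile₂ k (‖x - ξ‖ ^ 2 + ε ^ 2)) * χ x with hF
    have h1 : ∫ x, F x = ∫ x, F (x + ξ) := (integral_add_right_eq_self F ξ).symm
    have h2 := Measure.integral_comp_smul (volume : Measure Space3) (fun x => F (x + ξ)) ε
    have h3 : ∫ x, F (x + ξ) = (ε ^ 3 : ℝ) • ∫ y, F (ε • y + ξ) := by
      rw [h2, smul_smul]
      simp only [finrank_euclideanSpace, Fintype.card_fin]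
      rw [abs_of_pos (by positivity), mul_inv_cancel₀ (by positivity), one_smul]
    rw [h1, h3, ← integral_smul]
    refine integral_congr_ae (ae_of_all _ fun y => ?_)
    have h4 : √(‖ε • y + ξ - ξ‖ ^ 2 + ε ^ 2) = ε * s y := by
      rw [add_sub_cancel_right, norm_smul, Real.norm_of_nonneg hε.le, mul_pow,
        show ε ^ 2 * ‖y‖ ^ 2 + ε ^ 2 = ε ^ 2 * (‖y‖ ^ 2 + 1) by ring,
        Real.sqrt_mul (by positivity), Real.sqrt_sq hε.le]
    simp only [hF, G, waveProfile₂, h4, ← hεdef]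
    have e1 : (ε : ℂ) ≠ 0 := by exact_mod_cast hε.ne'
    have e2 : (s y : ℂ) ≠ 0 := by exact_mod_cast (hs0 y).ne'
    rw [Complex.real_smul, add_comm (ε • y) ξ]
    push_cast
    field_simp
  have hval : ∫ y : Space3, -(3 * ((s y ^ 5)⁻¹ : ℝ) : ℂ) * χ ξ = -(4 * Real.pi) * χ ξ := by
    rw [integral_mul_const, integral_neg, integral_const_mul, integral_complex_ofReal]
    simp only [s]
    rw [integral_inv_sqrt_pow_five]
    push_cast
    ring
  rw [← hval]
  simp_rw [hG]
  obtain ⟨B, hB⟩ := hc.exists_bound_of_continuous hχ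
  obtain ⟨R, hR⟩ := (hc.isCompact.image (f := fun x => ‖x - ξ‖) (by fun_prop)).bddAbove
  set R' := √(R ^ 2 + 1) with hR'
  set A := ‖k‖ * R' with hA
  have hA0 : 0 ≤ A := by positivity
  have hB0 : 0 ≤ B := (norm_nonneg _).trans (hB 0)
  refine tendsto_integral_of_dominated_convergence
    (fun y => (Real.exp A * (A * ‖k‖ + 3 * ‖k‖ + 3) * B) * (s y ^ 4)⁻¹) (fun n => ?_)
    (integrable_inv_sqrt_pow_four.const_mul _) (fun n => ae_of_all _ fun y => ?_)
    (ae_of_all _ fun y => ?_)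
  · refine Continuous.aestronglyMeasurable ?_
    have hsc : Continuous s := by fun_prop
    have hsi : Continuous fun y => (s y ^ 5)⁻¹ :=
      (hsc.pow 5).inv₀ fun y => pow_ne_zero _ (hs0 y).ne'
    simp only [G]
    fun_prop
  · have hε := nullSeq_pos n
    have hε1 := nullSeq_le_one n
    set ε := nullSeq n
    simp only [G]
    rw [norm_mul, norm_neg, norm_mul, norm_mul]
    by_cases hy : ξ + ε • y ∈ tsupport χ
    · have h1 : ‖ε • y‖ ≤ R := by
        have := hR ⟨_, hy, rfl⟩
        simpa using this
      have h2 : ε * s y ≤ R' := by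
        have : ε * s y = √(‖ε • y‖ ^ 2 + ε ^ 2) := by
          rw [norm_smul, Real.norm_of_nonneg hε.le, mul_pow,
            show ε ^ 2 * ‖y‖ ^ 2 + ε ^ 2 = ε ^ 2 * (‖y‖ ^ 2 + 1) by ring,
            Real.sqrt_mul (by positivity), Real.sqrt_sq hε.le]
        rw [this]
        refine Real.sqrt_le_sqrt ?_
        have : ε ^ 2 ≤ 1 := by nlinarith
        have : ‖ε • y‖ ^ 2 ≤ R ^ 2 := by gcongr
        linarith
      obtain ⟨h3, h4⟩ := norm_I_mul_mul_le k (mul_nonneg hε.le (hs0 y).le) h2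
      set z := Complex.I * k * ((ε * s y : ℝ) : ℂ)
      have h5 : ‖z‖ ≤ ‖k‖ * s y := by
        rw [h3]
        gcongr
        exact mul_le_of_le_one_left (hs0 y).le hε1
      -- In z² one factor is bounded by A on the support of χ and only the other by ‖k‖ s(y). Just
      -- one power of s is lost, and s^{-4} is still integrable on ℝ³.
      have h6 : ‖z ^ 2 - 3 * z + 3‖ ≤ (A * ‖k‖ + 3 * ‖k‖ + 3) * s y := by
        calc _ ≤ ‖z‖ * ‖z‖ + 3 * ‖z‖ + 3 := by
              refine (norm_add_le _ _).trans (add_le_add ((norm_sub_le _ _).trans ?_) (by simp))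
              rw [norm_pow, norm_mul (3 : ℂ) z, pow_two, Complex.norm_ofNat]
          _ ≤ A * (‖k‖ * s y) + 3 * (‖k‖ * s y) + 3 * s y := by
              have := hs1 y
              gcongr
              linarith
          _ = _ := by ring
      have h7 : ‖((s y ^ 5)⁻¹ : ℝ)‖ = (s y ^ 5)⁻¹ := Real.norm_of_nonneg (by have := hs0 y; positivity)
      rw [Complex.norm_real, h7]
      have := hs0 y
      calc _ ≤ Real.exp A * ((A * ‖k‖ + 3 * ‖k‖ + 3) * s y) * (s y ^ 5)⁻¹ * B := by
            gcongr
            · exact (norm_exp_le_exp_norm _).trans (Real.exp_le_exp.2 h4)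
            · exact hB _
        _ = _ := by field_simp
    · rw [image_eq_zero_of_notMem_tsupport hy, norm_zero, mul_zero]
      have := hs0 y
      positivity
  · have hm : Tendsto (fun n => Complex.I * k * ((nullSeq n * s y : ℝ) : ℂ)) atTop (𝓝 0) := by
      have h1 : Tendsto (fun n => nullSeq n * s y) atTop (𝓝 0) := by
        simpa using tendsto_nullSeq.mul_const (s y)
      have h2 := ((Complex.continuous_ofReal.tendsto 0).comp h1).const_mul (Complex.I * k)
      simpa using h2
    have hx : Tendsto (fun n => χ (ξ + nullSeq n • y)) atTop (𝓝 (χ ξ)) := by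
      refine (hχ.tendsto ξ).comp ?_
      simpa using (tendsto_const_nhds (x := ξ)).add (tendsto_nullSeq.smul_const y)
    have he := (Complex.continuous_exp.tendsto 0).comp hm
    have := ((((he.mul (((hm.pow 2).sub (hm.const_mul 3)).add_const 3)).mul_const
      (((s y ^ 5)⁻¹ : ℝ) : ℂ)).neg).mul hx)
    simpa [G] using this

/-- `e^{ikr}/r` is `-4π` times a fundamental solution of the Helmholtz equation. -/
lemma integral_sphericalWave_helmholtz (k : ℂ) (ξ : Space3) {χ : Space3 → ℂ}
    (hχ : ContDiff ℝ ∞ χ) (hc : HasCompactSupport χ) :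
    ∫ x, ZenerMedium.sphericalWave k ξ x * ((∑ i, pd i (pd i χ) x) + k ^ 2 * χ x) =
      -(4 * Real.pi) * χ ξ := by
  have hlim : Tendsto (fun n => nullSeq n ^ 2) atTop (𝓝 0) := by
    simpa using tendsto_nullSeq.pow 2
  have hpos : ∀ n, 0 < nullSeq n ^ 2 := fun n => pow_pos (nullSeq_pos n) 2
  have hle : ∀ n, nullSeq n ^ 2 ≤ 1 := fun n => pow_le_one₀ (nullSeq_pos n).le (nullSeq_le_one n)
  have hXi : ∀ i, ContDiff ℝ ∞ (pd i (pd i χ)) := fun i => (hχ.pd_infty i).pd_infty i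
  have hXc : ∀ i, HasCompactSupport (pd i (pd i χ)) := fun i => (hc.pd i).pd i
  have hX : Continuous (fun x => (∑ i, pd i (pd i χ) x) + k ^ 2 * χ x) :=
    (continuous_finsetSum _ fun i _ => (hXi i).continuous).add (continuous_const.mul hχ.continuous)
  have hXs : HasCompactSupport (fun x => (∑ i, pd i (pd i χ) x) + k ^ 2 * χ x) := by
    refine HasCompactSupport.intro hc fun x hx => ?_
    have h1 : ∀ i, pd i (pd i χ) x = 0 := fun i => image_eq_zero_of_notMem_tsupport fun h =>
      hx (tsupport_pd_subset _ _ (tsupport_pd_subset _ _ h))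
    simp [h1, image_eq_zero_of_notMem_tsupport hx]
  refine tendsto_nhds_unique (tendsto_integral_radial_wave k ξ hpos hle hlim hX hXs) ?_
  refine (tendsto_integral_scaled k ξ hχ.continuous hc).congr fun n => ?_
  have hφ := contDiff_radial_wave k ξ (hpos n)
  have hcont : ∀ (f : Space3 → ℂ) (g : Space3 → ℂ), ContDiff ℝ ∞ f → ContDiff ℝ ∞ g →
      HasCompactSupport g → Integrable (fun x => f x * g x) := fun f g hf hg hgc =>
    integrable_mul_of_continuousOn_tsupport hg.continuous hgc hf.continuous.continuousOn
  have e1 : ∀ x, -(4 * ((nullSeq n ^ 2 : ℝ) : ℂ) * waveProfile₂ k (‖x - ξ‖ ^ 2 + nullSeq n ^ 2)) * χ x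
      = (∑ i, pd i (pd i fun y => waveProfile k (‖y - ξ‖ ^ 2 + nullSeq n ^ 2)) x * χ x) +
        waveProfile k (‖x - ξ‖ ^ 2 + nullSeq n ^ 2) * (k ^ 2 * χ x) := by
    intro x
    rw [← helmholtz_radial k ξ x (hpos n), add_mul, Finset.sum_mul]
    ring
  have e2 : ∀ x, waveProfile k (‖x - ξ‖ ^ 2 + nullSeq n ^ 2) * ((∑ i, pd i (pd i χ) x) + k ^ 2 * χ x)
      = (∑ i, waveProfile k (‖x - ξ‖ ^ 2 + nullSeq n ^ 2) * pd i (pd i χ) x) +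
        waveProfile k (‖x - ξ‖ ^ 2 + nullSeq n ^ 2) * (k ^ 2 * χ x) := by
    intro x
    rw [mul_add, Finset.mul_sum]
  have hk : Integrable (fun x => waveProfile k (‖x - ξ‖ ^ 2 + nullSeq n ^ 2) * (k ^ 2 * χ x)) :=
    hcont _ _ hφ (contDiff_const.mul hχ) hc.mul_left
  simp_rw [e1, e2]
  rw [integral_add (integrable_finsetSum _ fun i _ =>
      hcont _ _ ((hφ.pd_infty i).pd_infty i) hχ hc) hk,
    integral_add (integrable_finsetSum _ fun i _ => hcont _ _ hφ (hXi i) (hXc i)) hk,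
    integral_finsetSum _ (fun i _ => hcont _ _ ((hφ.pd_infty i).pd_infty i) hχ hc),
    integral_finsetSum _ (fun i _ => hcont _ _ hφ (hXi i) (hXc i))]
  congr 1
  refine Finset.sum_congr rfl fun i _ => ?_
  exact (integral_mul_pd_pd hχ hc (fun x _ => hφ.contDiffAt) i i).symm

/-! ### The fundamental solution of the elastic operator -/

lemma pd_comm_fun {f : Space3 → ℂ} (hf : ContDiff ℝ ∞ f) (i j : Fin 3) :
    pd i (pd j f) = pd j (pd i f) :=
  funext fun _ => pd_comm hf.contDiffAt i j

lemma ContDiff.differentiableAt_infty {f : Space3 → ℂ} (hf : ContDiff ℝ ∞ f) (x : Space3) :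
    DifferentiableAt ℝ f x :=
  hf.contDiffAt.differentiableAt_infty

namespace ZenerMedium

variable {M : ZenerMedium}

/-- The scalar potential whose Hessian enters `uStar`. -/
def waveDiff (M : ZenerMedium) (ξ x : Space3) : ℂ :=
  sphericalWave M.k₂ ξ x - sphericalWave M.k₁ ξ x

lemma contDiffAt_waveDiff {ξ x : Space3} (hx : x ≠ ξ) : ContDiffAt ℝ ∞ (M.waveDiff ξ) x :=
  (contDiffAt_sphericalWave _ hx).sub (contDiffAt_sphericalWave _ hx)

lemma uStar_eq {ξ x : Space3} (hx : x ≠ ξ) (i j : Fin 3) :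
    M.uStar ξ x i j = 1 / (4 * (Real.pi : ℂ) * (M.mu : ℂ)) *
      (1 / M.k₂ ^ 2 * pd i (pd j (M.waveDiff ξ)) x + sphericalWave M.k₂ ξ x * kron i j) := by
  have h1 : (fun y => 1 / M.k₂ ^ 2 * sphericalWave M.k₂ ξ y - 1 / M.k₂ ^ 2 * sphericalWave M.k₁ ξ y)
      = fun y => 1 / M.k₂ ^ 2 * M.waveDiff ξ y := by
    ext y
    rw [waveDiff]
    ring
  have h2 : pd j (fun y => 1 / M.k₂ ^ 2 * M.waveDiff ξ y) =ᶠ[𝓝 x]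
      fun y => 1 / M.k₂ ^ 2 * pd j (M.waveDiff ξ) y := by
    filter_upwards [isOpen_ne.mem_nhds hx] with y hy
    exact pd_const_mul (contDiffAt_waveDiff hy).differentiableAt_infty _ _
  rw [uStar, h1, (h2.pd_eventuallyEq i).eq_of_nhds,
    pd_const_mul ((contDiffAt_waveDiff hx).pd_infty j).differentiableAt_infty]

lemma contDiffAt_uStar {ξ x : Space3} (hx : x ≠ ξ) (i j : Fin 3) :
    ContDiffAt ℝ ∞ (fun y => M.uStar ξ y i j) x := by
  have h : (fun y => M.uStar ξ y i j) =ᶠ[𝓝 x] fun y => 1 / (4 * (Real.pi : ℂ) * (M.mu : ℂ)) *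
      (1 / M.k₂ ^ 2 * pd i (pd j (M.waveDiff ξ)) y + sphericalWave M.k₂ ξ y * kron i j) := by
    filter_upwards [isOpen_ne.mem_nhds hx] with y hy
    exact uStar_eq hy i j
  refine ContDiffAt.congr_of_eventuallyEq ?_ h
  exact contDiffAt_const.mul ((contDiffAt_const.mul
    (((contDiffAt_waveDiff hx).pd_infty j).pd_infty i)).add
      ((contDiffAt_sphericalWave _ hx).mul contDiffAt_const))

lemma locallyIntegrable_sphericalWave (k : ℂ) (ξ : Space3) :
    LocallyIntegrable (sphericalWave k ξ) := by
  refine locallyIntegrable_of_le_inv_norm (ξ := ξ)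
    (fun x hx => (contDiffAt_sphericalWave k hx).continuousAt.continuousWithinAt) fun R => ?_
  obtain ⟨C, hC⟩ := exists_norm_radial_wave_le k ξ R
  refine ⟨C, fun x hx hxR => ?_⟩
  rw [sphericalWave_eq]
  exact hC x 0 ⟨le_rfl, zero_le_one⟩ hx hxR

lemma locallyIntegrable_pd_pd_waveDiff (ξ : Space3) (i j : Fin 3) :
    LocallyIntegrable (pd i (pd j (M.waveDiff ξ))) := by
  refine locallyIntegrable_of_le_inv_norm (ξ := ξ)
    (fun x hx => (((contDiffAt_waveDiff hx).pd_infty j).pd_infty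
      i).continuousAt.continuousWithinAt) fun R => ?_
  obtain ⟨C, hC⟩ := exists_norm_pd_pd_diffProfile_le M.k₂ M.k₁ ξ i j R
  refine ⟨C, fun x hx hxR => ?_⟩
  have : M.waveDiff ξ = fun y => diffProfile M.k₂ M.k₁ (‖y - ξ‖ ^ 2 + 0) := by
    ext y
    rw [waveDiff, sphericalWave_eq, sphericalWave_eq]
    rfl
  rw [this]
  exact hC x 0 ⟨le_rfl, zero_le_one⟩ hx hxR

lemma uStar_ae_eq (ξ : Space3) (i j : Fin 3) :
    (fun x => M.uStar ξ x i j) =ᵐ[volume] fun x => 1 / (4 * (Real.pi : ℂ) * (M.mu : ℂ)) *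
      (1 / M.k₂ ^ 2 * pd i (pd j (M.waveDiff ξ)) x + sphericalWave M.k₂ ξ x * kron i j) := by
  filter_upwards [ae_ne_point ξ] with x hx using uStar_eq hx i j

lemma locallyIntegrable_uStar (ξ : Space3) (i j : Fin 3) :
    LocallyIntegrable (fun x => M.uStar ξ x i j) := by
  have h : LocallyIntegrable (fun x => 1 / (4 * (Real.pi : ℂ) * (M.mu : ℂ)) *
      (1 / M.k₂ ^ 2 * pd i (pd j (M.waveDiff ξ)) x + sphericalWave M.k₂ ξ x * kron i j)) := by
    have h1 := (locallyIntegrable_pd_pd_waveDiff (M := M) ξ i j).smul (1 / M.k₂ ^ 2)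
    have h2 := (locallyIntegrable_sphericalWave M.k₂ ξ).smul (kron i j)
    have h3 := (h1.add h2).smul (1 / (4 * (Real.pi : ℂ) * (M.mu : ℂ)))
    convert h3 using 1
    ext x
    simp only [Pi.smul_apply, Pi.add_apply, smul_eq_mul]
    ring
  rw [locallyIntegrable_iff] at h ⊢
  exact fun K hK => (h K hK).congr (ae_restrict_of_ae (uStar_ae_eq ξ i j).symm)

lemma L_eq_fun {ψ : Fin 3 → Space3 → ℂ} (hψ : ∀ j, ContDiff ℝ ∞ (ψ j)) (j : Fin 3) :
    M.L ψ j = fun x => (M.lam + M.mu) * (∑ i, pd j (pd i (ψ i)) x) +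
      M.mu * (∑ i, pd i (pd i (ψ j)) x) + M.rho * M.dampedSq * ψ j x :=
  funext fun _ => M.L_eq (fun j => (hψ j).contDiffAt) j

lemma contDiff_L {ψ : Fin 3 → Space3 → ℂ} (hψ : ∀ j, ContDiff ℝ ∞ (ψ j)) (j : Fin 3) :
    ContDiff ℝ ∞ (M.L ψ j) := by
  rw [L_eq_fun hψ]
  exact ((contDiff_const.mul (ContDiff.sum fun i _ => ((hψ i).pd_infty i).pd_infty j)).add
    (contDiff_const.mul (ContDiff.sum fun i _ => ((hψ j).pd_infty i).pd_infty i))).add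
    (contDiff_const.mul (hψ j))

lemma L_eq_zero_of_notMem {ψ : Fin 3 → Space3 → ℂ} (hψ : ∀ j, ContDiff ℝ ∞ (ψ j)) {x : Space3}
    (hx : ∀ j, x ∉ tsupport (ψ j)) (j : Fin 3) : M.L ψ j x = 0 := by
  have h2 : ∀ a b j, pd a (pd b (ψ j)) x = 0 := fun a b j => image_eq_zero_of_notMem_tsupport fun h =>
      hx j (tsupport_pd_subset _ _ (tsupport_pd_subset _ _ h))
  rw [L_eq_fun hψ]
  simp [h2, image_eq_zero_of_notMem_tsupport (hx _)]

lemma hasCompactSupport_L {ψ : Fin 3 → Space3 → ℂ} (hψ : ∀ j, ContDiff ℝ ∞ (ψ j))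
    (hc : ∀ j, HasCompactSupport (ψ j)) (j : Fin 3) : HasCompactSupport (M.L ψ j) := by
  refine HasCompactSupport.intro (isCompact_iUnion hc) fun x hx => ?_
  exact L_eq_zero_of_notMem hψ (fun j hj => hx (Set.mem_iUnion.2 ⟨j, hj⟩)) j

/-- Under the divergence the two second-order terms of L merge: div Lψ = ((λ+2μ)Δ + ρω̃²) div ψ. The
remaining ∂_m comes from the Hessian in u*. -/
lemma sum_pd_pd_L {ψ : Fin 3 → Space3 → ℂ} (hψ : ∀ j, ContDiff ℝ ∞ (ψ j)) (m : Fin 3)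
    (x : Space3) :
    ∑ j, pd j (pd m (M.L ψ j)) x =
      (M.lam + 2 * M.mu) * (∑ i, pd i (pd i (pd m fun y => ∑ j, pd j (ψ j) y)) x) +
        M.rho * M.dampedSq * pd m (fun y => ∑ j, pd j (ψ j) y) x := by
  have c1 : ∀ a j, ContDiff ℝ ∞ (pd a (ψ j)) := fun a j => (hψ j).pd_infty a
  have c2 : ∀ a b j, ContDiff ℝ ∞ (pd a (pd b (ψ j))) := fun a b j => (c1 b j).pd_infty a
  have c3 : ∀ a b c j, ContDiff ℝ ∞ (pd a (pd b (pd c (ψ j)))) := fun a b c j =>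
    (c2 b c j).pd_infty a
  have hD : ∀ a, (pd a fun y => ∑ j, pd j (ψ j) y) = fun y => ∑ j, pd a (pd j (ψ j)) y :=
    fun a => funext fun y => pd_sum _ (fun j _ => (c1 j j).differentiableAt_infty y) a
  have hD2 : ∀ a b, (pd a fun y => ∑ j, pd b (pd j (ψ j)) y) =
      fun y => ∑ j, pd a (pd b (pd j (ψ j))) y :=
    fun a b => funext fun y => pd_sum _ (fun j _ => (c2 b j j).differentiableAt_infty y) a
  have hD3 : ∀ a b c, (pd a fun y => ∑ j, pd b (pd c (pd j (ψ j))) y) =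
      fun y => ∑ j, pd a (pd b (pd c (pd j (ψ j)))) y :=
    fun a b c => funext fun y => pd_sum _ (fun j _ => (c3 b c j j).differentiableAt_infty y) a
  have hL : ∀ j, pd j (pd m (M.L ψ j)) x =
      (M.lam + M.mu) * (∑ i, pd j (pd m (pd j (pd i (ψ i)))) x) +
      M.mu * (∑ i, pd j (pd m (pd i (pd i (ψ j)))) x) + M.rho * M.dampedSq * pd j (pd m (ψ j)) x := by
    intro j
    have h1 : pd m (M.L ψ j) = fun x => (M.lam + M.mu) * (∑ i, pd m (pd j (pd i (ψ i))) x) +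
        M.mu * (∑ i, pd m (pd i (pd i (ψ j))) x) + M.rho * M.dampedSq * pd m (ψ j) x := by
      ext y
      rw [L_eq_fun hψ, pd_add, pd_add, pd_const_mul, pd_const_mul, pd_const_mul, pd_sum, pd_sum]
      all_goals first
        | (intro i _; exact ContDiff.differentiableAt_infty (c2 _ _ _) _)
        | (refine ContDiff.differentiableAt_infty ?_ _)
      · exact hψ j
      · exact ContDiff.sum fun i _ => c2 _ _ _
      · exact ContDiff.sum fun i _ => c2 _ _ _
      · exact contDiff_const.mul (ContDiff.sum fun i _ => c2 _ _ _)
      · exact contDiff_const.mul (ContDiff.sum fun i _ => c2 _ _ _)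
      · exact (contDiff_const.mul (ContDiff.sum fun i _ => c2 _ _ _)).add
          (contDiff_const.mul (ContDiff.sum fun i _ => c2 _ _ _))
      · exact contDiff_const.mul (hψ j)
    rw [h1, pd_add, pd_add, pd_const_mul, pd_const_mul, pd_const_mul, pd_sum, pd_sum]
    all_goals first
      | (intro i _; exact ContDiff.differentiableAt_infty (c3 _ _ _ _) _)
      | (refine ContDiff.differentiableAt_infty ?_ _)
    · exact c1 _ _
    · exact ContDiff.sum fun i _ => c3 _ _ _ _
    · exact ContDiff.sum fun i _ => c3 _ _ _ _
    · exact contDiff_const.mul (ContDiff.sum fun i _ => c3 _ _ _ _)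
    · exact contDiff_const.mul (ContDiff.sum fun i _ => c3 _ _ _ _)
    · exact (contDiff_const.mul (ContDiff.sum fun i _ => c3 _ _ _ _)).add
        (contDiff_const.mul (ContDiff.sum fun i _ => c3 _ _ _ _))
    · exact contDiff_const.mul (c1 _ _)
  simp_rw [hL, hD, hD2, hD3]
  have p1 : ∀ i j, pd j (pd m (pd j (pd i (ψ i)))) = pd j (pd j (pd m (pd i (ψ i)))) := fun i j => by
    rw [pd_comm_fun (c1 i i) m j]
  have p2 : ∀ i j, pd j (pd m (pd i (pd i (ψ j)))) = pd i (pd i (pd m (pd j (ψ j)))) := fun i j => by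
    rw [pd_comm_fun (c1 i j) m i, pd_comm_fun (c2 m i j) j i, pd_comm_fun (hψ j) m i,
      pd_comm_fun (c1 m j) j i, pd_comm_fun (hψ j) j m]
  have p3 : ∀ j, pd j (pd m (ψ j)) = pd m (pd j (ψ j)) := fun j => pd_comm_fun (hψ j) j m
  simp_rw [p1, p2, p3]
  simp only [Fin.sum_univ_three]
  ring

/-- The Hessian is moved onto Lψ. With E = ∂_m div ψ, the Helmholtz equation replaces ∫φΔE by
-4πE(ξ) - k²∫φE; the point values cancel in φ₂ - φ₁, and the φ₁ integral disappears because
(λ+2μ)k₁² = ρω̃². After division by k₂² the φ₂ integral contributes -(λ+μ)∫φ₂E, which the δ_ij part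
of u* cancels, leaving -4πμψ_m(ξ). -/
lemma IsRegular.solvesPointForce_uStar (h : M.IsRegular) (ξ : Space3) :
    M.SolvesPointForce Set.univ ξ (M.uStar ξ) := by
  refine ⟨fun j m => (locallyIntegrable_uStar ξ j m).locallyIntegrableOn _, fun ψ hψ m => ?_⟩
  have hs : ∀ j, ContDiff ℝ ∞ (ψ j) := fun j => (hψ j).1
  have hc : ∀ j, HasCompactSupport (ψ j) := fun j => (hψ j).2.1
  have hT := fun j => contDiff_L (M := M) hs j
  have hTc := fun j => hasCompactSupport_L (M := M) hs hc j
  set c₀ : ℂ := 1 / (4 * (Real.pi : ℂ) * (M.mu : ℂ)) with hc₀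
  have hk2 : M.k₂ ^ 2 ≠ 0 := by simpa using h.decay₂.ne_zero
  have hμ : (M.mu : ℂ) ≠ 0 := by exact_mod_cast h.mu_pos.ne'
  have hπ : (Real.pi : ℂ) ≠ 0 := by exact_mod_cast Real.pi_ne_zero
  set E : Space3 → ℂ := pd m fun y => ∑ j, pd j (ψ j) y with hE
  have hDs : ContDiff ℝ ∞ (fun y => ∑ j, pd j (ψ j) y) :=
    ContDiff.sum fun j _ => (hs j).pd_infty j
  have hDc : HasCompactSupport (fun y => ∑ j, pd j (ψ j) y) := by
    refine HasCompactSupport.intro (isCompact_iUnion hc) fun x hx => ?_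
    refine Finset.sum_eq_zero fun j _ => image_eq_zero_of_notMem_tsupport fun hj => hx ?_
    exact Set.mem_iUnion.2 ⟨j, tsupport_pd_subset _ _ hj⟩
  have hEs : ContDiff ℝ ∞ E := hDs.pd_infty m
  have hEc : HasCompactSupport E := hDc.pd m
  have hφ := fun k => locallyIntegrable_sphericalWave k ξ
  have hW : LocallyIntegrable (M.waveDiff ξ) := (hφ M.k₂).sub (hφ M.k₁)
  have e1 : (∫ x, ∑ j, M.uStar ξ x j m * M.L ψ j x) =
      ∫ x, c₀ * (1 / M.k₂ ^ 2 * (∑ j, pd j (pd m (M.waveDiff ξ)) x * M.L ψ j x) +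
        sphericalWave M.k₂ ξ x * M.L ψ m x) := by
    refine integral_congr_ae ?_
    filter_upwards [ae_ne_point ξ] with x hx
    simp_rw [uStar_eq hx]
    fin_cases m <;> simp [Fin.sum_univ_three, kron] <;> ring
  have i1 : ∀ j, Integrable (fun x => pd j (pd m (M.waveDiff ξ)) x * M.L ψ j x) := fun j =>
    (locallyIntegrable_pd_pd_waveDiff ξ j m).integrable_mul_test (hT j).continuous (hTc j)
  have i2 : ∀ k m, Integrable (fun x => sphericalWave k ξ x * M.L ψ m x) := fun k m =>
    (hφ k).integrable_mul_test (hT m).continuous (hTc m)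
  rw [e1, integral_const_mul, integral_add ((integrable_finsetSum _ fun j _ => i1 j).const_mul _)
    (i2 _ _), integral_const_mul, integral_finsetSum _ fun j _ => i1 j]
  have e2 : ∀ j, ∫ x, pd j (pd m (M.waveDiff ξ)) x * M.L ψ j x =
      ∫ x, M.waveDiff ξ x * pd j (pd m (M.L ψ j)) x := fun j =>
    integral_pd_pd_diff M.k₂ M.k₁ ξ (hT j) (hTc j) j m
  have i3 : ∀ j, Integrable (fun x => M.waveDiff ξ x * pd j (pd m (M.L ψ j)) x) := fun j =>
    hW.integrable_mul_test (((hT j).pd_infty m).pd_infty j).continuous (((hTc j).pd m).pd j)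
  simp_rw [e2]
  rw [← integral_finsetSum _ fun j _ => i3 j]
  set ΔE : Space3 → ℂ := fun x => ∑ i, pd i (pd i E) x with hΔE
  have hΔs : ContDiff ℝ ∞ ΔE := ContDiff.sum fun i _ => (hEs.pd_infty i).pd_infty i
  have hΔc : HasCompactSupport ΔE := by
    refine HasCompactSupport.intro hEc fun x hx => ?_
    refine Finset.sum_eq_zero fun j _ => image_eq_zero_of_notMem_tsupport fun hj => hx ?_
    exact tsupport_pd_subset _ _ (tsupport_pd_subset _ _ hj)
  have iE : ∀ k, Integrable (fun x => sphericalWave k ξ x * E x) := fun k =>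
    (hφ k).integrable_mul_test hEs.continuous hEc
  have iΔ : ∀ k, Integrable (fun x => sphericalWave k ξ x * ΔE x) := fun k =>
    (hφ k).integrable_mul_test hΔs.continuous hΔc
  have hHelm : ∀ k, (∫ x, sphericalWave k ξ x * ΔE x) =
      -(4 * Real.pi) * E ξ - k ^ 2 * ∫ x, sphericalWave k ξ x * E x := by
    intro k
    have := integral_sphericalWave_helmholtz k ξ hEs hEc
    rw [← this, ← integral_const_mul, ← integral_sub]
    · refine integral_congr_ae (ae_of_all _ fun x => ?_)
      simp only [hΔE]
      ring
    · refine ((iΔ k).add ((iE k).const_mul (k ^ 2))).congr (ae_of_all _ fun x => ?_)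
      simp only [hΔE, Pi.add_apply]
      ring
    · exact (iE k).const_mul _
  have e3 : (∫ x, ∑ j, M.waveDiff ξ x * pd j (pd m (M.L ψ j)) x) =
      (M.lam + 2 * M.mu) * ((∫ x, sphericalWave M.k₂ ξ x * ΔE x) -
        ∫ x, sphericalWave M.k₁ ξ x * ΔE x) +
      M.rho * M.dampedSq * ((∫ x, sphericalWave M.k₂ ξ x * E x) -
        ∫ x, sphericalWave M.k₁ ξ x * E x) := by
    have jΔ : Integrable (fun x => sphericalWave M.k₂ ξ x * ΔE x - sphericalWave M.k₁ ξ x * ΔE x) :=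
      (iΔ _).sub (iΔ _)
    have jE : Integrable (fun x => sphericalWave M.k₂ ξ x * E x - sphericalWave M.k₁ ξ x * E x) :=
      (iE _).sub (iE _)
    rw [← integral_sub (iΔ _) (iΔ _), ← integral_sub (iE _) (iE _), ← integral_const_mul,
      ← integral_const_mul, ← integral_add (Integrable.const_mul jΔ _) (Integrable.const_mul jE _)]
    refine integral_congr_ae (ae_of_all _ fun x => ?_)
    simp only
    rw [← Finset.mul_sum, sum_pd_pd_L hs, waveDiff]
    ring
  have e4 : (∫ x, sphericalWave M.k₂ ξ x * M.L ψ m x) =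
      (M.lam + M.mu) * (∫ x, sphericalWave M.k₂ ξ x * E x) - M.mu * (4 * Real.pi) * ψ m ξ := by
    have hH := integral_sphericalWave_helmholtz M.k₂ ξ (hs m) (hc m)
    have iH : Integrable (fun x => sphericalWave M.k₂ ξ x *
        ((∑ i, pd i (pd i (ψ m)) x) + M.k₂ ^ 2 * ψ m x)) := by
      refine (hφ _).integrable_mul_test ?_ ?_
      · exact ((ContDiff.sum fun i _ => ((hs m).pd_infty i).pd_infty i).add
          (contDiff_const.mul (hs m))).continuous
      · refine HasCompactSupport.intro (hc m) fun x hx => ?_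
        have h1 : ∀ i, pd i (pd i (ψ m)) x = 0 := fun i => image_eq_zero_of_notMem_tsupport fun h =>
          hx (tsupport_pd_subset _ _ (tsupport_pd_subset _ _ h))
        simp [h1, image_eq_zero_of_notMem_tsupport hx]
    have : M.mu * (4 * Real.pi) * ψ m ξ = -(M.mu * (-(4 * Real.pi) * ψ m ξ)) := by ring
    rw [this, ← hH, sub_neg_eq_add, ← integral_const_mul, ← integral_const_mul,
      ← integral_add ((iE _).const_mul _) (iH.const_mul _)]
    refine integral_congr_ae (ae_of_all _ fun x => ?_)
    simp only
    have hEx : E x = ∑ i, pd m (pd i (ψ i)) x :=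
      pd_sum _ (fun j _ => ((hs j).pd_infty j).differentiableAt_infty x) m
    rw [L_eq_fun hs, hEx, ← h.mu_mul]
    ring
  rw [e3, e4, hHelm, hHelm, hc₀, ← h.lam_mul]
  have hrel := h.mu_mul.trans h.lam_mul.symm
  set I₂ := ∫ x, sphericalWave M.k₂ ξ x * E x
  have hk2' : M.k₂ ≠ 0 := fun h0 => hk2 (by simp [h0])
  field_simp
  linear_combination (-(1 : ℂ)) * I₂ * hrel
end ZenerMedium

/-! ### Symbols on the Fourier plane -/

/-- `f` is differentiable at the points of `S`, and `f` and its derivative are bounded there by a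
polynomial times `e^{-h|η|}`. -/
def SymbolOn (S : Set Plane2) (h : ℝ) (f : Plane2 → ℂ) : Prop :=
  ∃ (C : ℝ) (n : ℕ), 0 ≤ C ∧ ∀ η ∈ S, DifferentiableAt ℝ f η ∧
    ‖f η‖ ≤ C * ((1 + ‖η‖) ^ n * Real.exp (-(h * ‖η‖))) ∧
    ‖fderiv ℝ f η‖ ≤ C * ((1 + ‖η‖) ^ n * Real.exp (-(h * ‖η‖)))

namespace SymbolOn

variable {S : Set Plane2} {h h' : ℝ} {f g : Plane2 → ℂ}

lemma differentiableAt (hf : SymbolOn S h f) {η : Plane2} (hη : η ∈ S) : DifferentiableAt ℝ f η := by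
  obtain ⟨C, n, -, hb⟩ := hf
  exact (hb η hη).1

lemma add (hf : SymbolOn S h f) (hg : SymbolOn S h g) : SymbolOn S h (fun η => f η + g η) := by
  obtain ⟨C, n, hC, hf⟩ := hf
  obtain ⟨D, m, hD, hg⟩ := hg
  refine ⟨C + D, n + m, add_nonneg hC hD, fun η hη => ?_⟩
  obtain ⟨f1, f2, f3⟩ := hf η hη
  obtain ⟨g1, g2, g3⟩ := hg η hη
  have h1 : (1 : ℝ) ≤ 1 + ‖η‖ := by linarith [norm_nonneg η]
  have hn : (1 + ‖η‖) ^ n ≤ (1 + ‖η‖) ^ (n + m) := pow_le_pow_right₀ h1 (by lia)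
  have hm : (1 + ‖η‖) ^ m ≤ (1 + ‖η‖) ^ (n + m) := pow_le_pow_right₀ h1 (by lia)
  have key : ∀ a b : ℝ, a ≤ C * ((1 + ‖η‖) ^ n * Real.exp (-(h * ‖η‖))) →
      b ≤ D * ((1 + ‖η‖) ^ m * Real.exp (-(h * ‖η‖))) →
      a + b ≤ (C + D) * ((1 + ‖η‖) ^ (n + m) * Real.exp (-(h * ‖η‖))) := by
    intro a b ha hb
    rw [add_mul]
    refine add_le_add (ha.trans ?_) (hb.trans ?_) <;> gcongr
  refine ⟨f1.add g1, (norm_add_le _ _).trans (key _ _ f2 g2), ?_⟩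
  rw [fderiv_fun_add f1 g1]
  exact (norm_add_le _ _).trans (key _ _ f3 g3)

lemma mul (hf : SymbolOn S h f) (hg : SymbolOn S h' g) :
    SymbolOn S (h + h') (fun η => f η * g η) := by
  obtain ⟨C, n, hC, hf⟩ := hf
  obtain ⟨D, m, hD, hg⟩ := hg
  refine ⟨2 * (C * D), n + m, by positivity, fun η hη => ?_⟩
  obtain ⟨f1, f2, f3⟩ := hf η hη
  obtain ⟨g1, g2, g3⟩ := hg η hη
  have e : (C * ((1 + ‖η‖) ^ n * Real.exp (-(h * ‖η‖)))) *
      (D * ((1 + ‖η‖) ^ m * Real.exp (-(h' * ‖η‖)))) =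
      C * D * ((1 + ‖η‖) ^ (n + m) * Real.exp (-((h + h') * ‖η‖))) := by
    rw [show -((h + h') * ‖η‖) = -(h * ‖η‖) + -(h' * ‖η‖) by ring, Real.exp_add, pow_add]
    ring
  have e' : 2 * (C * D) * ((1 + ‖η‖) ^ (n + m) * Real.exp (-((h + h') * ‖η‖))) =
      C * D * ((1 + ‖η‖) ^ (n + m) * Real.exp (-((h + h') * ‖η‖))) +
      C * D * ((1 + ‖η‖) ^ (n + m) * Real.exp (-((h + h') * ‖η‖))) := by ring
  have hnn : 0 ≤ C * D * ((1 + ‖η‖) ^ (n + m) * Real.exp (-((h + h') * ‖η‖))) := by positivity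
  refine ⟨f1.mul g1, ?_, ?_⟩
  · rw [norm_mul, e']
    refine (mul_le_mul f2 g2 (norm_nonneg _) (by positivity)).trans ?_
    rw [e]
    linarith
  · rw [fderiv_fun_mul f1 g1, e']
    refine (norm_add_le _ _).trans (add_le_add ?_ ?_)
    · rw [norm_smul, ← e]
      exact mul_le_mul f2 g3 (norm_nonneg _) (by positivity)
    · rw [norm_smul, ← e, mul_comm]
      exact mul_le_mul f3 g2 (norm_nonneg _) (by positivity)

lemma mul_left (hf : SymbolOn S 0 f) (hg : SymbolOn S h g) : SymbolOn S h (fun η => f η * g η) := by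
  simpa using hf.mul hg

lemma const (S : Set Plane2) (c : ℂ) : SymbolOn S 0 (fun _ => c) := by
  refine ⟨‖c‖, 0, norm_nonneg _, fun η _ => ⟨differentiableAt_const _, ?_, ?_⟩⟩ <;> simp

lemma const_mul (hf : SymbolOn S h f) (c : ℂ) : SymbolOn S h (fun η => c * f η) :=
  (const S c).mul_left hf

lemma neg (hf : SymbolOn S h f) : SymbolOn S h (fun η => -f η) := by
  simpa using hf.const_mul (-1)

lemma sub (hf : SymbolOn S h f) (hg : SymbolOn S h g) : SymbolOn S h (fun η => f η - g η) := by
  simpa [sub_eq_add_neg] using hf.add hg.neg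

lemma sum {ι : Type*} (s : Finset ι) {f : ι → Plane2 → ℂ} (hf : ∀ i ∈ s, SymbolOn S h (f i)) :
    SymbolOn S h (fun η => ∑ i ∈ s, f i η) := by
  classical
  induction s using Finset.induction_on with
  | empty =>
    refine ⟨0, 0, le_rfl, fun η _ => ?_⟩
    simp
  | insert a s ha ih =>
    simp only [Finset.sum_insert ha]
    exact (hf a (by simp)).add (ih fun i hi => hf i (by simp [hi]))

lemma coord (S : Set Plane2) (i : Fin 2) : SymbolOn S 0 (fun η => ((η i : ℝ) : ℂ)) := by
  have hd : ∀ η : Plane2, HasFDerivAt (fun η : Plane2 => ((η i : ℝ) : ℂ))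
      (Complex.ofRealCLM.comp (EuclideanSpace.proj i : Plane2 →L[ℝ] ℝ)) η := fun η =>
    (Complex.ofRealCLM.comp (EuclideanSpace.proj i : Plane2 →L[ℝ] ℝ)).hasFDerivAt
  refine ⟨1, 1, zero_le_one, fun η _ => ⟨(hd η).differentiableAt, ?_, ?_⟩⟩
  · have := PiLp.norm_apply_le η i
    rw [Complex.norm_real]
    simp only [pow_one, zero_mul, neg_zero, Real.exp_zero, mul_one, one_mul]
    linarith
  · rw [(hd η).fderiv]
    refine (ContinuousLinearMap.opNorm_le_bound _ zero_le_one fun v => ?_).trans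
      (by simp)
    simpa using PiLp.norm_apply_le v i

lemma inv (hf : SymbolOn S 0 f) {δ : ℝ} (hδ : 0 < δ) (hlow : ∀ η ∈ S, δ ≤ ‖f η‖) :
    SymbolOn S 0 (fun η => (f η)⁻¹) := by
  obtain ⟨C, n, hC, hf⟩ := hf
  refine ⟨δ⁻¹ + C * δ⁻¹ ^ 2, n, by positivity, fun η hη => ?_⟩
  obtain ⟨f1, f2, f3⟩ := hf η hη
  have h0 : f η ≠ 0 := norm_pos_iff.1 (hδ.trans_le (hlow η hη))
  have h1 : (1 : ℝ) ≤ (1 + ‖η‖) ^ n := one_le_pow₀ (by linarith [norm_nonneg η])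
  have hi : ‖(f η)⁻¹‖ ≤ δ⁻¹ := by
    rw [norm_inv]
    exact inv_anti₀ hδ (hlow η hη)
  simp only [zero_mul, neg_zero, Real.exp_zero, mul_one] at f2 f3 ⊢
  have hd : HasFDerivAt (fun η => (f η)⁻¹) (-((f η)⁻¹ ^ 2) • fderiv ℝ f η) η := by
    have := (hasDerivAt_inv h0).hasFDerivAt.restrictScalars ℝ |>.comp η f1.hasFDerivAt
    refine this.congr_fderiv ?_
    ext v
    simp
    ring
  refine ⟨hd.differentiableAt, ?_, ?_⟩
  · have : 0 ≤ C * δ⁻¹ ^ 2 * (1 + ‖η‖) ^ n := by positivity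
    have : δ⁻¹ ≤ δ⁻¹ * (1 + ‖η‖) ^ n := le_mul_of_one_le_right (by positivity) h1
    linarith
  · rw [hd.fderiv, norm_smul, norm_neg, norm_pow]
    have : 0 ≤ δ⁻¹ * (1 + ‖η‖) ^ n := by positivity
    have : ‖(f η)⁻¹‖ ^ 2 * ‖fderiv ℝ f η‖ ≤ δ⁻¹ ^ 2 * (C * (1 + ‖η‖) ^ n) := by gcongr
    linarith

lemma congr (hf : SymbolOn S h f) (hfg : ∀ η, f η = g η) : SymbolOn S h g := by
  rwa [show g = f from funext fun η => (hfg η).symm]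

end SymbolOn

/-! ### Vertical exponents away from their branch points -/

/-- The set `S` keeps a positive distance from the branch points of `decayExp s`. -/
def AvoidsBranch (s : ℂ) (S : Set Plane2) : Prop :=
  ∃ δ > 0, ∀ η ∈ S, ((‖η‖ ^ 2 : ℝ) : ℂ) + s ∈ Complex.slitPlane ∧ δ ≤ ‖((‖η‖ ^ 2 : ℝ) : ℂ) + s‖

namespace AvoidsBranch

variable {s : ℂ} {S : Set Plane2}

lemma exists_le_norm (hS : AvoidsBranch s S) : ∃ δ > 0, ∀ η ∈ S, δ ≤ ‖decayExp s η‖ := by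
  obtain ⟨δ, hδ, hb⟩ := hS
  refine ⟨√δ, Real.sqrt_pos.2 hδ, fun η hη => ?_⟩
  rw [norm_decayExp]
  exact Real.sqrt_le_sqrt (hb η hη).2

lemma ne_zero (hS : AvoidsBranch s S) {η : Plane2} (hη : η ∈ S) : decayExp s η ≠ 0 := by
  obtain ⟨δ, hδ, hb⟩ := hS.exists_le_norm
  exact norm_pos_iff.1 (hδ.trans_le (hb η hη))

lemma hasFDerivAt (hS : AvoidsBranch s S) {η : Plane2} (hη : η ∈ S) :
    HasFDerivAt (decayExp s)
      ((decayExp s η)⁻¹ • Complex.ofRealCLM.comp (innerSL ℝ η)) η := by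
  have h0 := hS.ne_zero hη
  obtain ⟨δ, hδ, hb⟩ := hS
  have h1 : HasFDerivAt (fun η : Plane2 => ((‖η‖ ^ 2 : ℝ) : ℂ) + s)
      (Complex.ofRealCLM.comp (2 • (innerSL ℝ η))) η := by
    have h2 : HasFDerivAt (fun η : Plane2 => ‖η‖ ^ 2) (2 • (innerSL ℝ η)) η := by
      simpa using (hasFDerivAt_id η).norm_sq
    exact (Complex.ofRealCLM.hasFDerivAt.comp η h2).add_const s
  have h3 := ((Complex.hasDerivAt_sqrt_inv (hb η hη).1).hasFDerivAt.restrictScalars ℝ).comp η h1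
  refine h3.congr_fderiv ?_
  ext v
  simp only [ContinuousLinearMap.comp_apply, smul_apply,
    ContinuousLinearMap.coe_restrictScalars', Complex.ofRealCLM_apply]
  rw [← decayExp]
  simp
  field_simp

lemma norm_fderiv_le (hS : AvoidsBranch s S) : ∃ C, 0 ≤ C ∧ ∀ η ∈ S,
    ‖fderiv ℝ (decayExp s) η‖ ≤ C * ‖η‖ := by
  obtain ⟨δ, hδ, hb⟩ := hS.exists_le_norm
  refine ⟨δ⁻¹, by positivity, fun η hη => ?_⟩
  rw [(hS.hasFDerivAt hη).fderiv, norm_smul, norm_inv]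
  gcongr
  · exact hb η hη
  · refine ContinuousLinearMap.opNorm_le_bound _ (norm_nonneg _) fun v => ?_
    simpa using abs_real_inner_le_norm η v

lemma symbolOn_decayExp (hS : AvoidsBranch s S) : SymbolOn S 0 (decayExp s) := by
  obtain ⟨C, hC, hb⟩ := hS.norm_fderiv_le
  refine ⟨1 + √‖s‖ + C, 1, by positivity, fun η hη =>
    ⟨(hS.hasFDerivAt hη).differentiableAt, ?_, ?_⟩⟩
  · have := norm_decayExp_le s η
    simp only [pow_one, zero_mul, neg_zero, Real.exp_zero, mul_one]
    nlinarith [norm_nonneg η, Real.sqrt_nonneg ‖s‖]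
  · have := hb η hη
    simp only [pow_one, zero_mul, neg_zero, Real.exp_zero, mul_one]
    nlinarith [norm_nonneg η, Real.sqrt_nonneg ‖s‖]

lemma symbolOn_inv_decayExp (hS : AvoidsBranch s S) : SymbolOn S 0 (fun η => (decayExp s η)⁻¹) := by
  obtain ⟨δ, hδ, hb⟩ := hS.exists_le_norm
  exact hS.symbolOn_decayExp.inv hδ hb

lemma symbolOn_exp (hS : AvoidsBranch s S) {z : ℝ} (hz : z ≤ 0) :
    SymbolOn S (-z) (fun η => Complex.exp (decayExp s η * z)) := by
  obtain ⟨C, hC, hb⟩ := hS.norm_fderiv_le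
  have hexp : ∀ η, ‖Complex.exp (decayExp s η * z)‖ ≤
      Real.exp (√‖s‖ * -z) * Real.exp (-(-z * ‖η‖)) := by
    intro η
    have := norm_exp_neg_decayExp_le s η (neg_nonneg.2 hz)
    simpa using this
  refine ⟨Real.exp (√‖s‖ * -z) * (1 + |z| * C), 1, by positivity, fun η hη => ?_⟩
  have hd : HasFDerivAt (fun η => Complex.exp (decayExp s η * z))
      (Complex.exp (decayExp s η * z) • ((z : ℂ) • fderiv ℝ (decayExp s) η)) η :=
    ((hS.hasFDerivAt hη).differentiableAt.hasFDerivAt.mul_const (z : ℂ)).cexp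
  have h1 := hexp η
  have h2 := hb η hη
  have hz' : ‖(z : ℂ)‖ = |z| := by simp
  set E := Real.exp (√‖s‖ * -z)
  set F := Real.exp (-(-z * ‖η‖))
  have hE : 0 < E := Real.exp_pos _
  have hF : 0 < F := Real.exp_pos _
  have hn := norm_nonneg η
  refine ⟨hd.differentiableAt, h1.trans ?_, ?_⟩
  · rw [pow_one]
    have : E * (1 + |z| * C) * ((1 + ‖η‖) * F) - E * F =
      E * F * (‖η‖ + |z| * C * (1 + ‖η‖)) := by ring
    have : 0 ≤ E * F * (‖η‖ + |z| * C * (1 + ‖η‖)) := by positivity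
    linarith
  · rw [hd.fderiv, norm_smul, norm_smul, hz', pow_one]
    calc _ ≤ E * F * (|z| * (C * ‖η‖)) := by gcongr
      _ ≤ _ := by
        have : E * (1 + |z| * C) * ((1 + ‖η‖) * F) - E * F * (|z| * (C * ‖η‖)) =
          E * F * (1 + ‖η‖ + |z| * C) := by ring
        have : 0 ≤ E * F * (1 + ‖η‖ + |z| * C) := by positivity
        linarith

end AvoidsBranch

/-! ### The Rayleigh function -/

/-- The Rayleigh function `4|η|²β₁β₂ - (|η|² + β₂²)²`. -/
def rayleigh (s₁ s₂ : ℂ) (η : Plane2) : ℂ :=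
  4 * ((‖η‖ ^ 2 : ℝ) : ℂ) * decayExp s₁ η * decayExp s₂ η -
    (((‖η‖ ^ 2 : ℝ) : ℂ) + decayExp s₂ η ^ 2) ^ 2

lemma symbolOn_norm_sq (S : Set Plane2) : SymbolOn S 0 (fun η => ((‖η‖ ^ 2 : ℝ) : ℂ)) := by
  refine (((SymbolOn.coord S 0).mul_left (SymbolOn.coord S 0)).add
    ((SymbolOn.coord S 1).mul_left (SymbolOn.coord S 1))).congr fun η => ?_
  rw [ZenerMedium.norm_sq_plane]
  push_cast
  ring

lemma symbolOn_rayleigh {s₁ s₂ : ℂ} {S : Set Plane2} (h₁ : AvoidsBranch s₁ S)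
    (h₂ : AvoidsBranch s₂ S) : SymbolOn S 0 (rayleigh s₁ s₂) := by
  have n := symbolOn_norm_sq S
  have b1 := h₁.symbolOn_decayExp
  have b2 := h₂.symbolOn_decayExp
  have q := n.add (b2.mul_left b2)
  refine (((((n.const_mul 4).mul_left b1).mul_left b2)).sub (q.mul_left q)).congr fun η => ?_
  rw [rayleigh]
  ring

/-- Multiplication by the conjugate expression leaves only β₁² and β₂², hence a polynomial in |η|².
The terms 16|η|⁸ cancel, and the next coefficient is 16(s₁ - s₂). -/
lemma rayleigh_mul_conj (s₁ s₂ : ℂ) (η : Plane2) :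
    rayleigh s₁ s₂ η * (4 * ((‖η‖ ^ 2 : ℝ) : ℂ) * decayExp s₁ η * decayExp s₂ η +
      (((‖η‖ ^ 2 : ℝ) : ℂ) + decayExp s₂ η ^ 2) ^ 2) =
    16 * (s₁ - s₂) * ((‖η‖ ^ 2 : ℝ) : ℂ) ^ 3 +
      ((16 * s₁ * s₂ - 24 * s₂ ^ 2) * ((‖η‖ ^ 2 : ℝ) : ℂ) ^ 2 -
        8 * s₂ ^ 3 * ((‖η‖ ^ 2 : ℝ) : ℂ) - s₂ ^ 4) := by
  have h1 := decayExp_sq s₁ η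
  have h2 := decayExp_sq s₂ η
  have e : rayleigh s₁ s₂ η * (4 * ((‖η‖ ^ 2 : ℝ) : ℂ) * decayExp s₁ η * decayExp s₂ η +
      (((‖η‖ ^ 2 : ℝ) : ℂ) + decayExp s₂ η ^ 2) ^ 2) =
      16 * ((‖η‖ ^ 2 : ℝ) : ℂ) ^ 2 * decayExp s₁ η ^ 2 * decayExp s₂ η ^ 2 -
        (((‖η‖ ^ 2 : ℝ) : ℂ) + decayExp s₂ η ^ 2) ^ 4 := by
    rw [rayleigh]
    ring
  rw [e, h1, h2]
  ring

/-- The rationalised product grows like |η|⁶, the conjugate factor is at most D|η|⁴, and so the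
Rayleigh function grows at least like |η|². -/
lemma exists_one_le_norm_rayleigh {s₁ s₂ : ℂ} (h : s₁ ≠ s₂) :
    ∃ R₀ : ℝ, 0 < R₀ ∧ ∀ η : Plane2, R₀ < ‖η‖ → 1 ≤ ‖rayleigh s₁ s₂ η‖ := by
  have hd : 0 < ‖s₁ - s₂‖ := norm_pos_iff.2 (sub_ne_zero.2 h)
  set c := ‖16 * s₁ * s₂ - 24 * s₂ ^ 2‖ + ‖8 * s₂ ^ 3‖ + ‖s₂ ^ 4‖ with hc
  set D := 4 * (1 + √‖s₁‖) * (1 + √‖s₂‖) + (1 + (1 + √‖s₂‖) ^ 2) ^ 2 with hD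
  have hD0 : 0 < D := by positivity
  have hc0 : 0 ≤ c := by positivity
  -- Beyond this radius 16‖s₁ - s₂‖r² ≥ c + D, where c collects the lower-order coefficients and D
  -- bounds the conjugate factor.
  refine ⟨1 + (c + D) / (16 * ‖s₁ - s₂‖), by positivity, fun η hη => ?_⟩
  set r := ‖η‖ with hr
  have hr1 : 1 ≤ r := by
    have : 0 ≤ (c + D) / (16 * ‖s₁ - s₂‖) := by positivity
    linarith
  have hr2 : c + D ≤ 16 * ‖s₁ - s₂‖ * r ^ 2 := by
    have h1 : (c + D) / (16 * ‖s₁ - s₂‖) ≤ r := by linarith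
    rw [div_le_iff₀ (by positivity)] at h1
    have : r ≤ r ^ 2 := by nlinarith
    nlinarith
  have hX : ‖((r ^ 2 : ℝ) : ℂ)‖ = r ^ 2 := by
    rw [Complex.norm_real, Real.norm_of_nonneg (by positivity)]
  have hβ : ∀ s : ℂ, ‖decayExp s η‖ ≤ (1 + √‖s‖) * r := by
    intro s
    have := norm_decayExp_le s η
    nlinarith [Real.sqrt_nonneg ‖s‖]
  have hup : ‖4 * ((r ^ 2 : ℝ) : ℂ) * decayExp s₁ η * decayExp s₂ η +
      (((r ^ 2 : ℝ) : ℂ) + decayExp s₂ η ^ 2) ^ 2‖ ≤ D * r ^ 4 := by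
    calc _ ≤ 4 * r ^ 2 * ‖decayExp s₁ η‖ * ‖decayExp s₂ η‖ + (r ^ 2 + ‖decayExp s₂ η‖ ^ 2) ^ 2 := by
          refine (norm_add_le _ _).trans (add_le_add ?_ ?_)
          · rw [norm_mul, norm_mul, norm_mul, hX, Complex.norm_ofNat]
          · rw [norm_pow]
            gcongr
            refine (norm_add_le _ _).trans ?_
            rw [hX, norm_pow]
      _ ≤ 4 * r ^ 2 * ((1 + √‖s₁‖) * r) * ((1 + √‖s₂‖) * r) +
          (r ^ 2 + ((1 + √‖s₂‖) * r) ^ 2) ^ 2 := by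
          gcongr <;> exact hβ _
      _ = _ := by rw [hD]; ring
  have hlow : (16 * ‖s₁ - s₂‖ * r ^ 2 - c) * r ^ 4 ≤
      ‖16 * (s₁ - s₂) * ((r ^ 2 : ℝ) : ℂ) ^ 3 +
      ((16 * s₁ * s₂ - 24 * s₂ ^ 2) * ((r ^ 2 : ℝ) : ℂ) ^ 2 -
        8 * s₂ ^ 3 * ((r ^ 2 : ℝ) : ℂ) - s₂ ^ 4)‖ := by
    have h1 : ‖16 * (s₁ - s₂) * ((r ^ 2 : ℝ) : ℂ) ^ 3‖ = 16 * ‖s₁ - s₂‖ * r ^ 6 := by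
      rw [norm_mul, norm_mul, norm_pow, hX, Complex.norm_ofNat]
      ring
    have h2 : ‖(16 * s₁ * s₂ - 24 * s₂ ^ 2) * ((r ^ 2 : ℝ) : ℂ) ^ 2 -
        8 * s₂ ^ 3 * ((r ^ 2 : ℝ) : ℂ) - s₂ ^ 4‖ ≤ c * r ^ 4 := by
      have h3 : r ^ 2 ≤ r ^ 4 := pow_le_pow_right₀ hr1 (by norm_num)
      have h4 : 1 ≤ r ^ 4 := one_le_pow₀ hr1
      calc _ ≤ ‖16 * s₁ * s₂ - 24 * s₂ ^ 2‖ * r ^ 4 + ‖8 * s₂ ^ 3‖ * r ^ 2 + ‖s₂ ^ 4‖ := by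
            refine (norm_sub_le _ _).trans (add_le_add ((norm_sub_le _ _).trans ?_) le_rfl)
            rw [norm_mul, norm_mul (8 * s₂ ^ 3), norm_pow _ 2, hX]
            exact le_of_eq (by ring)
        _ ≤ ‖16 * s₁ * s₂ - 24 * s₂ ^ 2‖ * r ^ 4 + ‖8 * s₂ ^ 3‖ * r ^ 4 + ‖s₂ ^ 4‖ * r ^ 4 := by
            gcongr
            exact le_mul_of_one_le_right (norm_nonneg _) h4
        _ = _ := by rw [hc]; ring
    have h5 := norm_sub_norm_le (16 * (s₁ - s₂) * ((r ^ 2 : ℝ) : ℂ) ^ 3)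
      (-((16 * s₁ * s₂ - 24 * s₂ ^ 2) * ((r ^ 2 : ℝ) : ℂ) ^ 2 -
        8 * s₂ ^ 3 * ((r ^ 2 : ℝ) : ℂ) - s₂ ^ 4))
    rw [sub_neg_eq_add, norm_neg, h1] at h5
    nlinarith
  rw [← rayleigh_mul_conj, norm_mul] at hlow
  have hDr : 0 < D * r ^ 4 := by positivity
  have h6 : D * r ^ 4 ≤ ‖rayleigh s₁ s₂ η‖ * (D * r ^ 4) := by
    calc D * r ^ 4 ≤ (16 * ‖s₁ - s₂‖ * r ^ 2 - c) * r ^ 4 := by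
          gcongr
          linarith
      _ ≤ _ := hlow.trans (mul_le_mul_of_nonneg_left hup (norm_nonneg _))
  exact le_of_mul_le_mul_right (by linarith) hDr

/-! ### Superpositions of plane-wave modes -/

/-- Measurable functions of polynomial growth on the Fourier plane. -/
def PolyGrowth (p : Plane2 → ℂ) : Prop :=
  Measurable p ∧ ∃ (C : ℝ) (n : ℕ), 0 ≤ C ∧ ∀ η, ‖p η‖ ≤ C * (1 + ‖η‖) ^ n

namespace PolyGrowth

variable {p q : Plane2 → ℂ}

lemma const (c : ℂ) : PolyGrowth fun _ => c :=
  ⟨measurable_const, ‖c‖, 0, norm_nonneg c, by simp⟩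

lemma coord (i : Fin 2) : PolyGrowth fun η => ((η i : ℝ) : ℂ) := by
  refine ⟨by fun_prop, 1, 1, zero_le_one, fun η => ?_⟩
  have := PiLp.norm_apply_le η i
  rw [Complex.norm_real]
  simp only [pow_one, one_mul]
  linarith

lemma decayExp (s : ℂ) : PolyGrowth (decayExp s) := by
  refine ⟨measurable_decayExp s, 1 + √‖s‖, 1, by positivity, fun η => ?_⟩
  have := norm_decayExp_le s η
  rw [pow_one]
  nlinarith [norm_nonneg η, Real.sqrt_nonneg ‖s‖]

lemma mul (hp : PolyGrowth p) (hq : PolyGrowth q) : PolyGrowth fun η => p η * q η := by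
  obtain ⟨mp, C, n, hC, hp⟩ := hp
  obtain ⟨mq, D, m, hD, hq⟩ := hq
  refine ⟨mp.mul mq, C * D, n + m, by positivity, fun η => ?_⟩
  have hη := norm_nonneg η
  calc ‖p η * q η‖ ≤ (C * (1 + ‖η‖) ^ n) * (D * (1 + ‖η‖) ^ m) := by
        rw [norm_mul]
        exact mul_le_mul (hp η) (hq η) (norm_nonneg _) (by positivity)
    _ = _ := by rw [pow_add]; ring

lemma add (hp : PolyGrowth p) (hq : PolyGrowth q) : PolyGrowth fun η => p η + q η := by
  obtain ⟨mp, C, n, hC, hp⟩ := hp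
  obtain ⟨mq, D, m, hD, hq⟩ := hq
  refine ⟨mp.add mq, C + D, n + m, by positivity, fun η => ?_⟩
  have h1 : (1 : ℝ) ≤ 1 + ‖η‖ := by linarith [norm_nonneg η]
  have hn : (1 + ‖η‖) ^ n ≤ (1 + ‖η‖) ^ (n + m) := pow_le_pow_right₀ h1 (by lia)
  have hm : (1 + ‖η‖) ^ m ≤ (1 + ‖η‖) ^ (n + m) := pow_le_pow_right₀ h1 (by lia)
  rw [add_mul]
  refine (norm_add_le _ _).trans (add_le_add ((hp η).trans ?_) ((hq η).trans ?_)) <;> gcongr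

lemma neg (hp : PolyGrowth p) : PolyGrowth fun η => -p η := by
  simpa using (const (-1)).mul hp

end PolyGrowth

/-- Amplitudes on `T` that are integrable against every polynomial times `e^{c|η|}` with `c < h`. -/
structure ModeCoeff (T : Set Plane2) (h : ℝ) (A : Plane2 → ℂ) : Prop where
  meas : AEStronglyMeasurable A (volume.restrict T)
  integrable : ∀ n : ℕ, ∀ c < h,
    IntegrableOn (fun η => (1 + ‖η‖) ^ n * Real.exp (c * ‖η‖) * ‖A η‖) T

namespace ModeCoeff

variable {T : Set Plane2} {h : ℝ} {A B : Plane2 → ℂ}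

lemma add (hA : ModeCoeff T h A) (hB : ModeCoeff T h B) : ModeCoeff T h fun η => A η + B η := by
  refine ⟨hA.meas.add hB.meas, fun n c hc => ?_⟩
  refine ((hA.integrable n c hc).add (hB.integrable n c hc)).mono' ?_ (ae_of_all _ fun η => ?_)
  · exact (Continuous.aestronglyMeasurable (by fun_prop)).mul (hA.meas.add hB.meas).norm
  · rw [Real.norm_of_nonneg (by positivity)]
    have := norm_add_le (A η) (B η)
    simp only [Pi.add_apply]
    rw [← mul_add]
    gcongr

lemma mul_left {p : Plane2 → ℂ} (hp : PolyGrowth p) (hA : ModeCoeff T h A) :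
    ModeCoeff T h fun η => p η * A η := by
  obtain ⟨mp, C, m, hC, hp⟩ := hp
  have hm := mp.aestronglyMeasurable.mul hA.meas
  refine ⟨hm, fun n c hc => ?_⟩
  refine ((hA.integrable (n + m) c hc).const_mul C).mono' ?_ (ae_of_all _ fun η => ?_)
  · exact (Continuous.aestronglyMeasurable (by fun_prop)).mul hm.norm
  · rw [Real.norm_of_nonneg (by positivity), norm_mul]
    calc _ ≤ (1 + ‖η‖) ^ n * Real.exp (c * ‖η‖) * (C * (1 + ‖η‖) ^ m * ‖A η‖) := by
          gcongr
          exact hp η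
      _ = _ := by rw [pow_add]; ring

lemma const_mul (a : ℂ) (hA : ModeCoeff T h A) : ModeCoeff T h fun η => a * A η :=
  hA.mul_left (.const a)

lemma sum {ι : Type*} (s : Finset ι) {f : ι → Plane2 → ℂ} (hf : ∀ i ∈ s, ModeCoeff T h (f i)) :
    ModeCoeff T h fun η => ∑ i ∈ s, f i η := by
  classical
  induction s using Finset.induction_on with
  | empty => exact ⟨by simpa using aestronglyMeasurable_const, fun n c hc => by simp⟩
  | insert a s ha ih =>
    simp only [Finset.sum_insert ha]
    exact (hf a (by simp)).add (ih fun i hi => hf i (by simp [hi]))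

lemma mono {T' : Set Plane2} (hA : ModeCoeff T h A) (hT : T' ⊆ T) : ModeCoeff T' h A :=
  ⟨hA.meas.mono_set hT, fun n c hc => (hA.integrable n c hc).mono_set hT⟩

/-- On a bounded set the rate plays no role. -/
lemma of_isBounded (hA : ModeCoeff T h A) (hT : Bornology.IsBounded T) (h' : ℝ) :
    ModeCoeff T h' A := by
  refine ⟨hA.meas, fun n c hc => ?_⟩
  obtain ⟨R, hR⟩ := hT.exists_norm_le
  have hi := (hA.integrable n (h - 1) (by linarith)).const_mul (Real.exp ((|c| + |h - 1|) * R))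
  have hm : AEStronglyMeasurable (fun η => (1 + ‖η‖) ^ n * Real.exp (c * ‖η‖) * ‖A η‖)
      (volume.restrict T) :=
    (Continuous.aestronglyMeasurable (by fun_prop)).mul hA.meas.norm
  have hpt : ∀ η ∈ T, ‖(1 + ‖η‖) ^ n * Real.exp (c * ‖η‖) * ‖A η‖‖ ≤
      Real.exp ((|c| + |h - 1|) * R) *
        ((1 + ‖η‖) ^ n * Real.exp ((h - 1) * ‖η‖) * ‖A η‖) := by
    intro η hη
    rw [Real.norm_of_nonneg (by positivity)]
    have h1 : Real.exp (c * ‖η‖) ≤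
        Real.exp ((|c| + |h - 1|) * R) * Real.exp ((h - 1) * ‖η‖) := by
      rw [← Real.exp_add]
      refine Real.exp_le_exp.2 ?_
      have h2 := hR η hη
      have h3 : c - (h - 1) ≤ |c| + |h - 1| := by
        linarith [le_abs_self c, neg_abs_le (h - 1)]
      have h4 : 0 ≤ |c| + |h - 1| := by positivity
      nlinarith [norm_nonneg η, mul_le_mul_of_nonneg_left h2 h4,
        mul_le_mul_of_nonneg_right h3 (norm_nonneg η)]
    calc _ ≤ (1 + ‖η‖) ^ n * (Real.exp ((|c| + |h - 1|) * R) * Real.exp ((h - 1) * ‖η‖)) *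
          ‖A η‖ := by gcongr
      _ = _ := by ring
  -- `T` need not be measurable, so the bound is transferred to the measurable set where it holds
  refine hi.mono' hm ?_
  have hS : NullMeasurableSet {η | ‖(1 + ‖η‖) ^ n * Real.exp (c * ‖η‖) * ‖A η‖‖ ≤
      Real.exp ((|c| + |h - 1|) * R) *
        ((1 + ‖η‖) ^ n * Real.exp ((h - 1) * ‖η‖) * ‖A η‖)} (volume.restrict T) :=
    nullMeasurableSet_le hm.norm.aemeasurable hi.aestronglyMeasurable.aemeasurable
  rw [ae_restrict_iff₀ hS]
  exact ae_of_all _ hpt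

end ModeCoeff

lemma SymbolOn.modeCoeff {S : Set Plane2} (hS : IsOpen S) {h : ℝ} {f : Plane2 → ℂ}
    (hf : SymbolOn S h f) : ModeCoeff S h f := by
  have hm : AEStronglyMeasurable f (volume.restrict S) :=
    ContinuousOn.aestronglyMeasurable
      (fun η hη => (hf.differentiableAt hη).continuousAt.continuousWithinAt) hS.measurableSet
  obtain ⟨C, m, hC, hb⟩ := hf
  refine ⟨hm, fun n c hc => ?_⟩
  refine (((integrable_one_add_norm_pow_mul_exp (n + m) (sub_pos.2 hc)).const_mul
    C).integrableOn).mono' ?_ ?_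
  · exact (Continuous.aestronglyMeasurable (by fun_prop)).mul hm.norm
  · refine (ae_restrict_iff' hS.measurableSet).2 (ae_of_all _ fun η hη => ?_)
    rw [Real.norm_of_nonneg (by positivity)]
    calc _ ≤ (1 + ‖η‖) ^ n * Real.exp (c * ‖η‖) *
          (C * ((1 + ‖η‖) ^ m * Real.exp (-(h * ‖η‖)))) := by
          gcongr
          exact (hb η hη).2.1
      _ = C * ((1 + ‖η‖) ^ (n + m) * (Real.exp (c * ‖η‖) * Real.exp (-(h * ‖η‖)))) := by
          rw [pow_add]; ring
      _ = _ := by rw [← Real.exp_add]; ring_nf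

/-- Only integrability is required of an amplitude, not differentiability. Hence the source factor
is admissible on the whole plane, even when β vanishes on a circle. -/
lemma IsDecayRate.modeCoeff {s : ℂ} (hs : IsDecayRate s) {z : ℝ} (hz : 0 ≤ z) :
    ModeCoeff Set.univ z fun η => Complex.exp (-decayExp s η * z) / decayExp s η := by
  have := measurable_decayExp s
  have hm : Measurable fun η => Complex.exp (-decayExp s η * z) / decayExp s η := by fun_prop
  refine ⟨hm.aestronglyMeasurable, fun n c hc => ?_⟩
  rw [integrableOn_univ]
  refine ((hs.integrable_weight n (sub_pos.2 hc)).const_mul (Real.exp (√‖s‖ * z))).mono'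
    (Measurable.aestronglyMeasurable (by fun_prop)) (ae_of_all _ fun η => ?_)
  rw [Real.norm_of_nonneg (by positivity), norm_div, norm_decayExp]
  calc _ ≤ (1 + ‖η‖) ^ n * Real.exp (c * ‖η‖) *
        (Real.exp (√‖s‖ * z) * Real.exp (-(z * ‖η‖)) / √‖((‖η‖ ^ 2 : ℝ) : ℂ) + s‖) := by
        gcongr
        exact norm_exp_neg_decayExp_le s η hz
    _ = Real.exp (√‖s‖ * z) * ((1 + ‖η‖) ^ n * (Real.exp (c * ‖η‖) * Real.exp (-(z * ‖η‖))) /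
        √‖((‖η‖ ^ 2 : ℝ) : ℂ) + s‖) := by ring
    _ = _ := by rw [← Real.exp_add]; ring_nf

/-- The vertical exponents `b` of modes that grow on compact subsets of `U` slower than
`e^{h|η|}`. -/
structure IsModeExponent (b : Plane2 → ℂ) (h : ℝ) (U : Set Space3) : Prop where
  growth : PolyGrowth b
  isOpen : IsOpen U
  bound : ∀ x ∈ U, ∃ V ∈ 𝓝 x, ∃ C c : ℝ, 0 ≤ C ∧ c < h ∧ ∀ y ∈ V, ∀ η,
    ‖Complex.exp (b η * (y 2 : ℂ))‖ ≤ C * Real.exp (c * ‖η‖)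

lemma continuous_coord (i : Fin 3) : Continuous fun y : Space3 => y i := by fun_prop

lemma norm_exp_decayExp_le (s : ℂ) (η : Plane2) {z c : ℝ} (hc : 0 ≤ c) (hz : z ≤ c) :
    ‖Complex.exp (decayExp s η * z)‖ ≤ Real.exp (√‖s‖ * c) * Real.exp (c * ‖η‖) := by
  rw [Complex.norm_exp, ← Real.exp_add]
  refine Real.exp_le_exp.2 ?_
  simp only [Complex.mul_re, Complex.ofReal_re, Complex.ofReal_im, mul_zero, sub_zero]
  have h1 := re_decayExp_nonneg s η
  have h2 := (Complex.re_le_norm _).trans (norm_decayExp_le s η)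
  nlinarith [mul_le_mul_of_nonneg_left hz h1, mul_le_mul_of_nonneg_right h2 hc]

lemma isModeExponent_decayExp (s : ℂ) {h : ℝ} (hh : 0 < h) :
    IsModeExponent (decayExp s) h {x | x 2 < h} := by
  refine ⟨.decayExp s, isOpen_lt (continuous_coord 2) continuous_const, fun x hx => ?_⟩
  have hx' : x 2 < h := hx
  -- The rate must exceed x₃, to cover a neighbourhood, and be nonnegative, so that the upper bound
  -- Re β ≤ |η| + √|s| can be used.
  obtain ⟨c, hc1, hc2⟩ := exists_between (max_lt hx' hh)
  have hc0 : 0 < c := (le_max_right _ _).trans_lt hc1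
  refine ⟨{y | y 2 < c}, (isOpen_lt (continuous_coord 2) continuous_const).mem_nhds
    ((le_max_left _ _).trans_lt hc1), Real.exp (√‖s‖ * c), c, by positivity, hc2, fun y hy η => ?_⟩
  exact norm_exp_decayExp_le s η hc0.le (le_of_lt hy)

lemma isModeExponent_neg_decayExp (s : ℂ) {h : ℝ} (hh : 0 < h) :
    IsModeExponent (fun η => -decayExp s η) h {x | -h < x 2} := by
  refine ⟨(PolyGrowth.decayExp s).neg, isOpen_lt continuous_const (continuous_coord 2),
    fun x hx => ?_⟩
  have hx' : -x 2 < h := by linarith [show -h < x 2 from hx]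
  obtain ⟨c, hc1, hc2⟩ := exists_between (max_lt hx' hh)
  have hc0 : 0 < c := (le_max_right _ _).trans_lt hc1
  refine ⟨{y | -y 2 < c}, (isOpen_lt (continuous_coord 2).neg continuous_const).mem_nhds
    ((le_max_left _ _).trans_lt hc1), Real.exp (√‖s‖ * c), c, by positivity, hc2, fun y hy η => ?_⟩
  have := norm_exp_decayExp_le s η hc0.le (le_of_lt (show -y 2 < c from hy))
  simpa using this

open ZenerMedium in
/-- The mode with vertical exponent `b`. -/
def mode (b : Plane2 → ℂ) (ξ : Space3) (η : Plane2) (x : Space3) : ℂ :=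
  planeWave η ξ x * Complex.exp (b η * (x 2 : ℂ))

/-- Fourier symbol of the gradient acting on modes with vertical exponent `b`. -/
def modeGrad (b : Plane2 → ℂ) (i : Fin 3) (η : Plane2) : ℂ :=
  ![Complex.I * (η 0 : ℂ), Complex.I * (η 1 : ℂ), b η] i

/-- The superposition of modes with amplitude `A` over `T`. -/
def modeInt (T : Set Plane2) (b : Plane2 → ℂ) (ξ : Space3) (A : Plane2 → ℂ) (x : Space3) : ℂ :=
  ∫ η in T, A η * mode b ξ η x

lemma polyGrowth_modeGrad {b : Plane2 → ℂ} (hb : PolyGrowth b) (i : Fin 3) :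
    PolyGrowth (modeGrad b i) := by
  fin_cases i
  · exact (PolyGrowth.const Complex.I).mul (.coord 0)
  · exact (PolyGrowth.const Complex.I).mul (.coord 1)
  · exact hb

lemma norm_planeWave (η : Plane2) (ξ x : Space3) : ‖ZenerMedium.planeWave η ξ x‖ = 1 := by
  rw [ZenerMedium.planeWave_eq, norm_exp_I_mul_real]

lemma measurable_mode {b : Plane2 → ℂ} (hb : Measurable b) (ξ x : Space3) :
    Measurable fun η => mode b ξ η x := by
  unfold mode ZenerMedium.planeWave
  fun_prop

lemma hasFDerivAt_mode (b : Plane2 → ℂ) (ξ : Space3) (η : Plane2) (x : Space3) :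
    HasFDerivAt (mode b ξ η) (gradL fun i => modeGrad b i η * mode b ξ η x) x := by
  have hp : ∀ i : Fin 3, HasFDerivAt (fun y : Space3 => ((y i : ℝ) : ℂ))
      (Complex.ofRealCLM.comp (EuclideanSpace.proj i : Space3 →L[ℝ] ℝ)) x := fun i =>
    (Complex.ofRealCLM.comp (EuclideanSpace.proj i : Space3 →L[ℝ] ℝ)).hasFDerivAt
  have h1 := (((((hp 0).sub_const (ξ 0 : ℂ)).const_mul (η 0 : ℂ)).add
    (((hp 1).sub_const (ξ 1 : ℂ)).const_mul (η 1 : ℂ))).const_mul Complex.I).add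
    ((hp 2).const_mul (b η))
  have h2 := h1.cexp
  have e : mode b ξ η = fun y => Complex.exp (Complex.I * ((η 0 : ℂ) * ((y 0 : ℂ) - (ξ 0 : ℂ)) +
      (η 1 : ℂ) * ((y 1 : ℂ) - (ξ 1 : ℂ))) + b η * (y 2 : ℂ)) := by
    ext y
    rw [mode, ZenerMedium.planeWave, Complex.exp_add]
    push_cast
    rfl
  rw [e]
  refine h2.congr_fderiv ?_
  ext v
  simp [gradL_apply, Fin.sum_univ_three, modeGrad]
  ring

section ModeInt

variable {T : Set Plane2} {b : Plane2 → ℂ} {h : ℝ} {U : Set Space3} {A B : Plane2 → ℂ}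

/-- The amplitudes serve as index set: a derivative multiplies the amplitude by a symbol of
polynomial growth, which keeps it admissible. Superpositions of modes are therefore smooth and may
be differentiated under the integral. -/
lemma dominatedFamily_mode (hb : IsModeExponent b h U) (T : Set Plane2) (ξ : Space3) :
    DominatedFamily (J := {A // ModeCoeff T h A}) (volume.restrict T) U
      (fun i A => ⟨fun η => modeGrad b i η * A.1 η, A.2.mul_left (polyGrowth_modeGrad hb.growth i)⟩)
      (fun A η x => A.1 η * mode b ξ η x) where
  deriv A := ae_of_all _ fun η x _ => by
    refine ((hasFDerivAt_mode b ξ η x).const_mul (A.1 η)).congr_fderiv ?_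
    ext v
    simp [gradL_apply, Fin.sum_univ_three]
    ring
  meas A x _ := A.2.meas.mul (measurable_mode hb.growth.1 ξ x).aestronglyMeasurable
  bound A x hx := by
    obtain ⟨V, hV, C, c, hC, hc, hbd⟩ := hb.bound x hx
    refine ⟨V, hV, _, (A.2.integrable 0 c hc).const_mul C, ae_of_all _ fun η y hy => ?_⟩
    rw [norm_mul, mode, norm_mul, norm_planeWave, one_mul, pow_zero, one_mul]
    calc _ ≤ ‖A.1 η‖ * (C * Real.exp (c * ‖η‖)) := by
          gcongr
          exact hbd y hy η
      _ = _ := by ring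

lemma ModeCoeff.modeGrad_mul (hb : IsModeExponent b h U) (hA : ModeCoeff T h A) (i : Fin 3) :
    ModeCoeff T h fun η => modeGrad b i η * A η :=
  hA.mul_left (polyGrowth_modeGrad hb.growth i)

lemma ModeCoeff.integrable_mode (hb : IsModeExponent b h U) (hA : ModeCoeff T h A) (ξ : Space3)
    {x : Space3} (hx : x ∈ U) : IntegrableOn (fun η => A η * mode b ξ η x) T :=
  (dominatedFamily_mode hb T ξ).integrable ⟨A, hA⟩ hx

lemma ModeCoeff.contDiffAt (hb : IsModeExponent b h U) (hA : ModeCoeff T h A) (ξ : Space3)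
    {x : Space3} (hx : x ∈ U) : ContDiffAt ℝ ∞ (modeInt T b ξ A) x :=
  (dominatedFamily_mode hb T ξ).contDiffAt hb.isOpen ⟨A, hA⟩ hx

lemma ModeCoeff.pd_modeInt (hb : IsModeExponent b h U) (hA : ModeCoeff T h A) (ξ : Space3)
    {x : Space3} (hx : x ∈ U) (i : Fin 3) :
    pd i (modeInt T b ξ A) x = modeInt T b ξ (fun η => modeGrad b i η * A η) x :=
  (dominatedFamily_mode hb T ξ).pd_integral hb.isOpen ⟨A, hA⟩ hx i

lemma ModeCoeff.pd_pd_modeInt (hb : IsModeExponent b h U) (hA : ModeCoeff T h A) (ξ : Space3)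
    {x : Space3} (hx : x ∈ U) (i j : Fin 3) :
    pd i (pd j (modeInt T b ξ A)) x =
      modeInt T b ξ (fun η => modeGrad b i η * (modeGrad b j η * A η)) x := by
  rw [← (hA.modeGrad_mul hb j).pd_modeInt hb ξ hx i]
  refine (Filter.EventuallyEq.pd_eventuallyEq ?_ i).eq_of_nhds
  filter_upwards [hb.isOpen.mem_nhds hx] with y hy using hA.pd_modeInt hb ξ hy j

lemma modeInt_add (hb : IsModeExponent b h U) (hA : ModeCoeff T h A) (hB : ModeCoeff T h B)
    (ξ : Space3) {x : Space3} (hx : x ∈ U) :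
    modeInt T b ξ (fun η => A η + B η) x = modeInt T b ξ A x + modeInt T b ξ B x := by
  simp only [modeInt, add_mul]
  exact integral_add (hA.integrable_mode hb ξ hx) (hB.integrable_mode hb ξ hx)

lemma modeInt_const_mul (a : ℂ) (A : Plane2 → ℂ) (ξ x : Space3) :
    modeInt T b ξ (fun η => a * A η) x = a * modeInt T b ξ A x := by
  simp only [modeInt, mul_assoc]
  exact integral_const_mul _ _

lemma modeInt_sum (hb : IsModeExponent b h U) {ι : Type*} (s : Finset ι) {f : ι → Plane2 → ℂ}
    (hf : ∀ i ∈ s, ModeCoeff T h (f i)) (ξ : Space3) {x : Space3} (hx : x ∈ U) :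
    modeInt T b ξ (fun η => ∑ i ∈ s, f i η) x = ∑ i ∈ s, modeInt T b ξ (f i) x := by
  simp only [modeInt, Finset.sum_mul]
  exact integral_finsetSum _ fun i hi => (hf i hi).integrable_mode hb ξ hx

variable {M : ZenerMedium} {V : Fin 3 → Plane2 → ℂ}

lemma L_modeInt (hb : IsModeExponent b h U) (hV : ∀ i, ModeCoeff T h (V i)) (ξ : Space3)
    {x : Space3} (hx : x ∈ U) (j : Fin 3) :
    M.L (fun i => modeInt T b ξ (V i)) j x = modeInt T b ξ (fun η =>
      ((M.lam + M.mu : ℂ) * ∑ i, modeGrad b j η * (modeGrad b i η * V i η)) +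
      (M.mu * (∑ i, modeGrad b i η * (modeGrad b i η * V j η)) +
      M.rho * M.dampedSq * V j η)) x := by
  have h2 : ∀ i j k, ModeCoeff T h fun η => modeGrad b i η * (modeGrad b j η * V k η) :=
    fun i j k => ((hV k).modeGrad_mul hb j).modeGrad_mul hb i
  have hs1 := ModeCoeff.sum Finset.univ fun i _ => h2 j i i
  have hs2 := ModeCoeff.sum Finset.univ fun i _ => h2 i i j
  rw [M.L_eq (fun i => (hV i).contDiffAt hb ξ hx), modeInt_add hb (hs1.const_mul _)
    ((hs2.const_mul _).add ((hV j).const_mul _)) ξ hx,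
    modeInt_add hb (hs2.const_mul _) ((hV j).const_mul _) ξ hx, modeInt_const_mul,
    modeInt_const_mul, modeInt_const_mul, modeInt_sum hb _ (fun i _ => h2 j i i) ξ hx,
    modeInt_sum hb _ (fun i _ => h2 i i j) ξ hx]
  simp only [fun i j k => (hV k).pd_pd_modeInt hb ξ hx i j]
  ring

lemma traction_modeInt (hb : IsModeExponent b h U) (hV : ∀ i, ModeCoeff T h (V i)) (ξ : Space3)
    {x : Space3} (hx : x ∈ U) (j : Fin 3) :
    M.traction (fun i => modeInt T b ξ (V i)) j x = modeInt T b ξ (fun η =>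
      ∑ k, ∑ l, M.C 2 j k l * (modeGrad b l η * V k η)) x := by
  have h1 : ∀ k l, ModeCoeff T h fun η => M.C 2 j k l * (modeGrad b l η * V k η) :=
    fun k l => ((hV k).modeGrad_mul hb l).const_mul _
  rw [modeInt_sum hb _ (fun k _ => ModeCoeff.sum _ fun l _ => h1 k l) ξ hx]
  simp only [ZenerMedium.traction, ZenerMedium.stress]
  refine Finset.sum_congr rfl fun k _ => ?_
  rw [modeInt_sum hb _ (fun l _ => h1 k l) ξ hx]
  refine Finset.sum_congr rfl fun l _ => ?_
  rw [modeInt_const_mul, (hV k).pd_modeInt hb ξ hx]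

end ModeInt

namespace ZenerMedium

variable {M : ZenerMedium}

lemma traction_congr {v w : Fin 3 → Space3 → ℂ} {x : Space3} (h : ∀ i, v i =ᶠ[𝓝 x] w i)
    (j : Fin 3) : M.traction v j x = M.traction w j x := by
  simp only [traction, stress, fun k l => ((h k).pd_eventuallyEq l).eq_of_nhds]

lemma traction_add {v w : Fin 3 → Space3 → ℂ} {x : Space3} (hv : ∀ i, DifferentiableAt ℝ (v i) x)
    (hw : ∀ i, DifferentiableAt ℝ (w i) x) (j : Fin 3) :
    M.traction (fun i y => v i y + w i y) j x = M.traction v j x + M.traction w j x := by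
  simp only [traction, stress, fun k l => pd_add (hv k) (hw k) l, mul_add, Finset.sum_add_distrib]

lemma L_add {v w : Fin 3 → Space3 → ℂ} {x : Space3} (hv : ∀ i, ContDiffAt ℝ ∞ (v i) x)
    (hw : ∀ i, ContDiffAt ℝ ∞ (w i) x) (j : Fin 3) :
    M.L (fun i y => v i y + w i y) j x = M.L v j x + M.L w j x := by
  have hs : ∀ i, M.stress (fun i y => v i y + w i y) i j =ᶠ[𝓝 x]
      fun y => M.stress v i j y + M.stress w i j y := by
    intro i
    have e : ∀ᶠ y in 𝓝 x, ∀ k, DifferentiableAt ℝ (v k) y ∧ DifferentiableAt ℝ (w k) y := by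
      refine eventually_all.2 fun k => ?_
      filter_upwards [((hv k).of_le (m := 1) (by simp)).eventually (by simp),
        ((hw k).of_le (m := 1) (by simp)).eventually (by simp)] with y h1 h2
      exact ⟨h1.differentiableAt one_ne_zero, h2.differentiableAt one_ne_zero⟩
    filter_upwards [e] with y hy
    simp only [stress, fun k l => pd_add (hy k).1 (hy k).2 l, mul_add, Finset.sum_add_distrib]
  have hd : ∀ u : Fin 3 → Space3 → ℂ, (∀ i, ContDiffAt ℝ ∞ (u i) x) →
      ∀ i, DifferentiableAt ℝ (M.stress u i j) x := by
    intro u hu i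
    unfold stress
    exact DifferentiableAt.fun_sum fun k _ => DifferentiableAt.fun_sum fun l _ =>
      (((hu k).pd_infty l).differentiableAt_infty).const_mul _
  simp only [L, fun i => ((hs i).pd_eventuallyEq i).eq_of_nhds,
    fun i => pd_add (hd v hv i) (hd w hw i) i, mul_add, Finset.sum_add_distrib]
  ring

/-! ### Fields composed of pressure and shear modes -/

/-- The superposition over `T` of modes with vertical exponents `b₁`, `b₂` and vector amplitudes
`A`, `B`. -/
def modePair (T : Set Plane2) (b₁ b₂ : Plane2 → ℂ) (ξ : Space3) (A B : Fin 3 → Plane2 → ℂ)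
    (j : Fin 3) (x : Space3) : ℂ :=
  modeInt T b₁ ξ (A j) x + modeInt T b₂ ξ (B j) x

/-- The Fourier symbol of the equation `L v = 0` for the mode with exponent `b`. -/
def IsNavierSymbol (M : ZenerMedium) (T : Set Plane2) (b : Plane2 → ℂ) (A : Fin 3 → Plane2 → ℂ) :
    Prop :=
  ∀ j, ∀ η ∈ T, ((M.lam + M.mu : ℂ) * ∑ i, modeGrad b j η * (modeGrad b i η * A i η)) +
      (M.mu * (∑ i, modeGrad b i η * (modeGrad b i η * A j η)) +
      M.rho * M.dampedSq * A j η) = 0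

section ModePair

variable {T : Set Plane2} {b₁ b₂ : Plane2 → ℂ} {h : ℝ} {U : Set Space3}
  {A B : Fin 3 → Plane2 → ℂ} {x : Space3}

lemma contDiffAt_modePair (hb₁ : IsModeExponent b₁ h U) (hb₂ : IsModeExponent b₂ h U)
    (hA : ∀ i, ModeCoeff T h (A i)) (hB : ∀ i, ModeCoeff T h (B i)) (ξ : Space3) (hx : x ∈ U)
    (j : Fin 3) : ContDiffAt ℝ ∞ (modePair T b₁ b₂ ξ A B j) x :=
  ((hA j).contDiffAt hb₁ ξ hx).add ((hB j).contDiffAt hb₂ ξ hx)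

lemma L_modePair (hT : MeasurableSet T) (hb₁ : IsModeExponent b₁ h U)
    (hb₂ : IsModeExponent b₂ h U)
    (hA : ∀ i, ModeCoeff T h (A i)) (hB : ∀ i, ModeCoeff T h (B i)) (ξ : Space3) (hx : x ∈ U)
    (sA : M.IsNavierSymbol T b₁ A) (sB : M.IsNavierSymbol T b₂ B) (j : Fin 3) :
    M.L (modePair T b₁ b₂ ξ A B) j x = 0 := by
  have h0 : ∀ b (P : Plane2 → ℂ), (∀ η ∈ T, P η = 0) → modeInt T b ξ P x = 0 := by
    intro b P hP
    rw [modeInt, ← integral_zero Plane2 ℂ (μ := volume.restrict T)]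
    refine setIntegral_congr_fun hT fun η hη => ?_
    simp only [hP η hη, zero_mul]
  have := L_add (M := M) (fun i => (hA i).contDiffAt hb₁ ξ hx)
    (fun i => (hB i).contDiffAt hb₂ ξ hx) j
  rw [L_modeInt hb₁ hA ξ hx, L_modeInt hb₂ hB ξ hx, h0 _ _ (sA j), h0 _ _ (sB j), add_zero] at this
  exact this

/-- On x₃ = 0 every vertical exponential equals 1, so pressure and shear modes share the same
Fourier kernel and their symbols can be added. -/
lemma traction_modePair (hb₁ : IsModeExponent b₁ h U)
    (hb₂ : IsModeExponent b₂ h U)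
    (hA : ∀ i, ModeCoeff T h (A i)) (hB : ∀ i, ModeCoeff T h (B i)) (ξ : Space3) (hx : x ∈ U)
    (hx0 : x 2 = 0) (j : Fin 3) :
    IntegrableOn (fun η => ((∑ k, ∑ l, M.C 2 j k l * (modeGrad b₁ l η * A k η)) +
      ∑ k, ∑ l, M.C 2 j k l * (modeGrad b₂ l η * B k η)) * planeWave η ξ x) T ∧
    M.traction (modePair T b₁ b₂ ξ A B) j x = ∫ η in T,
      ((∑ k, ∑ l, M.C 2 j k l * (modeGrad b₁ l η * A k η)) +
      ∑ k, ∑ l, M.C 2 j k l * (modeGrad b₂ l η * B k η)) * planeWave η ξ x := by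
  have hm : ∀ b η, mode b ξ η x = planeWave η ξ x := by
    intro b η
    simp [mode, hx0]
  have c₁ : ModeCoeff T h fun η => ∑ k, ∑ l, M.C 2 j k l * (modeGrad b₁ l η * A k η) :=
    ModeCoeff.sum _ fun k _ => ModeCoeff.sum _ fun l _ => ((hA k).modeGrad_mul hb₁ l).const_mul _
  have c₂ : ModeCoeff T h fun η => ∑ k, ∑ l, M.C 2 j k l * (modeGrad b₂ l η * B k η) :=
    ModeCoeff.sum _ fun k _ => ModeCoeff.sum _ fun l _ => ((hB k).modeGrad_mul hb₂ l).const_mul _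
  have i₁ := c₁.integrable_mode hb₁ ξ hx
  have i₂ := c₂.integrable_mode hb₂ ξ hx
  have := traction_add (M := M) (fun i => ((hA i).contDiffAt hb₁ ξ hx).differentiableAt_infty)
    (fun i => ((hB i).contDiffAt hb₂ ξ hx).differentiableAt_infty) j
  rw [traction_modeInt hb₁ hA ξ hx, traction_modeInt hb₂ hB ξ hx] at this
  simp only [hm] at i₁ i₂
  simp only [modeInt, hm] at this
  simp only [add_mul]
  refine ⟨i₁.add i₂, ?_⟩
  rw [integral_add i₁ i₂]
  exact this

end ModePair

/-! ### The fundamental solution above the source -/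

lemma isModeExponent_beta (k : ℂ) {h : ℝ} (hh : 0 < h) :
    IsModeExponent (beta k) h {x | x 2 < h} := by
  rw [show beta k = decayExp (-k ^ 2) from funext (beta_eq_decayExp k)]
  exact isModeExponent_decayExp _ hh

lemma isModeExponent_neg_beta (k : ℂ) {h : ℝ} (hh : 0 < h) :
    IsModeExponent (fun η => -beta k η) h {x | -h < x 2} := by
  simp only [beta_eq_decayExp]
  exact isModeExponent_neg_decayExp _ hh

/-- The source factor `e^{β ξ₃} / β`. -/
def sourceFactor (k : ℂ) (ξ : Space3) (η : Plane2) : ℂ :=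
  Complex.exp (beta k η * (ξ 2 : ℂ)) / beta k η

lemma modeCoeff_sourceFactor {k : ℂ} (hk : IsDecayRate (-k ^ 2)) {ξ : Space3} (hξ : ξ 2 ≤ 0) :
    ModeCoeff Set.univ (-ξ 2) (sourceFactor k ξ) := by
  have := hk.modeCoeff (neg_nonneg.2 hξ)
  unfold sourceFactor
  simp only [beta_eq_decayExp]
  simpa using this

lemma sphericalWave_eq_modeInt {k : ℂ} (hk : IsDecayRate (-k ^ 2))
    (hI : Complex.I * k = -Complex.sqrt (-k ^ 2)) {ξ x : Space3} (hx : ξ 2 < x 2) :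
    sphericalWave k ξ x = 1 / (2 * (Real.pi : ℂ)) *
      modeInt Set.univ (fun η => -beta k η) ξ (sourceFactor k ξ) x := by
  rw [(planeWave_expansion hk hI hx.ne').2, modeInt, setIntegral_univ]
  congr 2
  ext η
  rw [waveIntegrand, abs_of_pos (sub_pos.2 hx), mode, sourceFactor]
  have : Complex.exp (-beta k η * ((x 2 - ξ 2 : ℝ) : ℂ)) =
      Complex.exp (beta k η * (ξ 2 : ℂ)) * Complex.exp (-beta k η * (x 2 : ℂ)) := by
    rw [← Complex.exp_add]
    push_cast
    ring_nf
  rw [this]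
  ring

/-- The factor `1 / (8π²μk₂²)`. -/
def sourceConst (M : ZenerMedium) : ℂ :=
  1 / (4 * (Real.pi : ℂ) * (M.mu : ℂ)) * (1 / (2 * (Real.pi : ℂ))) * (1 / M.k₂ ^ 2)

/-- Pressure amplitudes of the fundamental solution above the source. -/
def upP (M : ZenerMedium) (ξ : Space3) (m j : Fin 3) (η : Plane2) : ℂ :=
  -M.sourceConst * (M.D₁ η j m * sourceFactor M.k₁ ξ η)

/-- Shear amplitudes of the fundamental solution above the source. -/
def upS (M : ZenerMedium) (ξ : Space3) (m j : Fin 3) (η : Plane2) : ℂ :=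
  M.sourceConst * (M.D₂ η j m * sourceFactor M.k₂ ξ η)

/-- The part of the fundamental solution above the source with wave vectors in `T`. -/
def upField (M : ZenerMedium) (T : Set Plane2) (ξ : Space3) (m : Fin 3) :
    Fin 3 → Space3 → ℂ :=
  modePair T (fun η => -beta M.k₁ η) (fun η => -beta M.k₂ η) ξ (M.upP ξ m) (M.upS ξ m)

lemma gradSymbol_eq (k : ℂ) (η : Plane2) (i : Fin 3) :
    gradSymbol k η i = modeGrad (fun η => -beta k η) i η := rfl

lemma polyGrowth_gradSymbol (k : ℂ) (i : Fin 3) : PolyGrowth fun η => gradSymbol k η i :=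
  polyGrowth_modeGrad (isModeExponent_neg_beta k one_pos).growth i

lemma modeCoeff_upP (hM : M.IsRegular) {ξ : Space3} (hξ : ξ 2 ≤ 0) (m j : Fin 3) :
    ModeCoeff Set.univ (-ξ 2) (M.upP ξ m j) :=
  ((modeCoeff_sourceFactor hM.decay₁ hξ).mul_left
    ((polyGrowth_gradSymbol _ j).mul (polyGrowth_gradSymbol _ m))).const_mul _

lemma modeCoeff_upS (hM : M.IsRegular) {ξ : Space3} (hξ : ξ 2 ≤ 0) (m j : Fin 3) :
    ModeCoeff Set.univ (-ξ 2) (M.upS ξ m j) :=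
  ((modeCoeff_sourceFactor hM.decay₂ hξ).mul_left
    (((polyGrowth_gradSymbol _ j).mul (polyGrowth_gradSymbol _ m)).add (.const _))).const_mul _

/-- Above the source |x₃ - ξ₃| = x₃ - ξ₃, so Weyl's integrals are superpositions of modes e^{-βx₃},
on which the Hessian acts as multiplication by d_i d_j. This covers a neighbourhood of the boundary
plane. -/
lemma uStar_eq_upField (hM : M.IsRegular) {ξ : Space3} (hξ : ξ 2 < 0) {x : Space3}
    (hx : ξ 2 < x 2) (j m : Fin 3) : M.uStar ξ x j m = M.upField Set.univ ξ m j x := by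
  have hh : 0 < -ξ 2 := neg_pos.2 hξ
  have e₁ := isModeExponent_neg_beta M.k₁ hh
  have e₂ := isModeExponent_neg_beta M.k₂ hh
  have c₁ := modeCoeff_sourceFactor hM.decay₁ hξ.le
  have c₂ := modeCoeff_sourceFactor hM.decay₂ hξ.le
  have hU : ∀ y : Space3, ξ 2 < y 2 → y ∈ {y : Space3 | - -ξ 2 < y 2} := by simp
  have hne : x ≠ ξ := fun e => by simp [e] at hx
  have hw : waveDiff M ξ =ᶠ[𝓝 x] fun y => 1 / (2 * (Real.pi : ℂ)) *
      modeInt Set.univ (fun η => -beta M.k₂ η) ξ (sourceFactor M.k₂ ξ) y -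
      1 / (2 * (Real.pi : ℂ)) *
      modeInt Set.univ (fun η => -beta M.k₁ η) ξ (sourceFactor M.k₁ ξ) y := by
    filter_upwards [(isOpen_lt continuous_const (continuous_coord 2)).mem_nhds hx] with y hy
    rw [waveDiff, sphericalWave_eq_modeInt hM.decay₁ hM.I_mul_k₁ hy,
      sphericalWave_eq_modeInt hM.decay₂ hM.I_mul_k₂ hy]
  have hp : ∀ i, ∀ y : Space3, ξ 2 < y 2 → pd i (fun y => 1 / (2 * (Real.pi : ℂ)) *
      modeInt Set.univ (fun η => -beta M.k₂ η) ξ (sourceFactor M.k₂ ξ) y -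
      1 / (2 * (Real.pi : ℂ)) *
      modeInt Set.univ (fun η => -beta M.k₁ η) ξ (sourceFactor M.k₁ ξ) y) y = 
      1 / (2 * (Real.pi : ℂ)) *
      pd i (modeInt Set.univ (fun η => -beta M.k₂ η) ξ (sourceFactor M.k₂ ξ)) y -
      1 / (2 * (Real.pi : ℂ)) *
      pd i (modeInt Set.univ (fun η => -beta M.k₁ η) ξ (sourceFactor M.k₁ ξ)) y := by
    intro i y hy
    have d₁ := (c₁.contDiffAt e₁ ξ (hU y hy)).differentiableAt_infty
    have d₂ := (c₂.contDiffAt e₂ ξ (hU y hy)).differentiableAt_infty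
    rw [pd_sub (d₂.const_mul _) (d₁.const_mul _), pd_const_mul d₂, pd_const_mul d₁]
  have hpp : pd j (pd m (waveDiff M ξ)) x = 1 / (2 * (Real.pi : ℂ)) *
      pd j (pd m (modeInt Set.univ (fun η => -beta M.k₂ η) ξ (sourceFactor M.k₂ ξ))) x -
      1 / (2 * (Real.pi : ℂ)) *
      pd j (pd m (modeInt Set.univ (fun η => -beta M.k₁ η) ξ (sourceFactor M.k₁ ξ))) x := by
    rw [((hw.pd_eventuallyEq m).pd_eventuallyEq j).eq_of_nhds]
    have : pd m (fun y => 1 / (2 * (Real.pi : ℂ)) *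
      modeInt Set.univ (fun η => -beta M.k₂ η) ξ (sourceFactor M.k₂ ξ) y -
      1 / (2 * (Real.pi : ℂ)) *
      modeInt Set.univ (fun η => -beta M.k₁ η) ξ (sourceFactor M.k₁ ξ) y) =ᶠ[𝓝 x] fun y => 
      1 / (2 * (Real.pi : ℂ)) *
      pd m (modeInt Set.univ (fun η => -beta M.k₂ η) ξ (sourceFactor M.k₂ ξ)) y -
      1 / (2 * (Real.pi : ℂ)) *
      pd m (modeInt Set.univ (fun η => -beta M.k₁ η) ξ (sourceFactor M.k₁ ξ)) y := by
      filter_upwards [(isOpen_lt continuous_const (continuous_coord 2)).mem_nhds hx] with y hy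
        using hp m y hy
    rw [(this.pd_eventuallyEq j).eq_of_nhds]
    have d₁ := ((c₁.contDiffAt e₁ ξ (hU x hx)).pd_infty m).differentiableAt_infty
    have d₂ := ((c₂.contDiffAt e₂ ξ (hU x hx)).pd_infty m).differentiableAt_infty
    rw [pd_sub (d₂.const_mul _) (d₁.const_mul _), pd_const_mul d₂, pd_const_mul d₁]
  have hk : M.k₂ ≠ 0 := fun h0 => hM.decay₂.ne_zero (by simp [h0])
  have q₁ := ((c₁.modeGrad_mul e₁ m).modeGrad_mul e₁ j)
  have q₂ := ((c₂.modeGrad_mul e₂ m).modeGrad_mul e₂ j)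
  have hS : M.upS ξ m j = fun η => M.sourceConst * ((modeGrad (fun η => -beta M.k₂ η) j η *
      (modeGrad (fun η => -beta M.k₂ η) m η * sourceFactor M.k₂ ξ η)) +
      M.k₂ ^ 2 * kron j m * sourceFactor M.k₂ ξ η) := by
    ext η
    simp only [upS, D₂, gradSymbol_eq]
    ring
  have hP : M.upP ξ m j = fun η => -M.sourceConst * (modeGrad (fun η => -beta M.k₁ η) j η *
      (modeGrad (fun η => -beta M.k₁ η) m η * sourceFactor M.k₁ ξ η)) := by
    ext η
    simp only [upP, D₁, gradSymbol_eq]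
    ring
  rw [uStar_eq hne, hpp, c₁.pd_pd_modeInt e₁ ξ (hU x hx), c₂.pd_pd_modeInt e₂ ξ (hU x hx),
    sphericalWave_eq_modeInt hM.decay₂ hM.I_mul_k₂ hx, upField, modePair, hS, hP,
    modeInt_const_mul, modeInt_const_mul, modeInt_add e₂ q₂ (c₂.const_mul _) ξ (hU x hx),
    modeInt_const_mul, sourceConst]
  field_simp
  ring

lemma sum_gradSymbol_sq (k : ℂ) (η : Plane2) :
    gradSymbol k η 0 ^ 2 + gradSymbol k η 1 ^ 2 + gradSymbol k η 2 ^ 2 = -k ^ 2 := by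
  have h := decayExp_sq (-k ^ 2) η
  rw [← beta_eq_decayExp, norm_sq_plane] at h
  push_cast at h
  simp only [gradSymbol, Matrix.cons_val_zero, Matrix.cons_val_one, Matrix.cons_val, mul_pow,
    Complex.I_sq, neg_sq, h]
  ring

/-- The amplitude is parallel to d with d·d = -k₁², so the equation reduces to (λ+2μ)k₁² = ρω̃². -/
lemma isNavierSymbol_upP (hM : M.IsRegular) (T : Set Plane2) (ξ : Space3) (m : Fin 3) :
    M.IsNavierSymbol T (fun η => -beta M.k₁ η) (M.upP ξ m) := by
  intro j η _
  have h := sum_gradSymbol_sq M.k₁ η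
  have h2 := hM.lam_mul
  simp only [← gradSymbol_eq, upP, D₁, Fin.sum_univ_three]
  linear_combination (-M.sourceConst * gradSymbol M.k₁ η j * gradSymbol M.k₁ η m *
    sourceFactor M.k₁ ξ η) * ((M.lam + 2 * M.mu) * h - h2)

/-- Here d·d = -k₂² makes the columns of D² orthogonal to d. The divergence term drops out and μk₂²
= ρω̃² remains. -/
lemma isNavierSymbol_upS (hM : M.IsRegular) (T : Set Plane2) (ξ : Space3) (m : Fin 3) :
    M.IsNavierSymbol T (fun η => -beta M.k₂ η) (M.upS ξ m) := by
  intro j η _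
  have h := sum_gradSymbol_sq M.k₂ η
  have h2 := hM.mu_mul
  have h3 : ∑ i, gradSymbol M.k₂ η i * kron i m = gradSymbol M.k₂ η m := by simp [kron]
  rw [Fin.sum_univ_three] at h3
  simp only [← gradSymbol_eq, upS, D₂, Fin.sum_univ_three]
  linear_combination (M.sourceConst * sourceFactor M.k₂ ξ η) *
    ((M.lam + M.mu) * gradSymbol M.k₂ η j * (gradSymbol M.k₂ η m * h + M.k₂ ^ 2 * h3) +
    (gradSymbol M.k₂ η j * gradSymbol M.k₂ η m + M.k₂ ^ 2 * kron j m) * (M.mu * h - h2))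

lemma Q_eq (ξ : Space3) (η : Plane2) (j m : Fin 3) :
    M.Q ξ η j m = (∑ k, ∑ l, M.C 2 j k l * (modeGrad (fun η => -beta M.k₁ η) l η * M.upP ξ m k η)) +
      ∑ k, ∑ l, M.C 2 j k l * (modeGrad (fun η => -beta M.k₂ η) l η * M.upS ξ m k η) := by
  have e0 : M.expFactor ξ η 0 = sourceFactor M.k₁ ξ η := rfl
  have e1 : M.expFactor ξ η 1 = sourceFactor M.k₂ ξ η := rfl
  rw [Q, e0, e1]
  change M.sourceConst * _ = _
  simp only [← gradSymbol_eq, upP, upS, Fin.sum_univ_three]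
  ring

end ZenerMedium

namespace ZenerMedium

variable {M : ZenerMedium}

/-! ### Wave vectors away from branch points and zeros of the Rayleigh function -/

/-- The Rayleigh function of the medium. -/
def rayleighFn (M : ZenerMedium) : Plane2 → ℂ := rayleigh (-M.k₁ ^ 2) (-M.k₂ ^ 2)

/-- An open set of wave vectors with bounded complement, on which the branch points and the zeros
of the Rayleigh function are avoided. -/
structure IsGoodSet (M : ZenerMedium) (S : Set Plane2) : Prop where
  isOpen : IsOpen S
  avoids₁ : AvoidsBranch (-M.k₁ ^ 2) S
  avoids₂ : AvoidsBranch (-M.k₂ ^ 2) S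
  exists_le_rayleigh : ∃ δ > 0, ∀ η ∈ S, δ ≤ ‖M.rayleighFn η‖
  isBounded_compl : Bornology.IsBounded Sᶜ

/-- If k₁² = k₂², then μk₂² = (λ+2μ)k₁² gives (λ+μ)k₂² = 0. -/
lemma IsRegular.neg_sq_ne (hM : M.IsRegular) : -M.k₁ ^ 2 ≠ -M.k₂ ^ 2 := by
  intro h
  have h1 := hM.mu_mul.trans hM.lam_mul.symm
  have h2 : ((M.lam + M.mu : ℝ) : ℂ) * -M.k₂ ^ 2 = 0 := by
    push_cast
    linear_combination (M.lam + 2 * M.mu) * -h + h1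
  rcases mul_eq_zero.1 h2 with h3 | h3
  · exact hM.lam_add_mu_pos.ne' (by exact_mod_cast h3)
  · exact hM.decay₂.ne_zero h3

lemma avoidsBranch_of_lt (s : ℂ) {R : ℝ} (hR : ‖s‖ + 1 ≤ R ^ 2) (hR0 : 0 ≤ R) :
    AvoidsBranch s {η | R < ‖η‖} := by
  refine ⟨1, one_pos, fun η hη => ?_⟩
  have h1 : R ^ 2 < ‖η‖ ^ 2 := by
    have : R < ‖η‖ := hη
    gcongr
  have h2 := (abs_le.1 (Complex.abs_re_le_norm s)).1
  have h3 : 1 ≤ (((‖η‖ ^ 2 : ℝ) : ℂ) + s).re := by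
    rw [Complex.add_re, Complex.ofReal_re]
    linarith
  exact ⟨Or.inl (by linarith), h3.trans (Complex.re_le_norm _)⟩

/-- The exterior of a large disc will do; this needs neither absorption nor (H). -/
lemma IsRegular.exists_isGoodSet (hM : M.IsRegular) : ∃ S, M.IsGoodSet S := by
  obtain ⟨R₀, hR₀, hb⟩ := exists_one_le_norm_rayleigh hM.neg_sq_ne
  set R := R₀ + ‖-M.k₁ ^ 2‖ + ‖-M.k₂ ^ 2‖ + 1
  have n1 := norm_nonneg (-M.k₁ ^ 2)
  have n2 := norm_nonneg (-M.k₂ ^ 2)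
  have hR1 : 1 ≤ R := by linarith
  have hR2 : R ≤ R ^ 2 := by nlinarith
  refine ⟨{η | R < ‖η‖}, isOpen_lt continuous_const continuous_norm,
    avoidsBranch_of_lt _ (by linarith) (by linarith),
    avoidsBranch_of_lt _ (by linarith) (by linarith), ⟨1, one_pos, fun η hη => hb η ?_⟩, ?_⟩
  · have : R < ‖η‖ := hη
    linarith
  · refine (Metric.isBounded_closedBall (x := (0 : Plane2)) (r := R)).subset fun η hη => ?_
    simpa using hη

lemma avoidsBranch_univ {s : ℂ} (hs : s ∈ Complex.slitPlane) : AvoidsBranch s Set.univ := by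
  obtain ⟨δ, hδ, hb⟩ := exists_le_norm_ofReal_add hs
  exact ⟨δ, hδ, fun η _ => ⟨ofReal_add_mem_slitPlane hs (by positivity),
    (hb s (Metric.mem_ball_self hδ)).2 _ (by positivity)⟩⟩

lemma beta_sq (k : ℂ) (η : Plane2) : beta k η ^ 2 = (η 0 : ℂ) ^ 2 + (η 1 : ℂ) ^ 2 - k ^ 2 :=
  Complex.sqrt_sq_eq _

lemma rayleighFn_eq (η : Plane2) : M.rayleighFn η =
    4 * ((η 0 : ℂ) ^ 2 + (η 1 : ℂ) ^ 2) * beta M.k₁ η * beta M.k₂ η -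
      ((η 0 : ℂ) ^ 2 + (η 1 : ℂ) ^ 2 + beta M.k₂ η ^ 2) ^ 2 := by
  rw [rayleighFn, rayleigh, ← beta_eq_decayExp, ← beta_eq_decayExp, norm_sq_plane]
  push_cast
  ring

/-- The relation μk₂² = (λ+2μ)k₁² expresses the normal traction of a pressure mode through |η|² +
β₂², the quantity that occurs in the Rayleigh function. -/
lemma IsRegular.normal_symbol (hM : M.IsRegular) (η : Plane2) :
    (M.lam + 2 * M.mu) * beta M.k₁ η ^ 2 - M.lam * ((η 0 : ℂ) ^ 2 + (η 1 : ℂ) ^ 2) =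
      M.mu * ((η 0 : ℂ) ^ 2 + (η 1 : ℂ) ^ 2 + beta M.k₂ η ^ 2) := by
  have h1 := hM.mu_mul.trans hM.lam_mul.symm
  rw [beta_sq, beta_sq]
  linear_combination h1

/-- The link between (H) and the Rayleigh function. The factor η₁ comes from the basis: ν² and ν³
become parallel at η₁ = 0. -/
lemma Delta_eq (hM : M.IsRegular) (ξ : Space3) (η : Plane2) :
    M.Delta ξ η = Complex.I * M.mu ^ 3 * (η 0 : ℂ) * beta M.k₂ η * M.rayleighFn η *
      (M.expFactor ξ η 0 * M.expFactor ξ η 1 * M.expFactor ξ η 2) := by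
  have hN := hM.normal_symbol η
  rw [Delta, N, rayleighFn_eq]
  simp only [Matrix.det_fin_three, Matrix.of_apply, Matrix.cons_val_zero, Matrix.cons_val_one,
    Matrix.cons_val, betas]
  linear_combination (-Complex.I * M.mu ^ 2 * (η 0 : ℂ) * beta M.k₂ η *
    ((η 0 : ℂ) ^ 2 + (η 1 : ℂ) ^ 2 + beta M.k₂ η ^ 2) *
      (M.expFactor ξ η 0 * M.expFactor ξ η 1 * M.expFactor ξ η 2)) * hN

/-- The Rayleigh function is radial, so a zero can be rotated onto the η₁-axis, where (H) forces it
to be the origin. At the origin the value is -k₂⁴ ≠ 0. -/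
lemma rayleighFn_ne_zero (hM : M.IsRegular)
    (H : ∀ ξ ∈ halfSpace, ∀ η : Plane2, M.Delta ξ η = 0 → η 0 = 0) (η : Plane2) :
    M.rayleighFn η ≠ 0 := by
  intro h
  set η' : Plane2 := EuclideanSpace.single 0 ‖η‖ with hη'
  have hn : ‖η'‖ = ‖η‖ := by simp [hη']
  have h' : M.rayleighFn η' = 0 := by
    rw [← h]
    simp only [rayleighFn, rayleigh, decayExp, hn]
  have h0 := H (EuclideanSpace.single 2 (-1)) (by simp [halfSpace]) η' (by
    rw [Delta_eq hM, h', mul_zero, zero_mul])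
  have h1 : ‖η‖ = 0 := by simpa [hη'] using h0
  rw [rayleighFn, rayleigh, decayExp_sq, h1] at h
  simp at h
  exact hM.decay₂.ne_zero (by simpa using h)

/-- The uniform lower bound combines the bound 1 outside a disc with the positive minimum of the
continuous function |R| on the disc. -/
lemma isGoodSet_univ (hM : M.IsRegular) (h₁ : -M.k₁ ^ 2 ∈ Complex.slitPlane)
    (h₂ : -M.k₂ ^ 2 ∈ Complex.slitPlane)
    (H : ∀ ξ ∈ halfSpace, ∀ η : Plane2, M.Delta ξ η = 0 → η 0 = 0) :
    M.IsGoodSet Set.univ := by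
  have a₁ := avoidsBranch_univ h₁
  have a₂ := avoidsBranch_univ h₂
  refine ⟨isOpen_univ, a₁, a₂, ?_, by simp⟩
  obtain ⟨R₀, hR₀, hb⟩ := exists_one_le_norm_rayleigh hM.neg_sq_ne
  have hc : Continuous fun η => ‖M.rayleighFn η‖ := by
    refine Continuous.norm (continuous_iff_continuousAt.2 fun η => ?_)
    exact ((symbolOn_rayleigh a₁ a₂).differentiableAt (Set.mem_univ η)).continuousAt
  obtain ⟨η₀, -, hmin⟩ := (isCompact_closedBall (0 : Plane2) R₀).exists_isMinOn
    ⟨0, by simp [hR₀.le]⟩ hc.continuousOn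
  have hpos : 0 < ‖M.rayleighFn η₀‖ := norm_pos_iff.2 (rayleighFn_ne_zero hM H η₀)
  refine ⟨min 1 ‖M.rayleighFn η₀‖, lt_min one_pos hpos, fun η _ => ?_⟩
  rcases lt_or_ge R₀ ‖η‖ with h | h
  · exact (min_le_left _ _).trans (hb η h)
  · exact (min_le_right _ _).trans (hmin (by simpa using h))

/-! ### The amplitudes of the correction term -/

/-- The amplitude of the pressure mode in the correction term. -/
def downAmp (M : ZenerMedium) (ξ : Space3) (m : Fin 3) (η : Plane2) : ℂ :=
  (((η 0 : ℂ) ^ 2 + (η 1 : ℂ) ^ 2 + beta M.k₂ η ^ 2) * M.Q ξ η 2 m +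
    2 * Complex.I * beta M.k₂ η * ((η 0 : ℂ) * M.Q ξ η 0 m + (η 1 : ℂ) * M.Q ξ η 1 m)) *
    (-Complex.I * (M.mu : ℂ)⁻¹ * (M.rayleighFn η)⁻¹)

/-- The vertical amplitude of the shear mode in the correction term. -/
def downVert (M : ZenerMedium) (ξ : Space3) (m : Fin 3) (η : Plane2) : ℂ :=
  (Complex.I * ((η 0 : ℂ) ^ 2 + (η 1 : ℂ) ^ 2 + beta M.k₂ η ^ 2) *
    ((η 0 : ℂ) * M.Q ξ η 0 m + (η 1 : ℂ) * M.Q ξ η 1 m) +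
    2 * beta M.k₁ η * ((η 0 : ℂ) ^ 2 + (η 1 : ℂ) ^ 2) * M.Q ξ η 2 m) *
    (-(M.mu : ℂ)⁻¹ * (M.rayleighFn η)⁻¹)

/-- A horizontal amplitude of the shear mode in the correction term; `e` is the component of the
wave vector and `q` that of the traction. -/
def downHoriz (M : ZenerMedium) (ξ : Space3) (m : Fin 3) (e q : Plane2 → ℂ) (η : Plane2) : ℂ :=
  (-q η + 2 * M.mu * beta M.k₁ η * e η * M.downAmp ξ m η -
    Complex.I * M.mu * e η * M.downVert ξ m η) * ((M.mu : ℂ)⁻¹ * (beta M.k₂ η)⁻¹)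

/-- Vector amplitudes of the pressure modes in the correction term. -/
def downP (M : ZenerMedium) (ξ : Space3) (m j : Fin 3) (η : Plane2) : ℂ :=
  Complex.I * modeGrad (beta M.k₁) j η * M.downAmp ξ m η

/-- Vector amplitudes of the shear modes in the correction term. -/
def downS (M : ZenerMedium) (ξ : Space3) (m : Fin 3) : Fin 3 → Plane2 → ℂ :=
  ![M.downHoriz ξ m (fun η => (η 0 : ℂ)) fun η => M.Q ξ η 0 m,
    M.downHoriz ξ m (fun η => (η 1 : ℂ)) fun η => M.Q ξ η 1 m, M.downVert ξ m]

section Symbols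

variable {S : Set Plane2} {ξ : Space3}

lemma symbolOn_beta {k : ℂ} (hS : AvoidsBranch (-k ^ 2) S) : SymbolOn S 0 (beta k) :=
  hS.symbolOn_decayExp.congr fun η => (beta_eq_decayExp k η).symm

lemma symbolOn_inv_beta {k : ℂ} (hS : AvoidsBranch (-k ^ 2) S) :
    SymbolOn S 0 fun η => (beta k η)⁻¹ :=
  hS.symbolOn_inv_decayExp.congr fun η => by rw [beta_eq_decayExp]

lemma symbolOn_modeGrad {b : Plane2 → ℂ} (hb : SymbolOn S 0 b) (i : Fin 3) :
    SymbolOn S 0 (modeGrad b i) := by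
  fin_cases i
  · exact (SymbolOn.coord S 0).const_mul _
  · exact (SymbolOn.coord S 1).const_mul _
  · exact hb

lemma symbolOn_sourceFactor {k : ℂ} (hS : AvoidsBranch (-k ^ 2) S) (hξ : ξ 2 ≤ 0) :
    SymbolOn S (-ξ 2) (sourceFactor k ξ) := by
  refine (hS.symbolOn_inv_decayExp.mul_left (hS.symbolOn_exp hξ)).congr fun η => ?_
  rw [sourceFactor, beta_eq_decayExp]
  ring

lemma IsGoodSet.symbolOn_Q (hS : M.IsGoodSet S) (hξ : ξ 2 ≤ 0) (j m : Fin 3) :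
    SymbolOn S (-ξ 2) fun η => M.Q ξ η j m := by
  have b₁ := symbolOn_beta hS.avoids₁
  have b₂ := symbolOn_beta hS.avoids₂
  have g₁ := fun i => symbolOn_modeGrad b₁.neg i
  have g₂ := fun i => symbolOn_modeGrad b₂.neg i
  have u₁ : ∀ k, SymbolOn S (-ξ 2) (M.upP ξ m k) := fun k =>
    (((g₁ k).mul_left (g₁ m)).mul_left (symbolOn_sourceFactor hS.avoids₁ hξ)).const_mul _
  have u₂ : ∀ k, SymbolOn S (-ξ 2) (M.upS ξ m k) := fun k =>
    ((((g₂ k).mul_left (g₂ m)).add (SymbolOn.const S _)).mul_left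
      (symbolOn_sourceFactor hS.avoids₂ hξ)).const_mul _
  refine ((SymbolOn.sum Finset.univ fun k _ => SymbolOn.sum Finset.univ fun l _ =>
    ((g₁ l).mul_left (u₁ k)).const_mul (M.C 2 j k l)).add (SymbolOn.sum Finset.univ fun k _ =>
      SymbolOn.sum Finset.univ fun l _ => ((g₂ l).mul_left (u₂ k)).const_mul (M.C 2 j k l))).congr fun η => ?_
  exact (Q_eq ξ η j m).symm

lemma IsGoodSet.symbolOn_inv_rayleigh (hS : M.IsGoodSet S) :
    SymbolOn S 0 fun η => (M.rayleighFn η)⁻¹ := by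
  obtain ⟨δ, hδ, hb⟩ := hS.exists_le_rayleigh
  exact (symbolOn_rayleigh hS.avoids₁ hS.avoids₂).inv hδ hb

lemma IsGoodSet.symbolOn_sum_sq (hS : M.IsGoodSet S) :
    SymbolOn S 0 fun η => (η 0 : ℂ) ^ 2 + (η 1 : ℂ) ^ 2 + beta M.k₂ η ^ 2 := by
  have b₂ := symbolOn_beta hS.avoids₂
  refine ((symbolOn_norm_sq S).add (b₂.mul_left b₂)).congr fun η => ?_
  rw [norm_sq_plane]
  push_cast
  ring

lemma IsGoodSet.symbolOn_downAmp (hS : M.IsGoodSet S) (hξ : ξ 2 ≤ 0) (m : Fin 3) :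
    SymbolOn S (-ξ 2) (M.downAmp ξ m) := by
  have q := fun j => hS.symbolOn_Q hξ j m
  have b₂ := symbolOn_beta hS.avoids₂
  have e := ((SymbolOn.coord S 0).mul_left (q 0)).add ((SymbolOn.coord S 1).mul_left (q 1))
  refine ((hS.symbolOn_inv_rayleigh.const_mul (-Complex.I * (M.mu : ℂ)⁻¹)).mul_left
    ((hS.symbolOn_sum_sq.mul_left (q 2)).add
      ((b₂.const_mul (2 * Complex.I)).mul_left e))).congr fun η => ?_
  rw [downAmp]
  ring

lemma IsGoodSet.symbolOn_downVert (hS : M.IsGoodSet S) (hξ : ξ 2 ≤ 0) (m : Fin 3) :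
    SymbolOn S (-ξ 2) (M.downVert ξ m) := by
  have q := fun j => hS.symbolOn_Q hξ j m
  have b₁ := symbolOn_beta hS.avoids₁
  have e := ((SymbolOn.coord S 0).mul_left (q 0)).add ((SymbolOn.coord S 1).mul_left (q 1))
  refine ((hS.symbolOn_inv_rayleigh.const_mul (-(M.mu : ℂ)⁻¹)).mul_left
    (((hS.symbolOn_sum_sq.const_mul Complex.I).mul_left e).add
      (((b₁.const_mul 2).mul_left (symbolOn_norm_sq S)).mul_left (q 2)))).congr fun η => ?_
  rw [downVert, norm_sq_plane]
  push_cast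
  ring

lemma IsGoodSet.symbolOn_downHoriz (hS : M.IsGoodSet S) (hξ : ξ 2 ≤ 0) (m : Fin 3)
    {e q : Plane2 → ℂ} (he : SymbolOn S 0 e) (hq : SymbolOn S (-ξ 2) q) :
    SymbolOn S (-ξ 2) (M.downHoriz ξ m e q) := by
  have b₁ := symbolOn_beta hS.avoids₁
  refine (((symbolOn_inv_beta hS.avoids₂).const_mul (M.mu : ℂ)⁻¹).mul_left
    ((hq.neg.add (((b₁.const_mul (2 * M.mu)).mul_left he).mul_left
      (hS.symbolOn_downAmp hξ m))).sub ((he.const_mul (Complex.I * M.mu)).mul_left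
        (hS.symbolOn_downVert hξ m)))).congr fun η => ?_
  rw [downHoriz]
  ring

lemma IsGoodSet.symbolOn_downP (hS : M.IsGoodSet S) (hξ : ξ 2 ≤ 0) (m j : Fin 3) :
    SymbolOn S (-ξ 2) (M.downP ξ m j) :=
  ((symbolOn_modeGrad (symbolOn_beta hS.avoids₁) j).const_mul _).mul_left
    (hS.symbolOn_downAmp hξ m)

lemma IsGoodSet.symbolOn_downS (hS : M.IsGoodSet S) (hξ : ξ 2 ≤ 0) (m j : Fin 3) :
    SymbolOn S (-ξ 2) (M.downS ξ m j) := by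
  fin_cases j
  · exact hS.symbolOn_downHoriz hξ m (SymbolOn.coord S 0) (hS.symbolOn_Q hξ 0 m)
  · exact hS.symbolOn_downHoriz hξ m (SymbolOn.coord S 1) (hS.symbolOn_Q hξ 1 m)
  · exact hS.symbolOn_downVert hξ m

lemma IsGoodSet.beta_ne_zero (hS : M.IsGoodSet S) {η : Plane2} (hη : η ∈ S) :
    beta M.k₂ η ≠ 0 := by
  rw [beta_eq_decayExp]
  exact hS.avoids₂.ne_zero hη

lemma IsGoodSet.rayleighFn_ne_zero (hS : M.IsGoodSet S) {η : Plane2} (hη : η ∈ S) :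
    M.rayleighFn η ≠ 0 := by
  obtain ⟨δ, hδ, hb⟩ := hS.exists_le_rayleigh
  exact norm_pos_iff.1 (hδ.trans_le (hb η hη))

end Symbols

end ZenerMedium

/-! ### The linear system for vanishing traction -/

namespace ZenerMedium

variable {M : ZenerMedium} {S : Set Plane2} {ξ : Space3} {η : Plane2}

lemma traction_symbol (M : ZenerMedium) (d a : Fin 3 → ℂ) (j : Fin 3) :
    ∑ k, ∑ l, M.C 2 j k l * (d l * a k) =
      M.lam * kron 2 j * (d 0 * a 0 + d 1 * a 1 + d 2 * a 2) + M.mu * (d j * a 2 + d 2 * a j) := by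
  fin_cases j <;> simp [C, kron, Fin.sum_univ_three] <;> ring

lemma sum_modeGrad_beta_sq (k : ℂ) (η : Plane2) :
    modeGrad (beta k) 0 η ^ 2 + modeGrad (beta k) 1 η ^ 2 + modeGrad (beta k) 2 η ^ 2 = -k ^ 2 := by
  simp only [modeGrad, Matrix.cons_val_zero, Matrix.cons_val_one, Matrix.cons_val, mul_pow,
    Complex.I_sq, beta_sq]
  ring

/-- The amplitudes balance the horizontal divergence of the traction. -/
lemma down_balance_horizontal (hM : M.IsRegular) (hS : M.IsGoodSet S) (hη : η ∈ S) (m : Fin 3) :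
    -2 * M.mu * ((η 0 : ℂ) ^ 2 + (η 1 : ℂ) ^ 2) * beta M.k₁ η * M.downAmp ξ m η +
      Complex.I * M.mu * ((η 0 : ℂ) ^ 2 + (η 1 : ℂ) ^ 2 + beta M.k₂ η ^ 2) * M.downVert ξ m η =
      -((η 0 : ℂ) * M.Q ξ η 0 m + (η 1 : ℂ) * M.Q ξ η 1 m) := by
  have hr := hS.rayleighFn_ne_zero hη
  have hμ : (M.mu : ℂ) ≠ 0 := by exact_mod_cast hM.mu_pos.ne'
  have hR := rayleighFn_eq (M := M) η
  rw [downAmp, downVert]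
  field_simp
  rw [hR]
  ring_nf
  simp only [Complex.I_sq]
  ring

/-- The amplitudes balance the normal traction. -/
lemma down_balance_vertical (hM : M.IsRegular) (hS : M.IsGoodSet S) (hη : η ∈ S) (m : Fin 3) :
    Complex.I * M.mu * ((η 0 : ℂ) ^ 2 + (η 1 : ℂ) ^ 2 + beta M.k₂ η ^ 2) * M.downAmp ξ m η +
      2 * M.mu * beta M.k₂ η * M.downVert ξ m η = -M.Q ξ η 2 m := by
  have hr := hS.rayleighFn_ne_zero hη
  have hμ : (M.mu : ℂ) ≠ 0 := by exact_mod_cast hM.mu_pos.ne'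
  have hR := rayleighFn_eq (M := M) η
  rw [downAmp, downVert]
  field_simp
  rw [hR]
  ring_nf
  simp only [Complex.I_sq, Complex.I_pow_three]
  ring

lemma mul_downHoriz (hM : M.IsRegular) (hS : M.IsGoodSet S) (hη : η ∈ S) (m : Fin 3)
    (e q : Plane2 → ℂ) : M.mu * beta M.k₂ η * M.downHoriz ξ m e q η =
      -q η + 2 * M.mu * beta M.k₁ η * e η * M.downAmp ξ m η -
        Complex.I * M.mu * e η * M.downVert ξ m η := by
  have hb := hS.beta_ne_zero hη
  have hμ : (M.mu : ℂ) ≠ 0 := by exact_mod_cast hM.mu_pos.ne'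
  rw [downHoriz]
  field_simp

/-- The horizontal shear components are chosen to satisfy the tangential boundary conditions.
Inserted into the divergence, they turn transversality into the horizontal balance, which `downAmp`
and `downVert` solve. -/
lemma downS_transverse (hM : M.IsRegular) (hS : M.IsGoodSet S) (hη : η ∈ S) (m : Fin 3) :
    modeGrad (beta M.k₂) 0 η * M.downS ξ m 0 η + modeGrad (beta M.k₂) 1 η * M.downS ξ m 1 η +
      modeGrad (beta M.k₂) 2 η * M.downS ξ m 2 η = 0 := by
  have hb := hS.beta_ne_zero hη
  have hμ : (M.mu : ℂ) ≠ 0 := by exact_mod_cast hM.mu_pos.ne'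
  have h := down_balance_horizontal (ξ := ξ) hM hS hη m
  have h0 := mul_downHoriz (ξ := ξ) hM hS hη m (fun η => (η 0 : ℂ)) fun η => M.Q ξ η 0 m
  have h1 := mul_downHoriz (ξ := ξ) hM hS hη m (fun η => (η 1 : ℂ)) fun η => M.Q ξ η 1 m
  simp only [modeGrad, downS, Matrix.cons_val_zero, Matrix.cons_val_one, Matrix.cons_val]
  refine mul_left_cancel₀ (mul_ne_zero hμ hb) ?_
  linear_combination Complex.I * (η 0 : ℂ) * h0 + Complex.I * (η 1 : ℂ) * h1 - Complex.I * h +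
    M.mu * beta M.k₂ η ^ 2 * M.downVert ξ m η * Complex.I_sq

lemma isNavierSymbol_downP (hM : M.IsRegular) (T : Set Plane2) (ξ : Space3) (m : Fin 3) :
    M.IsNavierSymbol T (beta M.k₁) (M.downP ξ m) := by
  intro j η _
  have h := sum_modeGrad_beta_sq M.k₁ η
  have h2 := hM.lam_mul
  simp only [downP, Fin.sum_univ_three]
  linear_combination (Complex.I * modeGrad (beta M.k₁) j η * M.downAmp ξ m η) *
    ((M.lam + 2 * M.mu) * h - h2)

lemma isNavierSymbol_downS (hM : M.IsRegular) (hS : M.IsGoodSet S) (ξ : Space3) (m : Fin 3) :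
    M.IsNavierSymbol S (beta M.k₂) (M.downS ξ m) := by
  intro j η hη
  have h := sum_modeGrad_beta_sq M.k₂ η
  have h2 := hM.mu_mul
  have h3 := downS_transverse (ξ := ξ) hM hS hη m
  simp only [Fin.sum_univ_three]
  linear_combination M.downS ξ m j η * (M.mu * h - h2) +
    (M.lam + M.mu) * modeGrad (beta M.k₂) j η * h3

/-- Since the shear amplitude is transverse, its λ-term vanishes. The tangential components then
hold by the choice of `downHoriz`, and the normal one is the vertical balance. -/
lemma traction_down (hM : M.IsRegular) (hS : M.IsGoodSet S) (hη : η ∈ S) (m j : Fin 3) :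
    (∑ k, ∑ l, M.C 2 j k l * (modeGrad (beta M.k₁) l η * M.downP ξ m k η)) +
      ∑ k, ∑ l, M.C 2 j k l * (modeGrad (beta M.k₂) l η * M.downS ξ m k η) = -M.Q ξ η j m := by
  rw [traction_symbol M (fun l => modeGrad (beta M.k₁) l η) (fun k => M.downP ξ m k η),
    traction_symbol M (fun l => modeGrad (beta M.k₂) l η) (fun k => M.downS ξ m k η)]
  simp only [downS_transverse hM hS hη m]
  have h0 := mul_downHoriz (ξ := ξ) hM hS hη m (fun η => (η 0 : ℂ)) fun η => M.Q ξ η 0 m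
  have h1 := mul_downHoriz (ξ := ξ) hM hS hη m (fun η => (η 1 : ℂ)) fun η => M.Q ξ η 1 m
  have h2 := down_balance_vertical (ξ := ξ) hM hS hη m
  have hN := hM.normal_symbol η
  have hI := Complex.I_sq
  fin_cases j
  · simp [downP, downS, modeGrad, kron]
    linear_combination h0 + 2 * M.mu * (η 0 : ℂ) * beta M.k₁ η * M.downAmp ξ m η * hI
  · simp [downP, downS, modeGrad, kron]
    linear_combination h1 + 2 * M.mu * (η 1 : ℂ) * beta M.k₁ η * M.downAmp ξ m η * hI
  · simp [downP, downS, modeGrad, kron]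
    linear_combination h2 + Complex.I * M.downAmp ξ m η * hN + M.lam * M.downAmp ξ m η *
      Complex.I * ((η 0 : ℂ) ^ 2 + (η 1 : ℂ) ^ 2) * hI

/-- Off the line `η₁ = 0` the solution by Cramer's rule gives the same amplitudes. -/
lemma coeff_eq_down (hM : M.IsRegular) (hS : M.IsGoodSet S) (hη : η ∈ S)
    (hΔ : M.Delta ξ η ≠ 0) (m j : Fin 3) :
    M.coeff ξ η 0 m * M.nu η 0 j * M.expFactor ξ η 0 = M.downP ξ m j η ∧
    M.coeff ξ η 1 m * M.nu η 1 j * M.expFactor ξ η 1 +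
      M.coeff ξ η 2 m * M.nu η 2 j * M.expFactor ξ η 2 = M.downS ξ m j η := by
  have hr := hS.rayleighFn_ne_zero hη
  have hb := hS.beta_ne_zero hη
  have hμ : (M.mu : ℂ) ≠ 0 := by exact_mod_cast hM.mu_pos.ne'
  have hR := rayleighFn_eq (M := M) η
  have hN := hM.normal_symbol η
  have hI := Complex.I_sq
  -- Cramer's rule: `coeff` really solves the linear system where Δ ≠ 0.
  have hC : (M.N ξ η).mulVec (fun n => M.coeff ξ η n m) = fun j => -M.Q ξ η j m := by
    have e : (fun n => M.coeff ξ η n m) =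
        (M.Delta ξ η)⁻¹ • (M.N ξ η).cramer (fun j => -M.Q ξ η j m) := by
      ext n
      simp only [coeff, Pi.smul_apply, Matrix.cramer_apply, smul_eq_mul]
      ring
    rw [e, Matrix.mulVec_smul, Matrix.mulVec_cramer, smul_smul, ← Delta, inv_mul_cancel₀ hΔ,
      one_smul]
  have r0 := congrFun hC 0
  have r1 := congrFun hC 1
  have r2 := congrFun hC 2
  simp only [Matrix.mulVec, dotProduct, Fin.sum_univ_three, N, Matrix.of_apply,
    Matrix.cons_val_zero, Matrix.cons_val_one, Matrix.cons_val, betas] at r0 r1 r2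
  set A := M.coeff ξ η 0 m * M.expFactor ξ η 0 with hA
  set B := M.coeff ξ η 1 m * M.expFactor ξ η 1 with hB
  set D := M.coeff ξ η 2 m * M.expFactor ξ η 2 with hD
  have v0 := down_balance_horizontal (ξ := ξ) hM hS hη m
  have v1 := down_balance_vertical (ξ := ξ) hM hS hη m
  -- Weighting the tangential rows by η₁ and η₂ eliminates the coefficient of ν³. The pair (A, iη₁B)
  -- then satisfies the same 2×2 system as `downAmp` and `downVert`.
  have w0 : -2 * M.mu * ((η 0 : ℂ) ^ 2 + (η 1 : ℂ) ^ 2) * beta M.k₁ η * A +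
      Complex.I * M.mu * ((η 0 : ℂ) ^ 2 + (η 1 : ℂ) ^ 2 + beta M.k₂ η ^ 2) *
        (Complex.I * (η 0 : ℂ) * B) =
      -((η 0 : ℂ) * M.Q ξ η 0 m + (η 1 : ℂ) * M.Q ξ η 1 m) := by
    linear_combination (η 0 : ℂ) * r0 + (η 1 : ℂ) * r1 + M.mu * (η 0 : ℂ) * B *
      ((η 0 : ℂ) ^ 2 + (η 1 : ℂ) ^ 2 + beta M.k₂ η ^ 2) * hI
  have w1 : Complex.I * M.mu * ((η 0 : ℂ) ^ 2 + (η 1 : ℂ) ^ 2 + beta M.k₂ η ^ 2) * A +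
      2 * M.mu * beta M.k₂ η * (Complex.I * (η 0 : ℂ) * B) = -M.Q ξ η 2 m := by
    linear_combination r2 - Complex.I * A * hN
  -- Uniqueness: the two systems are subtracted and combined so that the difference is multiplied by
  -- μ times the Rayleigh function, which is nonzero.
  have hAmp : A = M.downAmp ξ m η := by
    refine mul_left_cancel₀ (mul_ne_zero hμ hr) ?_
    linear_combination (-2 * beta M.k₂ η) * (w0 - v0) + Complex.I *
      ((η 0 : ℂ) ^ 2 + (η 1 : ℂ) ^ 2 + beta M.k₂ η ^ 2) * (w1 - v1) +
      M.mu * (A - M.downAmp ξ m η) *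
      (hR - ((η 0 : ℂ) ^ 2 + (η 1 : ℂ) ^ 2 + beta M.k₂ η ^ 2) ^ 2 * hI)
  have hVert : Complex.I * (η 0 : ℂ) * B = M.downVert ξ m η := by
    refine mul_left_cancel₀ (mul_ne_zero hμ hr) ?_
    linear_combination (Complex.I * ((η 0 : ℂ) ^ 2 + (η 1 : ℂ) ^ 2 + beta M.k₂ η ^ 2)) * (w0 - v0) +
      2 * ((η 0 : ℂ) ^ 2 + (η 1 : ℂ) ^ 2) * beta M.k₁ η * (w1 - v1) +
      M.mu * (Complex.I * (η 0 : ℂ) * B - M.downVert ξ m η) *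
      (hR - ((η 0 : ℂ) ^ 2 + (η 1 : ℂ) ^ 2 + beta M.k₂ η ^ 2) ^ 2 * hI)
  have h0 := mul_downHoriz (ξ := ξ) hM hS hη m (fun η => (η 0 : ℂ)) fun η => M.Q ξ η 0 m
  have h1 := mul_downHoriz (ξ := ξ) hM hS hη m (fun η => (η 1 : ℂ)) fun η => M.Q ξ η 1 m
  rw [← hAmp, ← hVert] at h0 h1
  constructor
  · rw [downP, ← hAmp]
    fin_cases j
    · simp [nu, modeGrad]
      linear_combination -(η 0 : ℂ) * A * hI
    · simp [nu, modeGrad]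
      linear_combination -(η 1 : ℂ) * A * hI
    · simp [nu, modeGrad]
      ring
  · fin_cases j
    · simp only [nu, downS, Fin.zero_eta, Matrix.cons_val_zero, Matrix.cons_val_one,
        Matrix.cons_val]
      refine mul_left_cancel₀ (mul_ne_zero hμ hb) ?_
      rw [h0]
      linear_combination r0 + M.mu * (η 0 : ℂ) ^ 2 * B * hI
    · simp only [nu, downS, Fin.mk_one, Matrix.cons_val_zero, Matrix.cons_val_one,
        Matrix.cons_val]
      refine mul_left_cancel₀ (mul_ne_zero hμ hb) ?_
      rw [h1]
      linear_combination r1 + M.mu * (η 0 : ℂ) * (η 1 : ℂ) * B * hI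
    · simp only [nu, downS, Fin.reduceFinMk, Matrix.cons_val_zero, Matrix.cons_val_one,
        Matrix.cons_val]
      rw [← hVert]
      ring

end ZenerMedium

namespace ZenerMedium

variable {M : ZenerMedium} {S : Set Plane2} {ξ : Space3}

lemma stress_neg (v : Fin 3 → Space3 → ℂ) (i j : Fin 3) :
    M.stress (fun i y => -v i y) i j = fun x => -M.stress v i j x := by
  ext x
  simp [stress, pd, fderiv_fun_neg, Finset.sum_neg_distrib]

lemma L_neg (v : Fin 3 → Space3 → ℂ) (j : Fin 3) (x : Space3) :
    M.L (fun i y => -v i y) j x = -M.L v j x := by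
  simp only [L, stress_neg]
  simp only [pd, fderiv_fun_neg, neg_apply, Finset.sum_neg_distrib]
  ring

lemma traction_neg (v : Fin 3 → Space3 → ℂ) (j : Fin 3) (x : Space3) :
    M.traction (fun i y => -v i y) j x = -M.traction v j x := by
  simp only [traction, stress_neg]

/-! ### The correction term -/

/-- The decaying part of the correction term, with wave vectors in `S`. -/
def downField (M : ZenerMedium) (S : Set Plane2) (ξ : Space3) (m : Fin 3) :
    Fin 3 → Space3 → ℂ :=
  modePair S (beta M.k₁) (beta M.k₂) ξ (M.downP ξ m) (M.downS ξ m)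

/-- The correction term: decaying modes for the wave vectors in `S`, and the negative of the
fundamental solution's modes for the others. -/
def correction (M : ZenerMedium) (S : Set Plane2) (ξ x : Space3) (j m : Fin 3) : ℂ :=
  M.downField S ξ m j x + -M.upField Sᶜ ξ m j x

section Down

variable {x : Space3}

lemma IsGoodSet.modeCoeff_downP (hS : M.IsGoodSet S) (hξ : ξ 2 < 0) (m j : Fin 3) :
    ModeCoeff S (-ξ 2) (M.downP ξ m j) :=
  (hS.symbolOn_downP hξ.le m j).modeCoeff hS.isOpen

lemma IsGoodSet.modeCoeff_downS (hS : M.IsGoodSet S) (hξ : ξ 2 < 0) (m j : Fin 3) :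
    ModeCoeff S (-ξ 2) (M.downS ξ m j) :=
  (hS.symbolOn_downS hξ.le m j).modeCoeff hS.isOpen

lemma IsGoodSet.contDiffAt_downField (hS : M.IsGoodSet S) (hξ : ξ 2 < 0) (hx : x 2 ≤ 0)
    (m j : Fin 3) : ContDiffAt ℝ ∞ (M.downField S ξ m j) x :=
  contDiffAt_modePair (isModeExponent_beta _ (neg_pos.2 hξ)) (isModeExponent_beta _ (neg_pos.2 hξ))
    (hS.modeCoeff_downP hξ m) (hS.modeCoeff_downS hξ m) ξ
    (show x 2 < -ξ 2 by linarith) j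

lemma IsGoodSet.L_downField (hM : M.IsRegular) (hS : M.IsGoodSet S) (hξ : ξ 2 < 0) (hx : x 2 ≤ 0)
    (m j : Fin 3) : M.L (M.downField S ξ m) j x = 0 :=
  L_modePair hS.isOpen.measurableSet (isModeExponent_beta _ (neg_pos.2 hξ))
    (isModeExponent_beta _ (neg_pos.2 hξ)) (hS.modeCoeff_downP hξ m) (hS.modeCoeff_downS hξ m) ξ
    (show x 2 < -ξ 2 by linarith) (isNavierSymbol_downP hM S ξ m) (isNavierSymbol_downS hM hS ξ m) j

lemma IsGoodSet.traction_downField (hM : M.IsRegular) (hS : M.IsGoodSet S) (hξ : ξ 2 < 0)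
    (hx : x 2 = 0) (m j : Fin 3) :
    M.traction (M.downField S ξ m) j x = -∫ η in S, M.Q ξ η j m * planeWave η ξ x := by
  have h := (traction_modePair (M := M) (isModeExponent_beta M.k₁ (neg_pos.2 hξ))
    (isModeExponent_beta M.k₂ (neg_pos.2 hξ)) (hS.modeCoeff_downP hξ m) (hS.modeCoeff_downS hξ m) ξ
    (show x 2 < -ξ 2 by linarith) hx j).2
  rw [downField, h, ← integral_neg]
  refine setIntegral_congr_fun hS.isOpen.measurableSet fun η hη => ?_
  simp only [traction_down hM hS hη m j]
  ring

end Down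

section Up

variable {x : Space3} {T : Set Plane2} {h : ℝ}

lemma contDiffAt_upField (hh : 0 < h) {m : Fin 3} (hP : ∀ j, ModeCoeff T h (M.upP ξ m j))
    (hS : ∀ j, ModeCoeff T h (M.upS ξ m j)) (hx : -h < x 2) (j : Fin 3) :
    ContDiffAt ℝ ∞ (M.upField T ξ m j) x :=
  contDiffAt_modePair (isModeExponent_neg_beta _ hh) (isModeExponent_neg_beta _ hh) hP hS ξ hx j

lemma L_upField (hM : M.IsRegular) (hT : MeasurableSet T) (hh : 0 < h) {m : Fin 3}
    (hP : ∀ j, ModeCoeff T h (M.upP ξ m j))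
    (hS : ∀ j, ModeCoeff T h (M.upS ξ m j)) (hx : -h < x 2) (j : Fin 3) :
    M.L (M.upField T ξ m) j x = 0 :=
  L_modePair hT (isModeExponent_neg_beta _ hh) (isModeExponent_neg_beta _ hh) hP hS ξ hx
    (isNavierSymbol_upP hM T ξ m) (isNavierSymbol_upS hM T ξ m) j

lemma traction_upField (hh : 0 < h) {m : Fin 3} (hP : ∀ j, ModeCoeff T h (M.upP ξ m j))
    (hS : ∀ j, ModeCoeff T h (M.upS ξ m j)) (hx : x 2 = 0) (j : Fin 3) :
    IntegrableOn (fun η => M.Q ξ η j m * planeWave η ξ x) T ∧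
    M.traction (M.upField T ξ m) j x = ∫ η in T, M.Q ξ η j m * planeWave η ξ x := by
  simp only [Q_eq]
  exact traction_modePair (isModeExponent_neg_beta _ hh) (isModeExponent_neg_beta _ hh) hP hS ξ
    (show -h < x 2 by linarith) hx j

end Up

section Correction

variable {x : Space3}

/-- On a bounded set of wave vectors every exponential rate is admissible, so the upgoing modes form
a smooth field on all of space, including the source and the region below it. -/
lemma IsGoodSet.modeCoeff_upP_compl (hM : M.IsRegular) (hS : M.IsGoodSet S) (hξ : ξ 2 < 0) (h : ℝ)
    (m j : Fin 3) : ModeCoeff Sᶜ h (M.upP ξ m j) :=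
  ((modeCoeff_upP hM hξ.le m j).mono (Set.subset_univ _)).of_isBounded hS.isBounded_compl h

lemma IsGoodSet.modeCoeff_upS_compl (hM : M.IsRegular) (hS : M.IsGoodSet S) (hξ : ξ 2 < 0) (h : ℝ)
    (m j : Fin 3) : ModeCoeff Sᶜ h (M.upS ξ m j) :=
  ((modeCoeff_upS hM hξ.le m j).mono (Set.subset_univ _)).of_isBounded hS.isBounded_compl h

lemma neg_abs_add_one_lt (a : ℝ) : -(|a| + 1) < a := by linarith [neg_abs_le a]

lemma IsGoodSet.contDiffAt_upField_compl (hM : M.IsRegular) (hS : M.IsGoodSet S) (hξ : ξ 2 < 0)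
    (x : Space3) (m j : Fin 3) : ContDiffAt ℝ ∞ (M.upField Sᶜ ξ m j) x :=
  contDiffAt_upField (h := |x 2| + 1) (by positivity) (hS.modeCoeff_upP_compl hM hξ _ m)
    (hS.modeCoeff_upS_compl hM hξ _ m) (neg_abs_add_one_lt _) j

lemma IsGoodSet.contDiffAt_correction (hM : M.IsRegular) (hS : M.IsGoodSet S) (hξ : ξ 2 < 0)
    (hx : x 2 ≤ 0) (j m : Fin 3) : ContDiffAt ℝ ∞ (fun y => M.correction S ξ y j m) x :=
  (hS.contDiffAt_downField hξ hx m j).add (hS.contDiffAt_upField_compl hM hξ x m j).neg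

lemma IsGoodSet.L_correction (hM : M.IsRegular) (hS : M.IsGoodSet S) (hξ : ξ 2 < 0)
    (hx : x 2 ≤ 0) (j m : Fin 3) : M.L (fun i y => M.correction S ξ y i m) j x = 0 := by
  have := L_add (M := M) (fun i => hS.contDiffAt_downField hξ hx m i)
    (fun i => (hS.contDiffAt_upField_compl hM hξ x m i).neg) j
  have e := L_neg (M := M) (M.upField Sᶜ ξ m) j x
  rw [L_upField hM hS.isOpen.measurableSet.compl (h := |x 2| + 1) (by positivity)
    (hS.modeCoeff_upP_compl hM hξ _ m)
    (hS.modeCoeff_upS_compl hM hξ _ m) (neg_abs_add_one_lt _) j, neg_zero] at e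
  rw [hS.L_downField hM hξ hx, zero_add] at this
  exact this.trans e

/-- Near the boundary u* is its upgoing field, with traction ∫Q over the whole plane. The correction
contributes -∫_S Q from the solved modes and -∫_{Sᶜ} Q from the negated ones. -/
lemma IsGoodSet.traction_uStar_add_correction (hM : M.IsRegular) (hS : M.IsGoodSet S)
    (hξ : ξ 2 < 0) (hx : x 2 = 0) (j m : Fin 3) :
    M.traction (fun i y => M.uStar ξ y i m + M.correction S ξ y i m) j x = 0 := by
  have hh : 0 < -ξ 2 := neg_pos.2 hξ
  have hne : x ≠ ξ := fun e => by rw [e] at hx; linarith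
  have hu : ∀ i, (fun y => M.uStar ξ y i m) =ᶠ[𝓝 x] M.upField Set.univ ξ m i := by
    intro i
    filter_upwards [(isOpen_lt continuous_const (continuous_coord 2)).mem_nhds
      (show ξ 2 < x 2 by linarith)] with y hy
    exact uStar_eq_upField hM hξ hy i m
  have e1 := traction_add (M := M) (fun i => (contDiffAt_uStar (M := M) hne i m).differentiableAt_infty)
    (fun i => (hS.contDiffAt_correction hM hξ hx.le i m).differentiableAt_infty) j
  have e2 := traction_add (M := M)
    (fun i => (hS.contDiffAt_downField hξ hx.le m i).differentiableAt_infty)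
    (fun i => (hS.contDiffAt_upField_compl hM hξ x m i).neg.differentiableAt_infty) j
  have e3 := traction_neg (M := M) (M.upField Sᶜ ξ m) j x
  obtain ⟨hi, e4⟩ := traction_upField (T := Set.univ) hh (modeCoeff_upP hM hξ.le m)
    (modeCoeff_upS hM hξ.le m) hx j
  have e5 := (traction_upField (T := Sᶜ) hh (hS.modeCoeff_upP_compl hM hξ _ m)
    (hS.modeCoeff_upS_compl hM hξ _ m) hx j).2
  rw [integrableOn_univ] at hi
  have e6 := integral_add_compl hS.isOpen.measurableSet hi
  rw [setIntegral_univ] at e4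
  change M.traction (fun i y => M.correction S ξ y i m) j x = _ at e2
  rw [hS.traction_downField hM hξ hx, e3, e5] at e2
  rw [e1, traction_congr hu, e4, e2, ← e6]
  ring

/-- A smooth solution of the homogeneous equation pairs to zero with `L ψ`. -/
lemma integral_sum_mul_L_eq_zero {w ψ : Fin 3 → Space3 → ℂ} (hψ : ∀ j, ContDiff ℝ ∞ (ψ j))
    (hc : ∀ j, HasCompactSupport (ψ j))
    (hw : ∀ i j, ∀ x ∈ tsupport (ψ i), ContDiffAt ℝ ∞ (w j) x)
    (h0 : ∀ j, ∀ x ∈ tsupport (ψ j), M.L w j x = 0) :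
    Integrable (fun x => ∑ j, w j x * M.L ψ j x) ∧ ∫ x, ∑ j, w j x * M.L ψ j x = 0 := by
  have a2 : ∀ i j a b, Integrable fun x => w j x * pd a (pd b (ψ i)) x := fun i j a b =>
    integrable_mul_of_continuousOn_tsupport (((hψ i).pd_infty b).pd_infty a).continuous
      (((hc i).pd b).pd a) fun x hx => (hw i j x (tsupport_pd_subset _ _
        (tsupport_pd_subset _ _ hx))).continuousAt.continuousWithinAt
  have a0 : ∀ i j, Integrable fun x => w j x * ψ i x := fun i j =>
    integrable_mul_of_continuousOn_tsupport (hψ i).continuous (hc i) fun x hx =>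
      (hw i j x hx).continuousAt.continuousWithinAt
  have b2 : ∀ i j a b, Integrable fun x => pd a (pd b (w j)) x * ψ i x := fun i j a b =>
    integrable_mul_of_continuousOn_tsupport (hψ i).continuous (hc i) fun x hx =>
      (((hw i j x hx).pd_infty b).pd_infty a).continuousAt.continuousWithinAt
  -- The derivatives in the divergence term are interchanged so that w_j faces ∂_i∂_jψ_i.
  -- Integrating by parts twice then gives the same sum with the derivatives on w, which is the
  -- formal symmetry of L.
  have e1 : (fun x => ∑ j, w j x * M.L ψ j x) = fun x =>
      (∑ j, ∑ i, (M.lam + M.mu : ℂ) * (w j x * pd i (pd j (ψ i)) x)) +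
      ((∑ j, ∑ i, (M.mu : ℂ) * (w j x * pd i (pd i (ψ j)) x)) +
      ∑ j, (M.rho * M.dampedSq : ℂ) * (w j x * ψ j x)) := by
    ext x
    simp only [L_eq_fun hψ, fun i j => pd_comm_fun (hψ i) i j, Fin.sum_univ_three]
    ring
  have e2 : (fun x => (∑ j, ∑ i, (M.lam + M.mu : ℂ) * (pd i (pd j (w j)) x * ψ i x)) +
      ((∑ j, ∑ i, (M.mu : ℂ) * (pd i (pd i (w j)) x * ψ j x)) +
      ∑ j, (M.rho * M.dampedSq : ℂ) * (w j x * ψ j x))) = fun _ => 0 := by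
    ext x
    have : ∀ j, ((M.lam + M.mu) * (∑ i, pd j (pd i (w i)) x) + M.mu * (∑ i, pd i (pd i (w j)) x)
      + M.rho * M.dampedSq * w j x) * ψ j x = 0 := by
      intro j
      by_cases hx : x ∈ tsupport (ψ j)
      · rw [← M.L_eq (fun i => hw j i x hx) j, h0 j x hx, zero_mul]
      · rw [image_eq_zero_of_notMem_tsupport hx, mul_zero]
    have h := Finset.sum_congr rfl fun j (_ : j ∈ Finset.univ) => this j
    simp only [Fin.sum_univ_three] at h ⊢
    linear_combination h
  have i1 : Integrable fun x => ∑ j, ∑ i, (M.lam + M.mu : ℂ) * (w j x * pd i (pd j (ψ i)) x) :=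
    integrable_finsetSum _ fun j _ => integrable_finsetSum _ fun i _ => (a2 i j i j).const_mul _
  have i2 : Integrable fun x => ∑ j, ∑ i, (M.mu : ℂ) * (w j x * pd i (pd i (ψ j)) x) :=
    integrable_finsetSum _ fun j _ => integrable_finsetSum _ fun i _ => (a2 j j i i).const_mul _
  have i3 : Integrable fun x => ∑ j, (M.rho * M.dampedSq : ℂ) * (w j x * ψ j x) :=
    integrable_finsetSum _ fun j _ => (a0 j j).const_mul _
  have k1 : Integrable fun x => ∑ j, ∑ i, (M.lam + M.mu : ℂ) * (pd i (pd j (w j)) x * ψ i x) :=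
    integrable_finsetSum _ fun j _ => integrable_finsetSum _ fun i _ => (b2 i j i j).const_mul _
  have k2 : Integrable fun x => ∑ j, ∑ i, (M.mu : ℂ) * (pd i (pd i (w j)) x * ψ j x) :=
    integrable_finsetSum _ fun j _ => integrable_finsetSum _ fun i _ => (b2 j j i i).const_mul _
  have i23 : Integrable fun x => (∑ j, ∑ i, (M.mu : ℂ) * (w j x * pd i (pd i (ψ j)) x)) +
      ∑ j, (M.rho * M.dampedSq : ℂ) * (w j x * ψ j x) := i2.add i3
  have k23 : Integrable fun x => (∑ j, ∑ i, (M.mu : ℂ) * (pd i (pd i (w j)) x * ψ j x)) +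
      ∑ j, (M.rho * M.dampedSq : ℂ) * (w j x * ψ j x) := k2.add i3
  rw [e1]
  refine ⟨i1.add i23, ?_⟩
  calc _ = ∫ x, (∑ j, ∑ i, (M.lam + M.mu : ℂ) * (pd i (pd j (w j)) x * ψ i x)) +
      ((∑ j, ∑ i, (M.mu : ℂ) * (pd i (pd i (w j)) x * ψ j x)) +
      ∑ j, (M.rho * M.dampedSq : ℂ) * (w j x * ψ j x)) := by
        rw [integral_add i1 i23, integral_add i2 i3, integral_add k1 k23,
          integral_add k2 i3]
        congr 1
        · rw [integral_finsetSum _ fun j _ => integrable_finsetSum _ fun i _ =>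
              (a2 i j i j).const_mul _, integral_finsetSum _ fun j _ =>
              integrable_finsetSum _ fun i _ => (b2 i j i j).const_mul _]
          refine Finset.sum_congr rfl fun j _ => ?_
          rw [integral_finsetSum _ fun i _ => (a2 i j i j).const_mul _,
            integral_finsetSum _ fun i _ => (b2 i j i j).const_mul _]
          refine Finset.sum_congr rfl fun i _ => ?_
          rw [integral_const_mul, integral_const_mul, integral_mul_pd_pd (hψ i) (hc i) (hw i j)]
        · congr 1
          rw [integral_finsetSum _ fun j _ => integrable_finsetSum _ fun i _ =>
              (a2 j j i i).const_mul _, integral_finsetSum _ fun j _ =>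
              integrable_finsetSum _ fun i _ => (b2 j j i i).const_mul _]
          refine Finset.sum_congr rfl fun j _ => ?_
          rw [integral_finsetSum _ fun i _ => (a2 j j i i).const_mul _,
            integral_finsetSum _ fun i _ => (b2 j j i i).const_mul _]
          refine Finset.sum_congr rfl fun i _ => ?_
          rw [integral_const_mul, integral_const_mul, integral_mul_pd_pd (hψ j) (hc j) (hw j j)]
    _ = 0 := by rw [e2, integral_zero]

lemma IsGoodSet.solvesPointForce (hM : M.IsRegular) (hS : M.IsGoodSet S) (hξ : ξ 2 < 0) :
    M.SolvesPointForce halfSpace ξ fun x j m => M.uStar ξ x j m + M.correction S ξ x j m := by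
  have ho : IsOpen halfSpace := isOpen_lt (continuous_coord 2) continuous_const
  have hsm : ∀ j m, ∀ x ∈ halfSpace, ContDiffAt ℝ ∞ (fun y => M.correction S ξ y j m) x :=
    fun j m x hx => hS.contDiffAt_correction hM hξ (le_of_lt hx) j m
  refine ⟨fun j m => ?_, fun ψ hψ m => ?_⟩
  · refine ((locallyIntegrable_uStar ξ j m).locallyIntegrableOn _).add ?_
    refine ContinuousOn.locallyIntegrableOn (fun x hx => ?_) ho.measurableSet
    exact (hsm j m x hx).continuousAt.continuousWithinAt
  · have hs : ∀ j, ContDiff ℝ ∞ (ψ j) := fun j => (hψ j).1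
    have hc : ∀ j, HasCompactSupport (ψ j) := fun j => (hψ j).2.1
    obtain ⟨hi, h0⟩ := integral_sum_mul_L_eq_zero (M := M) (w := fun j x => M.correction S ξ x j m)
      hs hc (fun i j x hx => hsm j m x ((hψ i).2.2 hx))
      (fun j x hx => hS.L_correction hM hξ (le_of_lt ((hψ j).2.2 hx)) j m)
    have hu := (hM.solvesPointForce_uStar ξ).2 ψ
      (fun j => ⟨hs j, hc j, Set.subset_univ _⟩) m
    have hui : Integrable fun x => ∑ j, M.uStar ξ x j m * M.L ψ j x :=
      integrable_finsetSum _ fun j _ => (locallyIntegrable_uStar ξ j m).integrable_mul_test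
        (contDiff_L hs j).continuous (hasCompactSupport_L hs hc j)
    simp only [add_mul, Finset.sum_add_distrib]
    rw [integral_add hui hi, hu, h0, add_zero]

end Correction

/-! ### The Fourier integrals of the viscoelastic case -/

/-- The line on which Cramer's rule breaks down is a proper subspace, so it does not affect the
Fourier integrals. -/
lemma ae_coord_ne_zero : ∀ᵐ η : Plane2, η 0 ≠ 0 := by
  have h : volume ((LinearMap.ker ((EuclideanSpace.proj 0 : Plane2 →L[ℝ] ℝ) :
      Plane2 →ₗ[ℝ] ℝ) : Submodule ℝ Plane2) : Set Plane2) = 0 := by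
    refine Measure.addHaar_submodule _ _ fun ht => ?_
    have : EuclideanSpace.single (0 : Fin 2) (1 : ℝ) ∈ (⊤ : Submodule ℝ Plane2) := trivial
    rw [← ht] at this
    simp at this
  rw [ae_iff]
  convert h using 2
  ext η
  simp

lemma correction_univ (ξ x : Space3) (j m : Fin 3) :
    M.correction Set.univ ξ x j m = M.downField Set.univ ξ m j x := by
  simp [correction, upField, modePair, modeInt]

lemma wIntegrand_ae_eq (hM : M.IsRegular) (hS : M.IsGoodSet Set.univ)
    (H : ∀ η : Plane2, M.Delta ξ η = 0 → η 0 = 0) (x : Space3) (j m : Fin 3) :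
    M.wIntegrand ξ x j m =ᵐ[volume] fun η => M.downP ξ m j η * mode (beta M.k₁) ξ η x +
      M.downS ξ m j η * mode (beta M.k₂) ξ η x := by
  filter_upwards [ae_coord_ne_zero] with η hη
  obtain ⟨h1, h2⟩ := coeff_eq_down hM hS (Set.mem_univ η) (fun h => hη (H η h)) m j
  have he : ∀ n, Complex.exp (M.betas η n * ((x 2 + ξ 2 : ℝ) : ℂ)) / M.betas η n =
      M.expFactor ξ η n * Complex.exp (M.betas η n * (x 2 : ℂ)) := by
    intro n
    rw [expFactor, div_mul_eq_mul_div, ← Complex.exp_add]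
    push_cast
    ring_nf
  rw [← h1, ← h2, wIntegrand, Fin.sum_univ_three, he, he, he]
  simp only [mode]
  have b0 : M.betas η 0 = beta M.k₁ η := rfl
  have b1 : M.betas η 1 = beta M.k₂ η := rfl
  have b2 : M.betas η 2 = beta M.k₂ η := rfl
  rw [b0, b1, b2]
  ring

lemma integrable_wIntegrand (hM : M.IsRegular) (hS : M.IsGoodSet Set.univ) (hξ : ξ 2 < 0)
    (H : ∀ η : Plane2, M.Delta ξ η = 0 → η 0 = 0) {x : Space3} (hx : x 2 ≤ 0) (j m : Fin 3) :
    Integrable (M.wIntegrand ξ x j m) ∧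
      M.correction Set.univ ξ x j m = ∫ η, M.wIntegrand ξ x j m η := by
  have hh : 0 < -ξ 2 := neg_pos.2 hξ
  have i1 := (hS.modeCoeff_downP hξ m j).integrable_mode (isModeExponent_beta M.k₁ hh) ξ
    (show x 2 < -ξ 2 by linarith)
  have i2 := (hS.modeCoeff_downS hξ m j).integrable_mode (isModeExponent_beta M.k₂ hh) ξ
    (show x 2 < -ξ 2 by linarith)
  rw [integrableOn_univ] at i1 i2
  have e := wIntegrand_ae_eq hM hS H x j m
  refine ⟨(i1.add i2).congr e.symm, ?_⟩
  rw [integral_congr_ae e, integral_add i1 i2, correction_univ, downField, modePair, modeInt,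
    modeInt, setIntegral_univ, setIntegral_univ]

end ZenerMedium

/-! ### Decay of spherical waves in an absorbing medium -/

/-- The algebra of functions generated by the constants, the coordinates and `1 / r`. -/
inductive WaveAlgebra (ξ : Space3) : (Space3 → ℂ) → Prop
  | const (c : ℂ) : WaveAlgebra ξ fun _ => c
  | coord (i : Fin 3) : WaveAlgebra ξ fun y => ((y i - ξ i : ℝ) : ℂ)
  | inv : WaveAlgebra ξ fun y => ((‖y - ξ‖ : ℝ) : ℂ)⁻¹
  | add {f g : Space3 → ℂ} : WaveAlgebra ξ f → WaveAlgebra ξ g → WaveAlgebra ξ fun y => f y + g y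
  | mul {f g : Space3 → ℂ} : WaveAlgebra ξ f → WaveAlgebra ξ g → WaveAlgebra ξ fun y => f y * g y

lemma hasFDerivAt_ofReal_norm_sub {ξ y : Space3} (hy : y ≠ ξ) :
    HasFDerivAt (fun y : Space3 => ((‖y - ξ‖ : ℝ) : ℂ))
      (gradL fun i => ((y i - ξ i : ℝ) : ℂ) * ((‖y - ξ‖ : ℝ) : ℂ)⁻¹) y := by
  have h0 : ‖y - ξ‖ ≠ 0 := norm_ne_zero_iff.2 (sub_ne_zero.2 hy)
  have h1 : HasFDerivAt (fun y : Space3 => ‖y - ξ‖ ^ 2) (2 • innerSL ℝ (y - ξ)) y := by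
    simpa using ((hasFDerivAt_id y).sub_const ξ).norm_sq
  have h2 := h1.sqrt (by positivity)
  simp only [Real.sqrt_sq (norm_nonneg _)] at h2
  refine (Complex.ofRealCLM.hasFDerivAt.comp y h2).congr_fderiv ?_
  ext v
  simp [gradL_apply, Fin.sum_univ_three, PiLp.inner_apply]
  have h0' : ((‖y - ξ‖ : ℝ) : ℂ) ≠ 0 := by exact_mod_cast h0
  field_simp
  ring

namespace WaveAlgebra

variable {ξ : Space3} {f : Space3 → ℂ}

/-- Closure under differentiation away from ξ, which rests on ∂_i r = (y_i - ξ_i)/r. It makes all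
derivatives of e^{ikr}/r again e^{ikr} times elements of the algebra. -/
lemma exists_hasFDerivAt (hf : WaveAlgebra ξ f) :
    ∃ a : Fin 3 → Space3 → ℂ, (∀ i, WaveAlgebra ξ (a i)) ∧
      ∀ y, y ≠ ξ → HasFDerivAt f (gradL fun i => a i y) y := by
  induction hf with
  | const c =>
    refine ⟨fun _ _ => 0, fun _ => .const 0, fun y _ => ?_⟩
    refine (hasFDerivAt_const c y).congr_fderiv ?_
    ext v
    simp [gradL_apply]
  | coord j =>
    refine ⟨fun i _ => kron i j, fun i => .const _, fun y _ => ?_⟩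
    have hp : HasFDerivAt (fun y : Space3 => ((y j - ξ j : ℝ) : ℂ))
        (Complex.ofRealCLM.comp (EuclideanSpace.proj j : Space3 →L[ℝ] ℝ)) y := by
      have := (Complex.ofRealCLM.comp (EuclideanSpace.proj j : Space3 →L[ℝ] ℝ)).hasFDerivAt (x := y)
      simpa using this.sub_const ((ξ j : ℝ) : ℂ)
    refine hp.congr_fderiv ?_
    ext v
    simp [gradL_apply, kron]
  | inv =>
    refine ⟨fun i y => -1 * (((y i - ξ i : ℝ) : ℂ) * (((‖y - ξ‖ : ℝ) : ℂ)⁻¹ *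
      (((‖y - ξ‖ : ℝ) : ℂ)⁻¹ * ((‖y - ξ‖ : ℝ) : ℂ)⁻¹))), fun i => ?_, fun y hy => ?_⟩
    · exact (WaveAlgebra.const _).mul ((WaveAlgebra.coord i).mul (WaveAlgebra.inv.mul
        (WaveAlgebra.inv.mul .inv)))
    · have h0 : ((‖y - ξ‖ : ℝ) : ℂ) ≠ 0 := by simpa [sub_eq_zero] using hy
      have := (hasDerivAt_inv h0).hasFDerivAt.restrictScalars ℝ |>.comp y
        (hasFDerivAt_ofReal_norm_sub hy)
      refine this.congr_fderiv ?_
      ext v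
      simp [gradL_apply, Fin.sum_univ_three]
      field_simp
      ring
  | @add f g hf hg ihf ihg =>
    obtain ⟨a, ha, ha'⟩ := ihf
    obtain ⟨b, hb, hb'⟩ := ihg
    refine ⟨fun i y => a i y + b i y, fun i => (ha i).add (hb i), fun y hy => ?_⟩
    refine ((ha' y hy).add (hb' y hy)).congr_fderiv ?_
    ext v
    simp [gradL_apply, Fin.sum_univ_three]
    ring
  | @mul f g hf hg ihf ihg =>
    obtain ⟨a, ha, ha'⟩ := ihf
    obtain ⟨b, hb, hb'⟩ := ihg
    refine ⟨fun i y => f y * b i y + a i y * g y,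
      fun i => (hf.mul (hb i)).add ((ha i).mul hg), fun y hy => ?_⟩
    refine ((ha' y hy).mul (hb' y hy)).congr_fderiv ?_
    ext v
    simp [gradL_apply, Fin.sum_univ_three]
    ring

lemma exists_norm_le (hf : WaveAlgebra ξ f) :
    ∃ (C : ℝ) (n : ℕ), 0 ≤ C ∧ ∀ y, 1 ≤ ‖y - ξ‖ → ‖f y‖ ≤ C * ‖y - ξ‖ ^ n := by
  induction hf with
  | const c => exact ⟨‖c‖, 0, norm_nonneg c, by simp⟩
  | coord i =>
    refine ⟨1, 1, zero_le_one, fun y _ => ?_⟩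
    have := PiLp.norm_apply_le (y - ξ) i
    rw [Complex.norm_real]
    simpa using this
  | inv =>
    refine ⟨1, 0, zero_le_one, fun y hy => ?_⟩
    rw [norm_inv, Complex.norm_real, norm_norm]
    simpa using inv_le_one_of_one_le₀ hy
  | @add f g hf hg ihf ihg =>
    obtain ⟨C, n, hC, hf⟩ := ihf
    obtain ⟨D, m, hD, hg⟩ := ihg
    refine ⟨C + D, n + m, by positivity, fun y hy => ?_⟩
    have hn : ‖y - ξ‖ ^ n ≤ ‖y - ξ‖ ^ (n + m) := pow_le_pow_right₀ hy (by lia)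
    have hm : ‖y - ξ‖ ^ m ≤ ‖y - ξ‖ ^ (n + m) := pow_le_pow_right₀ hy (by lia)
    rw [add_mul]
    refine (norm_add_le _ _).trans (add_le_add ((hf y hy).trans ?_) ((hg y hy).trans ?_)) <;> gcongr
  | @mul f g hf hg ihf ihg =>
    obtain ⟨C, n, hC, hf⟩ := ihf
    obtain ⟨D, m, hD, hg⟩ := ihg
    refine ⟨C * D, n + m, by positivity, fun y hy => ?_⟩
    rw [norm_mul, pow_add]
    calc _ ≤ (C * ‖y - ξ‖ ^ n) * (D * ‖y - ξ‖ ^ m) :=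
          mul_le_mul (hf y hy) (hg y hy) (norm_nonneg _) (by positivity)
      _ = _ := by ring

end WaveAlgebra

/-- Off `ξ`, the function is `e^{ikr}` times an element of the algebra `WaveAlgebra`. -/
def IsWave (k : ℂ) (ξ : Space3) (f : Space3 → ℂ) : Prop :=
  ∃ p, WaveAlgebra ξ p ∧ ∀ y, y ≠ ξ → f y = Complex.exp (Complex.I * k * ((‖y - ξ‖ : ℝ) : ℂ)) * p y

namespace IsWave

variable {k : ℂ} {ξ : Space3} {f g : Space3 → ℂ}

lemma sphericalWave (k : ℂ) (ξ : Space3) : IsWave k ξ (ZenerMedium.sphericalWave k ξ) :=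
  ⟨_, .inv, fun _ _ => div_eq_mul_inv _ _⟩

lemma add (hf : IsWave k ξ f) (hg : IsWave k ξ g) : IsWave k ξ fun y => f y + g y := by
  obtain ⟨p, hp, hf⟩ := hf
  obtain ⟨q, hq, hg⟩ := hg
  exact ⟨_, hp.add hq, fun y hy => by simp only [hf y hy, hg y hy]; ring⟩

lemma const_mul (hf : IsWave k ξ f) (c : ℂ) : IsWave k ξ fun y => c * f y := by
  obtain ⟨p, hp, hf⟩ := hf
  exact ⟨_, (WaveAlgebra.const c).mul hp, fun y hy => by simp only [hf y hy]; ring⟩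

lemma differentiableAt_and_pd (hf : IsWave k ξ f) :
    (∀ y, y ≠ ξ → DifferentiableAt ℝ f y) ∧ ∀ i, IsWave k ξ (pd i f) := by
  obtain ⟨p, hp, hf⟩ := hf
  obtain ⟨a, ha, hd⟩ := hp.exists_hasFDerivAt
  have key : ∀ y, y ≠ ξ → HasFDerivAt f (gradL fun i =>
      Complex.exp (Complex.I * k * ((‖y - ξ‖ : ℝ) : ℂ)) * (Complex.I * k *
        (((y i - ξ i : ℝ) : ℂ) * (((‖y - ξ‖ : ℝ) : ℂ)⁻¹ * p y)) + a i y)) y := by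
    intro y hy
    have h1 := (((hasFDerivAt_ofReal_norm_sub hy).const_mul (Complex.I * k)).cexp).mul (hd y hy)
    have h2 : f =ᶠ[𝓝 y] fun y => Complex.exp (Complex.I * k * ((‖y - ξ‖ : ℝ) : ℂ)) * p y := by
      filter_upwards [isOpen_ne.mem_nhds hy] with z hz using hf z hz
    refine (h1.congr_of_eventuallyEq h2).congr_fderiv ?_
    ext v
    simp [gradL_apply, Fin.sum_univ_three]
    ring
  refine ⟨fun y hy => (key y hy).differentiableAt, fun i => ⟨_, ?_, fun y hy => (key y hy).pd_eq i⟩⟩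
  exact ((WaveAlgebra.const _).mul ((WaveAlgebra.coord i).mul (WaveAlgebra.inv.mul hp))).add (ha i)

lemma pd (hf : IsWave k ξ f) (i : Fin 3) : IsWave k ξ (pd i f) := hf.differentiableAt_and_pd.2 i

lemma differentiableAt (hf : IsWave k ξ f) {y : Space3} (hy : y ≠ ξ) : DifferentiableAt ℝ f y :=
  hf.differentiableAt_and_pd.1 y hy

/-- Along the ray r is at least t - |x - ξ|, and |e^{ikr}| = e^{-r Im k} outweighs both the
polynomial growth of the algebra element and the factor t. -/
lemma tendsto (hf : IsWave k ξ f) (hk : 0 < k.im) (x : Space3) {θ : Space3} (hθ : ‖θ‖ = 1) :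
    Tendsto (fun t : ℝ => (t : ℂ) * f (x + t • θ)) atTop (𝓝 0) := by
  obtain ⟨p, hp, hf⟩ := hf
  obtain ⟨C, n, hC, hb⟩ := hp.exists_norm_le
  set K := ‖x - ξ‖ with hK
  have hK0 : 0 ≤ K := norm_nonneg _
  have hlow : ∀ t : ℝ, 0 ≤ t → t - K ≤ ‖x + t • θ - ξ‖ := by
    intro t ht
    have h1 : t • θ = (x + t • θ - ξ) - (x - ξ) := by abel
    have h2 := norm_sub_le (x + t • θ - ξ) (x - ξ)
    rw [← h1, norm_smul, hθ, Real.norm_of_nonneg ht] at h2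
    linarith
  have hr : Tendsto (fun t : ℝ => ‖x + t • θ - ξ‖) atTop atTop := by
    refine tendsto_atTop_mono' atTop ?_ (tendsto_atTop_add_const_right atTop (-K) tendsto_id)
    filter_upwards [eventually_ge_atTop 0] with t ht using hlow t ht
  have hlim : Tendsto (fun r : ℝ => C * (1 + K) * (r ^ (n + 1) * Real.exp (-k.im * r)))
      atTop (𝓝 0) := by
    have := tendsto_rpow_mul_exp_neg_mul_atTop_nhds_zero ((n + 1 : ℕ) : ℝ) k.im hk
    simp only [Real.rpow_natCast] at this
    simpa using this.const_mul (C * (1 + K))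
  refine squeeze_zero_norm' ?_ (hlim.comp hr)
  filter_upwards [eventually_ge_atTop (1 + K)] with t ht
  have hl := hlow t (by linarith)
  have h1 : 1 ≤ ‖x + t • θ - ξ‖ := by linarith
  have hne : x + t • θ ≠ ξ := fun h => by rw [h] at h1; simp at h1; linarith
  have hp' := hb _ h1
  set r := ‖x + t • θ - ξ‖
  have he : ‖Complex.exp (Complex.I * k * ((r : ℝ) : ℂ))‖ = Real.exp (-k.im * r) := by
    rw [Complex.norm_exp]
    simp
  -- From t ≤ r + K and r ≥ 1.
  have ht' : t ≤ (1 + K) * r := by nlinarith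
  rw [hf _ hne, norm_mul, norm_mul, he, Complex.norm_real, Real.norm_of_nonneg (by linarith)]
  calc t * (Real.exp (-k.im * r) * ‖p (x + t • θ)‖)
      ≤ ((1 + K) * r) * (Real.exp (-k.im * r) * (C * r ^ n)) := by gcongr
    _ = _ := by simp only [Function.comp]; ring

end IsWave

namespace ZenerMedium

variable {M : ZenerMedium}

/-- Off the source, `u*` is the sum of a pressure wave and a shear wave. -/
lemma exists_uStar_eq_waves (M : ZenerMedium) (ξ : Space3) (i j : Fin 3) :
    ∃ f g : Space3 → ℂ, IsWave M.k₁ ξ f ∧ IsWave M.k₂ ξ g ∧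
      ∀ y, y ≠ ξ → M.uStar ξ y i j = f y + g y := by
  have w₁ := IsWave.sphericalWave M.k₁ ξ
  have w₂ := IsWave.sphericalWave M.k₂ ξ
  refine ⟨_, _, ((w₁.pd j).pd i).const_mul
      (1 / (4 * (Real.pi : ℂ) * (M.mu : ℂ)) * (-(1 / M.k₂ ^ 2))),
    ((((w₂.pd j).pd i).const_mul (1 / M.k₂ ^ 2)).add (w₂.const_mul (kron i j))).const_mul
      (1 / (4 * (Real.pi : ℂ) * (M.mu : ℂ))), fun y hy => ?_⟩
  have h1 : pd j (M.waveDiff ξ) =ᶠ[𝓝 y] fun z => pd j (sphericalWave M.k₂ ξ) z -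
      pd j (sphericalWave M.k₁ ξ) z := by
    filter_upwards [isOpen_ne.mem_nhds hy] with z hz
    exact pd_sub (w₂.differentiableAt hz) (w₁.differentiableAt hz) j
  rw [uStar_eq hy, (h1.pd_eventuallyEq i).eq_of_nhds,
    pd_sub ((w₂.pd j).differentiableAt hy) ((w₁.pd j).differentiableAt hy)]
  ring

lemma im_pos_of_mem_slitPlane {k : ℂ} (hI : Complex.I * k = -Complex.sqrt (-k ^ 2))
    (hk : -k ^ 2 ∈ Complex.slitPlane) : 0 < k.im := by
  have h1 := Complex.re_sqrt_pos hk
  have h2 := congrArg Complex.re hI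
  simp at h2
  linarith

end ZenerMedium

/-! ### Horizontal decay of mode superpositions -/

namespace SymbolOn

variable {h : ℝ} {f : Plane2 → ℂ}

lemma integrable (hf : SymbolOn Set.univ h f) (hh : 0 < h) : Integrable f := by
  have := (hf.modeCoeff isOpen_univ).integrable 0 0 hh
  have hm := (hf.modeCoeff isOpen_univ).meas
  rw [Measure.restrict_univ] at hm
  rw [integrableOn_univ] at this
  simp only [pow_zero, zero_mul, Real.exp_zero, one_mul] at this
  exact (integrable_norm_iff hm).1 this

lemma integrable_fderiv (hf : SymbolOn Set.univ h f) (hh : 0 < h) (v : Plane2) :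
    Integrable fun η => fderiv ℝ f η v := by
  obtain ⟨C, n, hC, hb⟩ := hf
  refine ((integrable_one_add_norm_pow_mul_exp n hh).const_mul (C * ‖v‖)).mono'
    (measurable_fderiv_apply_const ℝ f v).aestronglyMeasurable (ae_of_all _ fun η => ?_)
  calc _ ≤ ‖fderiv ℝ f η‖ * ‖v‖ := ContinuousLinearMap.le_opNorm _ _
    _ ≤ C * ((1 + ‖η‖) ^ n * Real.exp (-(h * ‖η‖))) * ‖v‖ := by
        gcongr
        exact (hb η trivial).2.2
    _ = _ := by ring

end SymbolOn

/-- The Riemann–Lebesgue lemma along a ray; the factor -1/(2π) matches the normalisation of the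
Fourier character. -/
lemma tendsto_integral_exp_inner (f : Plane2 → ℂ) (y : Plane2) {v : Plane2} (hv : ‖v‖ = 1) :
    Tendsto (fun t : ℝ => ∫ η, f η * Complex.exp (Complex.I * (inner ℝ (y + t • v) η : ℝ)))
      atTop (𝓝 0) := by
  have hlim : Tendsto (fun t : ℝ => (-(2 * Real.pi)⁻¹) • (y + t • v)) atTop (cocompact Plane2) := by
    rw [← Metric.cobounded_eq_cocompact, ← tendsto_norm_atTop_iff_cobounded]
    have h1 : Tendsto (fun t : ℝ => (2 * Real.pi)⁻¹ * (t + -‖y‖)) atTop atTop :=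
      (tendsto_atTop_add_const_right atTop _ tendsto_id).const_mul_atTop (by positivity)
    refine tendsto_atTop_mono' atTop ?_ h1
    filter_upwards [eventually_ge_atTop 0] with t ht
    rw [norm_smul, norm_neg, Real.norm_of_nonneg (by positivity)]
    gcongr
    have h2 := norm_sub_le (y + t • v) y
    rw [add_sub_cancel_left, norm_smul, hv, Real.norm_of_nonneg ht] at h2
    linarith
  refine ((tendsto_integral_exp_inner_smul_cocompact f).comp hlim).congr fun t => ?_
  refine integral_congr_ae (ae_of_all _ fun η => ?_)
  simp only
  rw [Circle.smul_def, Real.fourierChar_apply, smul_eq_mul, mul_comm, inner_smul_right,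
    real_inner_comm]
  congr 2
  push_cast
  have : (Real.pi : ℂ) ≠ 0 := by exact_mod_cast Real.pi_ne_zero
  field_simp

/-- Since ∂_v e^{i⟨y+tv,η⟩} = i(⟨y,v⟩ + t)e^{i⟨y+tv,η⟩}, integration by parts trades the factor t
for ∂_v f plus a term with a fixed coefficient. Riemann–Lebesgue then applies to both integrals.
This is why the symbols must be differentiable on the whole plane. -/
lemma SymbolOn.tendsto_mul_integral {h : ℝ} (hh : 0 < h) {f : Plane2 → ℂ}
    (hf : SymbolOn Set.univ h f) (y : Plane2) {v : Plane2} (hv : ‖v‖ = 1) :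
    Tendsto (fun t : ℝ => (t : ℂ) *
      ∫ η, f η * Complex.exp (Complex.I * (inner ℝ (y + t • v) η : ℝ))) atTop (𝓝 0) := by
  have hfi := hf.integrable hh
  have hfd := hf.integrable_fderiv hh v
  have key : ∀ t : ℝ, (t : ℂ) * ∫ η, f η * Complex.exp (Complex.I * (inner ℝ (y + t • v) η : ℝ)) =
      Complex.I * (∫ η, fderiv ℝ f η v * Complex.exp (Complex.I * (inner ℝ (y + t • v) η : ℝ))) -
      (inner ℝ y v : ℝ) * ∫ η, f η * Complex.exp (Complex.I * (inner ℝ (y + t • v) η : ℝ)) := by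
    intro t
    set e : Plane2 → ℂ := fun η => Complex.exp (Complex.I * (inner ℝ (y + t • v) η : ℝ)) with he
    have hd : ∀ η, HasFDerivAt e (e η • (Complex.I • (Complex.ofRealCLM.comp
        (innerSL ℝ (y + t • v))))) η := fun η =>
      ((Complex.ofRealCLM.comp (innerSL ℝ (y + t • v))).hasFDerivAt.const_mul Complex.I).cexp
    have hdv : ∀ η, fderiv ℝ e η v = Complex.I * ((inner ℝ y v : ℝ) + t) * e η := by
      intro η
      rw [(hd η).fderiv]
      simp [hv]
      ring
    have hec : Continuous e := by rw [he]; fun_prop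
    have hen : ∀ η, ‖e η‖ ≤ 1 := fun η => (norm_exp_I_mul_real _).le
    have i1 : Integrable fun η => f η * e η :=
      hfi.mul_bdd hec.aestronglyMeasurable (ae_of_all _ hen)
    have i2 : Integrable fun η => fderiv ℝ f η v * e η :=
      hfd.mul_bdd hec.aestronglyMeasurable (ae_of_all _ hen)
    have hfun : (fun η => f η * fderiv ℝ e η v) = fun η =>
        Complex.I * ((inner ℝ y v : ℝ) + t) * (f η * e η) := by
      ext η
      rw [hdv]
      ring
    have i3 : Integrable fun η => f η * fderiv ℝ e η v := by
      rw [hfun]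
      exact i1.const_mul _
    have hp := integral_mul_fderiv_eq_neg_fderiv_mul_of_integrable (μ := volume) i2 i3 i1
      (fun η _ => hf.differentiableAt trivial) (fun η _ => (hd η).differentiableAt)
    rw [hfun, integral_const_mul] at hp
    linear_combination -Complex.I * hp + ((inner ℝ y v : ℝ) + t) * (∫ η, f η * e η) * Complex.I_sq
  simp only [key]
  have l1 := (tendsto_integral_exp_inner (fun η => fderiv ℝ f η v) y hv).const_mul Complex.I
  have l2 := (tendsto_integral_exp_inner f y hv).const_mul ((inner ℝ y v : ℝ) : ℂ)
  simpa using l1.sub l2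

namespace ZenerMedium

variable {M : ZenerMedium} {ξ : Space3}

lemma horizontal_add_smul (ξ x θ : Space3) (t : ℝ) :
    horizontal ξ (x + t • θ) = horizontal ξ x + t • horizontal 0 θ := by
  ext i
  fin_cases i <;> simp [horizontal] <;> ring

lemma norm_horizontal {θ : Space3} (h : θ 2 = 0) : ‖horizontal 0 θ‖ = ‖θ‖ := by
  rw [← sq_eq_sq₀ (norm_nonneg _) (norm_nonneg _), norm_sq_plane, norm_sq_space, h]
  simp [horizontal]

lemma tendsto_mul_modeInt {k : ℂ} (hk : AvoidsBranch (-k ^ 2) Set.univ) {h : ℝ} (hh : 0 < h)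
    {A : Plane2 → ℂ} (hA : SymbolOn Set.univ h A) {x θ : Space3} (hx : x 2 ≤ 0) (hθ : θ 2 = 0)
    (hθ1 : ‖θ‖ = 1) :
    Tendsto (fun t : ℝ => (t : ℂ) * modeInt Set.univ (beta k) ξ A (x + t • θ)) atTop (𝓝 0) := by
  have hf : SymbolOn Set.univ (h + -x 2) fun η => A η * Complex.exp (beta k η * (x 2 : ℂ)) := by
    simp only [beta_eq_decayExp]
    exact hA.mul (hk.symbolOn_exp hx)
  refine (hf.tendsto_mul_integral (by linarith) (horizontal ξ x)
    (v := horizontal 0 θ) (by rw [norm_horizontal hθ, hθ1])).congr fun t => ?_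
  rw [modeInt, setIntegral_univ]
  congr 2
  ext η
  rw [mode, planeWave_eq, horizontal_add_smul]
  have : (x + t • θ) 2 = x 2 := by simp [hθ]
  rw [this]
  ring

lemma fderiv_apply_eq (f : Space3 → ℂ) (x v : Space3) :
    fderiv ℝ f x v = ∑ i, (v i : ℂ) * pd i f x := by
  rw [fderiv_eq_gradL, gradL_apply]

lemma add_smul_coord {x θ : Space3} (hθ : θ 2 = 0) (t : ℝ) : (x + t • θ) 2 = x 2 := by simp [hθ]

lemma tendsto_mul_downField (hS : M.IsGoodSet Set.univ) (hξ : ξ 2 < 0) {x θ : Space3}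
    (hx : x 2 ≤ 0) (hθ : θ 2 = 0) (hθ1 : ‖θ‖ = 1) (m j : Fin 3) :
    Tendsto (fun t : ℝ => (t : ℂ) * M.downField Set.univ ξ m j (x + t • θ)) atTop (𝓝 0) := by
  have hh : 0 < -ξ 2 := neg_pos.2 hξ
  have h1 := tendsto_mul_modeInt (ξ := ξ) hS.avoids₁ hh (hS.symbolOn_downP hξ.le m j) hx hθ hθ1
  have h2 := tendsto_mul_modeInt (ξ := ξ) hS.avoids₂ hh (hS.symbolOn_downS hξ.le m j) hx hθ hθ1
  have := h1.add h2
  rw [add_zero] at this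
  refine this.congr fun t => ?_
  rw [downField, modePair]
  ring

lemma tendsto_mul_pd_downField (hS : M.IsGoodSet Set.univ) (hξ : ξ 2 < 0) {x θ : Space3}
    (hx : x 2 ≤ 0) (hθ : θ 2 = 0) (hθ1 : ‖θ‖ = 1) (m j i : Fin 3) :
    Tendsto (fun t : ℝ => (t : ℂ) * pd i (M.downField Set.univ ξ m j) (x + t • θ)) atTop (𝓝 0) := by
  have hh : 0 < -ξ 2 := neg_pos.2 hξ
  have h1 := tendsto_mul_modeInt (ξ := ξ) hS.avoids₁ hh ((symbolOn_modeGrad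
    (symbolOn_beta hS.avoids₁) i).mul_left (hS.symbolOn_downP hξ.le m j)) hx hθ hθ1
  have h2 := tendsto_mul_modeInt (ξ := ξ) hS.avoids₂ hh ((symbolOn_modeGrad
    (symbolOn_beta hS.avoids₂) i).mul_left (hS.symbolOn_downS hξ.le m j)) hx hθ hθ1
  have := h1.add h2
  rw [add_zero] at this
  refine this.congr fun t => ?_
  have hU : x + t • θ ∈ {y : Space3 | y 2 < -ξ 2} := by
    change (x + t • θ) 2 < -ξ 2
    rw [add_smul_coord hθ]
    linarith
  have cP := hS.modeCoeff_downP hξ m j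
  have cS := hS.modeCoeff_downS hξ m j
  have e₁ := isModeExponent_beta M.k₁ hh
  have e₂ := isModeExponent_beta M.k₂ hh
  have := pd_add (cP.contDiffAt e₁ ξ hU).differentiableAt_infty
    (cS.contDiffAt e₂ ξ hU).differentiableAt_infty i
  rw [cP.pd_modeInt e₁ ξ hU, cS.pd_modeInt e₂ ξ hU] at this
  change _ = (t : ℂ) * pd i (fun y => modeInt Set.univ (beta M.k₁) ξ (M.downP ξ m j) y +
    modeInt Set.univ (beta M.k₂) ξ (M.downS ξ m j) y) (x + t • θ)
  rw [this]
  ring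

/-- The two terms of Sommerfeld's difference are each o(1/t), so no cancellation is needed and the
wave number k is arbitrary. -/
lemma radiatesHorizontally_of_tendsto {f : Space3 → ℂ}
    (h0 : ∀ x θ : Space3, x 2 ≤ 0 → θ 2 = 0 → ‖θ‖ = 1 →
      Tendsto (fun t : ℝ => (t : ℂ) * f (x + t • θ)) atTop (𝓝 0))
    (h1 : ∀ i, ∀ x θ : Space3, x 2 ≤ 0 → θ 2 = 0 → ‖θ‖ = 1 →
      Tendsto (fun t : ℝ => (t : ℂ) * pd i f (x + t • θ)) atTop (𝓝 0)) (k : ℂ) :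
    RadiatesHorizontally k f := by
  intro x θ hx hθ hθ1
  have l0 := (h0 x θ hx hθ hθ1).const_mul (Complex.I * k)
  have l1 := tendsto_finsetSum Finset.univ fun i _ =>
    (h1 i x θ hx hθ hθ1).const_mul (θ i : ℂ)
  have := l1.sub l0
  simp only [mul_zero, Finset.sum_const_zero, sub_zero] at this
  refine this.congr fun t => ?_
  rw [fderiv_apply_eq, mul_sub, Finset.mul_sum]
  congr 1
  · exact Finset.sum_congr rfl fun i _ => by ring
  · ring

lemma eventually_add_smul_ne (x ξ : Space3) {θ : Space3} (hθ : ‖θ‖ = 1) :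
    ∀ᶠ t : ℝ in atTop, x + t • θ ≠ ξ := by
  filter_upwards [eventually_gt_atTop ‖ξ - x‖] with t ht h
  have h1 : t • θ = ξ - x := by rw [← h]; abel
  have h2 : ‖t • θ‖ = t := by
    rw [norm_smul, hθ, mul_one, Real.norm_of_nonneg ((norm_nonneg _).trans ht.le)]
  rw [h1] at h2
  linarith

/-- In an absorbing medium the half-space Green function radiates horizontally. -/
lemma radiatesHorizontally_green (hM : M.IsRegular) (h₁ : -M.k₁ ^ 2 ∈ Complex.slitPlane)
    (h₂ : -M.k₂ ^ 2 ∈ Complex.slitPlane) (hS : M.IsGoodSet Set.univ) (hξ : ξ 2 < 0)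
    (j m : Fin 3) (k : ℂ) :
    RadiatesHorizontally k fun y => M.uStar ξ y j m + M.correction Set.univ ξ y j m := by
  have p₁ := im_pos_of_mem_slitPlane hM.I_mul_k₁ h₁
  have p₂ := im_pos_of_mem_slitPlane hM.I_mul_k₂ h₂
  obtain ⟨f, g, hf, hg, hu⟩ := exists_uStar_eq_waves M ξ j m
  have heq : ∀ y : Space3, y ≠ ξ → M.uStar ξ y j m + M.correction Set.univ ξ y j m =
      (f y + g y) + M.downField Set.univ ξ m j y := fun y hy => by
    rw [hu y hy, correction_univ]
  refine radiatesHorizontally_of_tendsto (fun x θ hx hθ hθ1 => ?_)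
    (fun i x θ hx hθ hθ1 => ?_) k
  · have := ((hf.tendsto p₁ x hθ1).add (hg.tendsto p₂ x hθ1)).add
      (tendsto_mul_downField hS hξ hx hθ hθ1 m j)
    simp only [add_zero] at this
    refine this.congr' ?_
    filter_upwards [eventually_add_smul_ne x ξ hθ1] with t ht
    rw [heq _ ht]
    ring
  · have := (((hf.pd i).tendsto p₁ x hθ1).add ((hg.pd i).tendsto p₂ x hθ1)).add
      (tendsto_mul_pd_downField hS hξ hx hθ hθ1 m j i)
    simp only [add_zero] at this
    refine this.congr' ?_
    filter_upwards [eventually_add_smul_ne x ξ hθ1] with t ht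
    have hE : (fun y => M.uStar ξ y j m + M.correction Set.univ ξ y j m) =ᶠ[𝓝 (x + t • θ)]
        fun y => (f y + g y) + M.downField Set.univ ξ m j y := by
      filter_upwards [isOpen_ne.mem_nhds ht] with y hy using heq y hy
    have d1 := hf.differentiableAt ht
    have d2 := hg.differentiableAt ht
    have d3 := (hS.contDiffAt_downField hξ (x := x + t • θ)
      (by rwa [add_smul_coord hθ]) m j).differentiableAt_infty
    rw [(hE.pd_eventuallyEq i).eq_of_nhds, pd_add (f := fun y => f y + g y) (d1.add d2) d3, pd_add d1 d2]
    ring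

end ZenerMedium

end

/-! ### The theorem -/

theorem theorem1 (M : ZenerMedium)
    (hmu : 0 < M.mu) (hlam : 0 < M.lam + M.mu) (hrho : 0 < M.rho) (hω : M.omega ≠ 0)
    (hp : 0 ≤ M.p) (hq : 0 ≤ M.q) (hα : M.alpha ∈ Set.Icc (0 : ℝ) 1)
    (H : M.HypothesisH) :
    -- the plane-wave expansion of the two scalar waves from which `u*` is built
    (∀ k ∈ ({M.k₁, M.k₂} : Set ℂ), ∀ ξ x : Space3, x 2 ≠ ξ 2 →
      MeasureTheory.Integrable (ZenerMedium.waveIntegrand k ξ x) ∧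
      ZenerMedium.sphericalWave k ξ x =
        1 / (2 * (Real.pi : ℂ)) * ∫ η, ZenerMedium.waveIntegrand k ξ x η) ∧
    -- `u*` is a fundamental solution on the whole space
    (∀ ξ : Space3, M.SolvesPointForce Set.univ ξ (M.uStar ξ)) ∧
    -- the correction term
    ∃ w : Space3 → Space3 → Fin 3 → Fin 3 → ℂ, ∀ ξ ∈ halfSpace,
      -- `w` is smooth up to the boundary and solves the homogeneous equation
      (∀ j m, ∀ x : Space3, x 2 ≤ 0 → ContDiffAt ℝ ∞ (fun y => w ξ y j m) x) ∧
      (∀ j m, ∀ x ∈ halfSpace, M.L (fun i y => w ξ y i m) j x = 0) ∧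
      -- `g = u* + w` solves the point-force equation in the half-space
      M.SolvesPointForce halfSpace ξ (fun x j m => M.uStar ξ x j m + w ξ x j m) ∧
      -- `g` has zero traction on the boundary
      (∀ j m, ∀ x : Space3, x 2 = 0 →
        M.traction (fun i y => M.uStar ξ y i m + w ξ y i m) j x = 0) ∧
      -- in the viscoelastic case `w` is given by the Fourier integrals, and `g` radiates
      (M.p ≠ M.q → M.alpha ≠ 0 →
        (∀ j m, ∀ x : Space3, x 2 ≤ 0 →
          MeasureTheory.Integrable (M.wIntegrand ξ x j m) ∧
          w ξ x j m = ∫ η, M.wIntegrand ξ x j m η) ∧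
        (∀ k ∈ ({M.k₁, M.k₂} : Set ℂ), ∀ j m,
          ZenerMedium.RadiatesHorizontally k (fun y => M.uStar ξ y j m + w ξ y j m))) := by
  have hM := ZenerMedium.isRegular hmu hlam hrho hω hp hq hα
  have hslit : M.p ≠ M.q → M.alpha ≠ 0 →
      -M.k₁ ^ 2 ∈ Complex.slitPlane ∧ -M.k₂ ^ 2 ∈ Complex.slitPlane := fun hpq h0 =>
    ZenerMedium.neg_sq_mem_slitPlane hlam hmu hrho
      (ZenerMedium.im_dampedSq_ne_zero hω hq hα hpq h0)
  -- The set S depends only on the medium, so a single w serves all sources and both cases: S is the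
  -- whole plane in the viscoelastic case and the exterior of a large disc otherwise.
  obtain ⟨S, hS, hSu⟩ : ∃ S, M.IsGoodSet S ∧ (M.p ≠ M.q → M.alpha ≠ 0 → S = Set.univ) := by
    by_cases h : M.p ≠ M.q ∧ M.alpha ≠ 0
    · obtain ⟨h₁, h₂⟩ := hslit h.1 h.2
      exact ⟨_, ZenerMedium.isGoodSet_univ hM h₁ h₂ (H h.1 h.2), fun _ _ => rfl⟩
    · obtain ⟨S, hS⟩ := hM.exists_isGoodSet
      exact ⟨S, hS, fun h1 h2 => absurd ⟨h1, h2⟩ h⟩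
  refine ⟨fun k hk ξ x hx => ZenerMedium.planeWave_expansion (hM.wave hk).1 (hM.wave hk).2 hx,
    hM.solvesPointForce_uStar, M.correction S, fun ξ hξ => ?_⟩
  refine ⟨fun j m x hx => hS.contDiffAt_correction hM hξ hx j m,
    fun j m x hx => hS.L_correction hM hξ (le_of_lt hx) j m, hS.solvesPointForce hM hξ,
    fun j m x hx => hS.traction_uStar_add_correction hM hξ hx j m, fun hpq h0 => ?_⟩
  obtain ⟨h₁, h₂⟩ := hslit hpq h0
  obtain rfl := hSu hpq h0
  exact ⟨fun j m x hx => ZenerMedium.integrable_wIntegrand hM hS hξ (H hpq h0 ξ hξ) hx j m,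
    fun k _ j m => ZenerMedium.radiatesHorizontally_green hM h₁ h₂ hS hξ j m k⟩
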